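/- Let $p,q,r:\mathbb R\to\mathbb R$ with $1/p,q,r\in L^1_{\mathrm{loc}}(\mathbb R)$ and $p>0$ a.e., and let $c\in\mathbb R$ be such that $r>0$ a.e. on $(c,\infty)$ and $r<0$ a.e. on $(-\infty,c)$. Put $\ell=\frac1{|r|}\bigl(-\frac{d}{dx}p\frac{d}{dx}+q\bigr)$ and let $\mathcal D$ be the set of all $f\in L^2_{|r|}(\mathbb R)$ such that $f$ and $pf'$ are locally absolutely continuous and $\ell f\in L^2_{|r|}(\mathbb R)$. Assume that the maximal operator $Af=\ell f$, $\operatorname{dom}A=\mathcal D$, is selfadjoint in $L^2_{|r|}(\mathbb R)$ and that $\min\sigma(A)>0$. Let $(Jf)(x)=\operatorname{sgn}(r(x))f(x)$, so that $JA$ has domain $\mathcal D$. Let $\mathcal D_+$ and $\mathcal D_-$ be the sets of restrictions of functions of $\mathcal D$ to $(c,\infty)$ and to $(-\infty,c)$, and let $B_\pm h=\ell h$, $\operatorname{dom}B_\pm=\{h\in\mathcal D_\pm: h(c)=0\}$, be the Dirichlet operators in $L^2_{|r|}(c,\infty)$ and $L^2_{|r|}(-\infty,c)$, respectively. Put $B=B_+\oplus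 B_-$ and $JB=B_+\oplus(-B_-)$, operators in $L^2_{|r|}(\mathbb R)=L^2_{|r|}(c,\infty)\oplus L^2_{|r|}(-\infty,c)$. For $\lambda\in\rho(B_\pm)$ let $$m_\pm(\lambda)=\frac{(pu')(c)}{u(c)},$$ where $u\in\mathcal D_\pm$ is a nontrivial solution of $\ell u=\lambda u$ on the respective half-line (it is unique up to a constant multiple), and let $$M(\lambda)=m_+(\lambda)-m_-(-\lambda),\qquad \lambda\in\rho(B_+)\cap\rho(-B_-).$$ For a closed operator $T$ let $\sigma_{\mathrm{ess}}(T)$ be the set of all $\lambda\in\mathbb C$ such that $T-\lambda$ is not Fredholm, and let $\sigma_p(T)$ be the set of eigenvalues of $T$. A zero of a function is a point of its domain at which it vanishes ($m_+-m_-$ has the domain $\rho(B_+)\cap\rho(B_-)$). A pole is a point with a punctured neighbourhood in the domain at which the function is meromorphic with negative order. 1. For every $\lambda\in\mathbb C\setminus\sigma_{\mathrm{ess}}(JA)$: (i) $\lambda\in\sigma_p(JA)$ if and only if $\lambda$ is a zero of $M$; (ii) $\lambda\in\sigma_p(JB)$ if and only if $\lambda$ is a pole of $M$. 2. For every $\lambda\in\mathbb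 C\setminus\sigma_{\mathrm{ess}}(A)$: (i) $\lambda\in\sigma_p(A)$ if and only if $\lambda$ is either a zero of $m_+-m_-$ or a pole of both $m_+$ and $m_-$; (ii) $\lambda\in\sigma_p(B)$ if and only if $\lambda$ is a pole of $m_+$ or of $m_-$. -/

import Mathlib

open MeasureTheory Set Filter Topology
open scoped ENNReal

noncomputable section

/-! ### Spectral notions for unbounded operators -/

section Operators

variable {E : Type*} [NormedAddCommGroup E] [NormedSpace ℂ E]

/-- The map `T - z`, defined on the domain of the (unbounded) operator `T`. -/
def opShift (T : E →ₗ.[ℂ] E) (z : ℂ) : T.domain →ₗ[ℂ] E :=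
  T.toFun - z • T.domain.subtype

/-- The resolvent set: all `z` such that `T - z : dom T → E` has an everywhere defined bounded
two-sided inverse. -/
def opResolventSet (T : E →ₗ.[ℂ] E) : Set ℂ :=
  {z | ∃ R : E →L[ℂ] E,
    (∀ g : E, ∃ h : R g ∈ T.domain, opShift T z ⟨R g, h⟩ = g) ∧
    ∀ f : T.domain, R (opShift T z f) = (f : E)}

/-- The spectrum. -/
def opSpectrum (T : E →ₗ.[ℂ] E) : Set ℂ := (opResolventSet T)ᶜ

/-- The point spectrum: the set of all eigenvalues. -/
def opPointSpectrum (T : E →ₗ.[ℂ] E) : Set ℂ :=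
  {z | ∃ f : T.domain, (f : E) ≠ 0 ∧ T f = z • (f : E)}

/-- `T - z` is Fredholm: finite-dimensional kernel, closed range of finite codimension. -/
def OpShiftIsFredholm (T : E →ₗ.[ℂ] E) (z : ℂ) : Prop :=
  FiniteDimensional ℂ (LinearMap.ker (opShift T z)) ∧
  IsClosed (LinearMap.range (opShift T z) : Set E) ∧
  FiniteDimensional ℂ (E ⧸ LinearMap.range (opShift T z))

/-- The essential spectrum: all `z` such that `T - z` is not Fredholm. -/
def opEssSpectrum (T : E →ₗ.[ℂ] E) : Set ℂ := {z | ¬ OpShiftIsFredholm T z}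

end Operators

/-! ### Zeros and poles of a function with a given domain -/

/-- `z` is a zero of the function `F`, which has domain `U`. -/
def IsZeroOf (U : Set ℂ) (F : ℂ → ℂ) (z : ℂ) : Prop := z ∈ U ∧ F z = 0

/-- `z` is a pole of the function `F`, which has domain `U`: a punctured neighbourhood of `z`
lies in `U`, and `F` is meromorphic at `z` with negative order. (The order is `0` by convention
if `F` is not meromorphic at `z`, and it does not depend on `F z`.) -/
def IsPoleOf (U : Set ℂ) (F : ℂ → ℂ) (z : ℂ) : Prop :=
  (∀ᶠ w in 𝓝[≠] z, w ∈ U) ∧ meromorphicOrderAt F z < 0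

/-! ### Sturm-Liouville expressions -/

/-- `u` is locally absolutely continuous on `ℝ`. -/
def LocAC (u : ℝ → ℂ) : Prop := ∀ a b : ℝ, AbsolutelyContinuousOnInterval u a b

/-- Real coefficients `p, q, r` with `1/p, q, r` locally integrable and `p > 0` a.e., such that
the weight `r` is positive a.e. on `(c, ∞)` and negative a.e. on `(-∞, c)`. -/
structure SLCoeff where
  p : ℝ → ℝ
  q : ℝ → ℝ
  r : ℝ → ℝ
  c : ℝ
  inv_p_locInt : LocallyIntegrable (fun x => (p x)⁻¹) volume
  q_locInt : LocallyIntegrable q volume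
  r_locInt : LocallyIntegrable r volume
  p_pos : ∀ᵐ x, 0 < p x
  r_pos : ∀ᵐ x, c < x → 0 < r x
  r_neg : ∀ᵐ x, x < c → r x < 0

namespace SLCoeff

variable (S : SLCoeff)

/-- The measure `|r| dx`. -/
def μ : Measure ℝ := volume.withDensity (fun x => ENNReal.ofReal |S.r x|)

/-- The Hilbert space `L²_{|r|}(ℝ)`. -/
abbrev H : Type := Lp ℂ 2 S.μ

/-- The Hilbert space `L²_{|r|}(s)`, for an open set `s`. -/
abbrev HOn (s : Set ℝ) : Type := Lp ℂ 2 (S.μ.restrict s)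

/-- `u` and `v = p u'` are locally absolutely continuous and
`g = ℓ u = (1/|r|) (-(p u')' + q u)` almost everywhere. -/
def IsEll (u v g : ℝ → ℂ) : Prop :=
  LocAC u ∧ LocAC v ∧
  (∀ᵐ x, HasDerivAt u (v x / (S.p x : ℂ)) x) ∧
  (∀ᵐ x, HasDerivAt v ((S.q x : ℂ) * u x - ((|S.r x| : ℝ) : ℂ) * g x) x)

/-- `u` belongs to the maximal domain `𝓓`, with `v = p u'` and `g = ℓ u`. -/
def InD (u v g : ℝ → ℂ) : Prop :=
  S.IsEll u v g ∧ MemLp u 2 S.μ ∧ MemLp g 2 S.μ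

section Helpers

variable {S}

lemma r_ne_zero : ∀ᵐ x, S.r x ≠ 0 := by
  have hc : ∀ᵐ x : ℝ, x ≠ S.c := by
    simp [ae_iff, measure_singleton]
  filter_upwards [S.r_pos, S.r_neg, hc] with x h1 h2 h3
  rcases lt_or_gt_of_ne h3 with h | h
  · exact (h2 h).ne
  · exact (h1 h).ne'

lemma ae_mu_iff {P : ℝ → Prop} : (∀ᵐ x ∂S.μ, P x) ↔ ∀ᵐ x, P x := by
  have hm : AEMeasurable (fun x => ENNReal.ofReal |S.r x|) volume := by
    have := S.r_locInt.aestronglyMeasurable.aemeasurable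
    exact ((continuous_abs.measurable.comp_aemeasurable this)).ennreal_ofReal
  constructor
  · intro h
    exact (withDensity_absolutelyContinuous' hm (by
      filter_upwards [r_ne_zero (S := S)] with x hx
      simpa using hx)).ae_le h
  · intro h
    exact (withDensity_absolutelyContinuous _ _).ae_le h

lemma ae_mu_restrict_iff {s : Set ℝ} (hs : MeasurableSet s) {P : ℝ → Prop} :
    (∀ᵐ x ∂S.μ.restrict s, P x) ↔ ∀ᵐ x, x ∈ s → P x := by
  rw [ae_restrict_iff' hs, ae_mu_iff]

lemma _root_.LocAC.continuous {u : ℝ → ℂ} (h : LocAC u) : Continuous u := by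
  rw [continuous_iff_continuousAt]
  intro x
  refine (h (x - 1) (x + 1)).continuousOn.continuousAt ?_
  rw [uIcc_of_le (by linarith)]
  exact Icc_mem_nhds (by linarith) (by linarith)

lemma _root_.LocAC.add {u v : ℝ → ℂ} (hu : LocAC u) (hv : LocAC v) : LocAC (u + v) :=
  fun a b => (hu a b).add (hv a b)

lemma _root_.LocAC.const_smul {u : ℝ → ℂ} (k : ℂ) (hu : LocAC u) : LocAC (k • u) :=
  fun a b => AbsolutelyContinuousOnInterval.const_smul k (hu a b)

lemma _root_.LocAC.zero : LocAC (0 : ℝ → ℂ) := by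
  intro a b
  exact ((LipschitzWith.const (0 : ℂ)).lipschitzOnWith (s := uIcc a b)).absolutelyContinuousOnInterval

lemma IsEll.add {u v g u' v' g' : ℝ → ℂ} (h : S.IsEll u v g) (h' : S.IsEll u' v' g') :
    S.IsEll (u + u') (v + v') (g + g') := by
  obtain ⟨h1, h2, h3, h4⟩ := h
  obtain ⟨k1, k2, k3, k4⟩ := h'
  refine ⟨h1.add k1, h2.add k2, ?_, ?_⟩
  · filter_upwards [h3, k3] with x hx kx
    refine (hx.add kx).congr_deriv ?_
    simp [add_div]
  · filter_upwards [h4, k4] with x hx kx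
    refine (hx.add kx).congr_deriv ?_
    simp only [Pi.add_apply]; ring

lemma IsEll.const_smul {u v g : ℝ → ℂ} (k : ℂ) (h : S.IsEll u v g) :
    S.IsEll (k • u) (k • v) (k • g) := by
  obtain ⟨h1, h2, h3, h4⟩ := h
  refine ⟨h1.const_smul k, h2.const_smul k, ?_, ?_⟩
  · filter_upwards [h3] with x hx
    refine (hx.const_smul k).congr_deriv ?_
    simp [mul_div_assoc]
  · filter_upwards [h4] with x hx
    refine (hx.const_smul k).congr_deriv ?_
    simp only [Pi.smul_apply, smul_eq_mul]; ring

lemma IsEll.zero : S.IsEll 0 0 0 := by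
  refine ⟨LocAC.zero, LocAC.zero, ?_, ?_⟩
  · filter_upwards with x
    refine (hasDerivAt_const x (0 : ℂ)).congr_deriv ?_
    simp
  · filter_upwards with x
    refine (hasDerivAt_const x (0 : ℂ)).congr_deriv ?_
    simp

lemma IsEll.congr {u v g g' : ℝ → ℂ} (h : S.IsEll u v g) (hg : ∀ᵐ x, g x = g' x) :
    S.IsEll u v g' := by
  refine ⟨h.1, h.2.1, h.2.2.1, ?_⟩
  filter_upwards [h.2.2.2, hg] with x hx hgx
  rwa [← hgx]

lemma InD.add {u v g u' v' g' : ℝ → ℂ} (h : S.InD u v g) (h' : S.InD u' v' g') :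
    S.InD (u + u') (v + v') (g + g') :=
  ⟨h.1.add h'.1, h.2.1.add h'.2.1, h.2.2.add h'.2.2⟩

lemma InD.const_smul {u v g : ℝ → ℂ} (k : ℂ) (h : S.InD u v g) :
    S.InD (k • u) (k • v) (k • g) :=
  ⟨h.1.const_smul k, h.2.1.const_smul k, h.2.2.const_smul k⟩

lemma InD.zero : S.InD 0 0 0 := ⟨IsEll.zero, MemLp.zero, MemLp.zero⟩

/-- A continuous function that vanishes a.e. on an open set vanishes there. -/
lemma eq_zero_of_ae {u : ℝ → ℂ} {s : Set ℝ} (hs : IsOpen s) (hu : Continuous u)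
    (h : ∀ᵐ x, x ∈ s → u x = 0) : ∀ x ∈ s, u x = 0 := by
  have := Measure.eqOn_open_of_ae_eq (μ := (volume : Measure ℝ)) (f := u) (g := fun _ => (0 : ℂ))
    ((ae_restrict_iff' hs.measurableSet).2 h) hs hu.continuousOn continuousOn_const
  exact this

/-- On an open set, `u = 0` a.e. implies `ℓ u = 0` a.e. -/
lemma IsEll.unique {u v g : ℝ → ℂ} {s : Set ℝ} (hs : IsOpen s) (h : S.IsEll u v g)
    (hu : ∀ᵐ x, x ∈ s → u x = 0) : ∀ᵐ x, x ∈ s → g x = 0 := by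
  obtain ⟨h1, h2, h3, h4⟩ := h
  have hu0 := eq_zero_of_ae hs h1.continuous hu
  have hv : ∀ᵐ x, x ∈ s → v x = 0 := by
    filter_upwards [h3, S.p_pos] with x hx hp hxs
    have h0 : HasDerivAt u 0 x := (hasDerivAt_const x (0 : ℂ)).congr_of_eventuallyEq
      (by filter_upwards [hs.mem_nhds hxs] with y hy using hu0 y hy)
    have := hx.unique h0
    have hp' : (S.p x : ℂ) ≠ 0 := by exact_mod_cast hp.ne'
    simpa [hp'] using this
  have hv0 := eq_zero_of_ae hs h2.continuous hv
  filter_upwards [h4, r_ne_zero (S := S)] with x hx hr hxs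
  have h0 : HasDerivAt v 0 x := (hasDerivAt_const x (0 : ℂ)).congr_of_eventuallyEq
      (by filter_upwards [hs.mem_nhds hxs] with y hy using hv0 y hy)
  have := hx.unique h0
  simpa [hu0 x hxs, hr] using this

end Helpers

/-! ### The operators `A` and `JA` -/

/-- The graph of the maximal operator associated with `ℓ` in `L²_{|r|}(ℝ)`. -/
def graphA : Submodule ℂ (S.H × S.H) where
  carrier := {x | ∃ u v g : ℝ → ℂ, S.InD u v g ∧ x.1 =ᵐ[S.μ] u ∧ x.2 =ᵐ[S.μ] g}
  zero_mem' := ⟨0, 0, 0, InD.zero, Lp.coeFn_zero _ _ _, Lp.coeFn_zero _ _ _⟩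
  add_mem' := by
    rintro x y ⟨u, v, g, h, h1, h2⟩ ⟨u', v', g', h', h1', h2'⟩
    exact ⟨_, _, _, h.add h', (Lp.coeFn_add _ _).trans (h1.add h1'),
      (Lp.coeFn_add _ _).trans (h2.add h2')⟩
  smul_mem' := by
    rintro k x ⟨u, v, g, h, h1, h2⟩
    exact ⟨_, _, _, h.const_smul k, (Lp.coeFn_smul _ _).trans (h1.const_smul k),
      (Lp.coeFn_smul _ _).trans (h2.const_smul k)⟩

/-- The maximal operator `A f = ℓ f`, `dom A = 𝓓`. -/
def A : S.H →ₗ.[ℂ] S.H := S.graphA.toLinearPMap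

lemma A_graph : S.A.graph = S.graphA := by
  refine Submodule.toLinearPMap_graph_eq _ ?_
  rintro ⟨x, y⟩ ⟨u, v, g, h, h1, h2⟩ (hx : x = 0)
  subst hx
  have hu : ∀ᵐ t, t ∈ univ → u t = 0 := by
    rw [← ae_mu_iff (S := S)]
    filter_upwards [h1, Lp.coeFn_zero ℂ 2 S.μ] with t ht ht' _
    rw [← ht, ht']; rfl
  have hg := (ae_mu_iff (S := S)).2 (h.1.unique isOpen_univ hu)
  refine Lp.eq_zero_iff_ae_eq_zero.2 ?_
  filter_upwards [h2, hg] with t ht ht'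
  rw [ht, ht' trivial]; rfl

lemma memLp_sign_mul (f : S.H) :
    MemLp (fun x => ((Real.sign (S.r x) : ℝ) : ℂ) * f x) 2 S.μ := by
  have hs : Measurable Real.sign :=
    Measurable.ite measurableSet_Iio measurable_const
      (Measurable.ite measurableSet_Ioi measurable_const measurable_const)
  have hr : AEMeasurable S.r S.μ :=
    S.r_locInt.aestronglyMeasurable.aemeasurable.mono_ac (withDensity_absolutelyContinuous _ _)
  have hm : AEStronglyMeasurable (fun x => ((Real.sign (S.r x) : ℝ) : ℂ)) S.μ :=
    (Complex.measurable_ofReal.comp_aemeasurable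
      (hs.comp_aemeasurable hr)).aestronglyMeasurable
  refine (Lp.memLp f).mono (hm.mul (Lp.aestronglyMeasurable f)) ?_
  filter_upwards with x
  rcases Real.sign_apply_eq (S.r x) with h | h | h <;> simp [h]

/-- The fundamental symmetry `(J f)(x) = sgn (r x) f x`. -/
def J : S.H →ₗ[ℂ] S.H where
  toFun f := (S.memLp_sign_mul f).toLp _
  map_add' f g := by
    rw [← MemLp.toLp_add]
    refine MemLp.toLp_congr _ _ ?_
    filter_upwards [Lp.coeFn_add f g] with x hx
    simp only [hx, Pi.add_apply]; ring
  map_smul' k f := by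
    rw [RingHom.id_apply, ← MemLp.toLp_const_smul]
    refine MemLp.toLp_congr _ _ ?_
    filter_upwards [Lp.coeFn_smul k f] with x hx
    simp only [hx, Pi.smul_apply, smul_eq_mul]; ring

/-- The indefinite Sturm-Liouville operator `JA`, with `dom JA = 𝓓`. -/
def JA : S.H →ₗ.[ℂ] S.H := S.J.compPMap S.A

/-! ### The Dirichlet operators on the half-lines, and their orthogonal sums -/

/-- The graph of the Dirichlet operator associated with `ℓ` on `s = (c, ∞)` or `s = (-∞, c)`:
its domain consists of the restrictions to `s` of those `u ∈ 𝓓` that satisfy `u(c) = 0`. -/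
def graphDirichlet (s : Set ℝ) : Submodule ℂ (S.HOn s × S.HOn s) where
  carrier := {x | ∃ u v g : ℝ → ℂ, S.InD u v g ∧ u S.c = 0 ∧
    x.1 =ᵐ[S.μ.restrict s] u ∧ x.2 =ᵐ[S.μ.restrict s] g}
  zero_mem' := ⟨0, 0, 0, InD.zero, rfl, Lp.coeFn_zero _ _ _, Lp.coeFn_zero _ _ _⟩
  add_mem' := by
    rintro x y ⟨u, v, g, h, hc, h1, h2⟩ ⟨u', v', g', h', hc', h1', h2'⟩
    exact ⟨_, _, _, h.add h', by simp [hc, hc'], (Lp.coeFn_add _ _).trans (h1.add h1'),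
      (Lp.coeFn_add _ _).trans (h2.add h2')⟩
  smul_mem' := by
    rintro k x ⟨u, v, g, h, hc, h1, h2⟩
    exact ⟨_, _, _, h.const_smul k, by simp [hc], (Lp.coeFn_smul _ _).trans (h1.const_smul k),
      (Lp.coeFn_smul _ _).trans (h2.const_smul k)⟩

/-- The Dirichlet operator on `s`. -/
def dirichlet (s : Set ℝ) : S.HOn s →ₗ.[ℂ] S.HOn s := (S.graphDirichlet s).toLinearPMap

lemma dirichlet_graph {s : Set ℝ} (hs : IsOpen s) :
    (S.dirichlet s).graph = S.graphDirichlet s := by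
  refine Submodule.toLinearPMap_graph_eq _ ?_
  rintro ⟨x, y⟩ ⟨u, v, g, h, -, h1, h2⟩ (hx : x = 0)
  subst hx
  have hu : ∀ᵐ t, t ∈ s → u t = 0 := by
    rw [← ae_mu_restrict_iff (S := S) hs.measurableSet]
    filter_upwards [h1, Lp.coeFn_zero ℂ 2 (S.μ.restrict s)] with t ht ht'
    rw [← ht, ht']; rfl
  have hg := (ae_mu_restrict_iff (S := S) hs.measurableSet).2 (h.1.unique hs hu)
  refine Lp.eq_zero_iff_ae_eq_zero.2 ?_
  filter_upwards [h2, hg] with t ht ht'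
  rw [ht, ht']; rfl

/-- The Dirichlet operator `B₊` in `L²_{r₊}(c, ∞)`. -/
def Bplus : S.HOn (Ioi S.c) →ₗ.[ℂ] S.HOn (Ioi S.c) := S.dirichlet (Ioi S.c)

/-- The Dirichlet operator `B₋` in `L²_{-r₋}(-∞, c)`. -/
def Bminus : S.HOn (Iio S.c) →ₗ.[ℂ] S.HOn (Iio S.c) := S.dirichlet (Iio S.c)

/-- Restriction of functions, `L²_{|r|}(ℝ) → L²_{|r|}(s)`. -/
def restr (s : Set ℝ) : S.H →ₗ[ℂ] S.HOn s := (LpToLpRestrictCLM ℝ ℂ ℂ S.μ 2 s).toLinearMap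

/-- The graph of the orthogonal sum of operators in `L²_{|r|}(c, ∞)` and `L²_{|r|}(-∞, c)`, as an
operator in `L²_{|r|}(ℝ) = L²_{|r|}(c, ∞) ⊕ L²_{|r|}(-∞, c)`. -/
def graphOrthSum (T : S.HOn (Ioi S.c) →ₗ.[ℂ] S.HOn (Ioi S.c))
    (T' : S.HOn (Iio S.c) →ₗ.[ℂ] S.HOn (Iio S.c)) : Submodule ℂ (S.H × S.H) :=
  T.graph.comap ((S.restr (Ioi S.c)).prodMap (S.restr (Ioi S.c))) ⊓
    T'.graph.comap ((S.restr (Iio S.c)).prodMap (S.restr (Iio S.c)))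

/-- The orthogonal sum `T ⊕ T'`. -/
def orthSum (T : S.HOn (Ioi S.c) →ₗ.[ℂ] S.HOn (Ioi S.c))
    (T' : S.HOn (Iio S.c) →ₗ.[ℂ] S.HOn (Iio S.c)) : S.H →ₗ.[ℂ] S.H :=
  (S.graphOrthSum T T').toLinearPMap

lemma eq_zero_of_restr {f : S.H} (h1 : S.restr (Ioi S.c) f = 0) (h2 : S.restr (Iio S.c) f = 0) :
    f = 0 := by
  have key : ∀ s : Set ℝ, MeasurableSet s → S.restr s f = 0 → ∀ᵐ x, x ∈ s → f x = 0 := by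
    intro s hs h
    rw [← ae_mu_restrict_iff (S := S) hs]
    have h3 : S.restr s f =ᵐ[S.μ.restrict s] f := LpToLpRestrictCLM_coeFn ℂ s f
    rw [h] at h3
    filter_upwards [h3, Lp.coeFn_zero ℂ 2 (S.μ.restrict s)] with x hx hx'
    rw [← hx, hx']; rfl
  have hc : ∀ᵐ x : ℝ, x ≠ S.c := by simp [ae_iff, measure_singleton]
  refine Lp.eq_zero_iff_ae_eq_zero.2 ?_
  refine ae_mu_iff.2 ?_
  filter_upwards [key _ measurableSet_Ioi h1, key _ measurableSet_Iio h2, hc] with x k1 k2 k3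
  rcases lt_or_gt_of_ne k3 with h | h
  · exact k2 h
  · exact k1 h

lemma mem_graphOrthSum (T : S.HOn (Ioi S.c) →ₗ.[ℂ] S.HOn (Ioi S.c))
    (T' : S.HOn (Iio S.c) →ₗ.[ℂ] S.HOn (Iio S.c)) (x y : S.H) :
    (x, y) ∈ S.graphOrthSum T T' ↔
      (S.restr (Ioi S.c) x, S.restr (Ioi S.c) y) ∈ T.graph ∧
      (S.restr (Iio S.c) x, S.restr (Iio S.c) y) ∈ T'.graph := by
  simp only [graphOrthSum, Submodule.mem_inf, Submodule.mem_comap, LinearMap.prodMap_apply]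

lemma orthSum_graph (T : S.HOn (Ioi S.c) →ₗ.[ℂ] S.HOn (Ioi S.c))
    (T' : S.HOn (Iio S.c) →ₗ.[ℂ] S.HOn (Iio S.c)) :
    (S.orthSum T T').graph = S.graphOrthSum T T' := by
  refine Submodule.toLinearPMap_graph_eq _ ?_
  rintro ⟨x, y⟩ h hx
  simp only at hx
  rw [mem_graphOrthSum, hx, map_zero, map_zero] at h
  exact S.eq_zero_of_restr (T.graph_fst_eq_zero_snd h.1 rfl) (T'.graph_fst_eq_zero_snd h.2 rfl)

/-- `B = B₊ ⊕ B₋`. -/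
def B : S.H →ₗ.[ℂ] S.H := S.orthSum S.Bplus S.Bminus

/-- `JB = B₊ ⊕ (-B₋)`. -/
def JB : S.H →ₗ.[ℂ] S.H := S.orthSum S.Bplus (-S.Bminus)

/-! ### The functions `m₊`, `m₋` and `M` -/

/-- `u` is (an extension to `ℝ` within `𝓓` of) a nontrivial solution of `ℓ u = z u` on `s` that
is the restriction of a function from `𝓓`, and `v = p u'`. -/
def IsWeylSolution (s : Set ℝ) (z : ℂ) (u v : ℝ → ℂ) : Prop :=
  ∃ g : ℝ → ℂ, S.InD u v g ∧ (∀ᵐ x, x ∈ s → g x = z * u x) ∧ ∃ x ∈ s, u x ≠ 0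

/-- The quotient `(p u')(c) / u(c)`, where `u` is a nontrivial solution of `ℓ u = z u` on `s`
that is the restriction of a function from `𝓓` (a choice of one; such a solution is unique up to
a constant multiple when `s` is a half-line and `z` is in the resolvent set of the Dirichlet
operator on `s`). -/
def titchmarshWeyl (s : Set ℝ) (z : ℂ) : ℂ :=
  let w := Classical.epsilon
    (fun w : (ℝ → ℂ) × (ℝ → ℂ) => S.IsWeylSolution s z w.1 w.2)
  w.2 S.c / w.1 S.c

/-- The function `m₊`, with domain `ρ(B₊)`. -/
def mPlus (z : ℂ) : ℂ := S.titchmarshWeyl (Ioi S.c) z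

/-- The function `m₋`, with domain `ρ(B₋)`. -/
def mMinus (z : ℂ) : ℂ := S.titchmarshWeyl (Iio S.c) z

/-- The function `M(z) = m₊(z) - m₋(-z)`. -/
def M (z : ℂ) : ℂ := S.mPlus z - S.mMinus (-z)

/-- The domain `ρ(B₊) ∩ ρ(-B₋)` of `M`. -/
def domM : Set ℂ := opResolventSet S.Bplus ∩ opResolventSet (-S.Bminus)

/-- The maximal operator `A` is selfadjoint, and `min σ(A)` exists and is positive. -/
def LeftDefinite : Prop :=
  IsSelfAdjoint S.A ∧ ∃ m : ℝ, IsLeast {x : ℝ | (x : ℂ) ∈ opSpectrum S.A} m ∧ 0 < m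

end SLCoeff

end

/-!
The coupling of the two half-lines at `c` is read off from the Cauchy data `(u(c), (p u')(c))`.
An eigenfunction of `A` (or of `JA`) consists of a solution of `ℓ u = z u` on `(c, ∞)` and of a
solution of `ℓ u = z u` (or `ℓ u = -z u`) on `(-∞, c)` with the same Cauchy data
(`SLCoeff.HasCoupledSolution`, `SLCoeff.InD.exists_glue`). If `u(c) ≠ 0`, this says that the
quotients `(p u')(c) / u(c)`, which are the values of the Weyl functions, agree; if `u(c) = 0`, both
pieces are Dirichlet eigenfunctions (`SLCoeff.LeftDefinite.hasCoupledSolution_iff`). The second case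
does not occur for `JA`, because `B₊` and `B₋` have positive eigenvalues only
(`SLCoeff.LeftDefinite.eigenvalue_pos`). For the same reason the poles of `m₊(z)` and `m₋(-z)`
cannot cancel in `M`.

That the Dirichlet eigenvalues are exactly the poles of a Weyl function comes from an explicit
formula. The selfadjointness of `A` implies Green's identity on each half-line without a boundary
term at infinity (`SLCoeff.LeftDefinite.green`), and the Dirichlet operator has a bounded
selfadjoint inverse `T` (`SLCoeff.LeftDefinite.exists_dirichlet_inverse`). If `a` is the solution of
`ℓ a = 0` in the domain with `a(c) = 1`, then the solution at `w` is `(1 - w T)⁻¹ a` and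
`m(w) = (p a')(c) ± w ⟪a, (1 - w T)⁻¹ a⟫` (`SLCoeff.LeftDefinite.exists_weylModel`). If `1 - z T`
has a range of finite codimension, then either it is invertible (`isUnit_one_sub_smul`), or `z` is a
simple pole of this function (`exists_simple_pole`): by Green's identity,
`z ⟪a, e⟫ = ± (p e')(c) ≠ 0` for an eigenfunction `e`. Outside of the essential spectrum of `A` or
of `JA` the codimension is finite on both half-lines, since the Dirichlet condition costs at most one
dimension (`SLCoeff.LeftDefinite.cofg_of_restr`).

Two facts need functions from the domain that are concentrated near `c`; they are built by variation
of parameters from local solutions of `ℓ y = 0`. All Cauchy data at `c` are attained by functions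
with compact support (`SLCoeff.exists_inD_cauchyData`), which gives Green's identity. And there are
functions with `(p u')(c) = 1` of small energy on one side of `c`
(`SLCoeff.exists_inD_small_energy`); with these a Dirichlet eigenfunction, extended by `0`, can be
approximated in the domain of `A`, and the lower bound of `A` applies to it.
-/

noncomputable section

open scoped ComplexConjugate

/-! ### Locally absolutely continuous functions -/

lemma LocAC.ofReal {u : ℝ → ℝ} (h : ∀ a b, AbsolutelyContinuousOnInterval u a b) :
    LocAC (fun x => (u x : ℂ)) := by
  intro a b
  have h1 := (h a b).smul
    ((LipschitzWith.const (1 : ℂ)).lipschitzOnWith (s := uIcc a b)).absolutelyContinuousOnInterval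
  have e : (fun x => (u x : ℂ)) = u • fun _ => (1 : ℂ) := by
    funext x
    simp
  rw [e]
  exact h1

lemma LocAC.mul {u v : ℝ → ℂ} (hu : LocAC u) (hv : LocAC v) : LocAC (fun x => u x * v x) :=
  fun a b => (hu a b).smul (hv a b)

lemma LocAC.fun_add {u v : ℝ → ℂ} (hu : LocAC u) (hv : LocAC v) : LocAC (fun x => u x + v x) :=
  fun a b => (hu a b).add (hv a b)

lemma LocAC.fun_sub {u v : ℝ → ℂ} (hu : LocAC u) (hv : LocAC v) : LocAC (fun x => u x - v x) :=
  fun a b => (hu a b).sub (hv a b)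

lemma LocAC.const (k : ℂ) : LocAC (fun _ => k) := fun _ _ =>
  ((LipschitzWith.const k).lipschitzOnWith).absolutelyContinuousOnInterval

lemma LocAC.conj {u : ℝ → ℂ} (hu : LocAC u) : LocAC (fun x => conj (u x)) := by
  intro a b
  have := hu a b
  unfold AbsolutelyContinuousOnInterval at this ⊢
  simpa [Complex.dist_conj_conj] using this

/-- A primitive of a locally integrable function is locally absolutely continuous. -/
lemma locAC_integral {f : ℝ → ℂ} (hf : LocallyIntegrable f) (c : ℝ) :
    LocAC (fun x => ∫ t in c..x, f t) := by
  have hi : ∀ a b, IntervalIntegrable f volume a b := fun a b =>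
    (hf.integrableOn_isCompact isCompact_uIcc).intervalIntegrable
  have h1 : ∀ g : ℝ → ℝ, (∀ a b, IntervalIntegrable g volume a b) → ∀ a b,
      AbsolutelyContinuousOnInterval (fun x => ∫ t in c..x, g t) a b := by
    intro g hg a b
    have hI := hg (min (min a b) c) (max (max a b) c)
    have := hI.absolutelyContinuousOnInterval_intervalIntegral (c := c)
      (by rw [mem_uIcc]; left; simp)
    refine this.mono ?_
    rw [uIcc_of_le (by simp : min (min a b) c ≤ max (max a b) c)]
    exact Icc_subset_Icc (min_le_left _ _) (le_max_left _ _)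
  have hre := LocAC.ofReal (h1 (fun t => (f t).re) (fun a b => ⟨(hi a b).1.re, (hi a b).2.re⟩))
  have him := LocAC.ofReal (h1 (fun t => (f t).im) (fun a b => ⟨(hi a b).1.im, (hi a b).2.im⟩))
  convert hre.fun_add (him.mul (LocAC.const Complex.I)) using 2 with x
  have e1 := Complex.reCLM.intervalIntegral_comp_comm (hi c x)
  have e2 := Complex.imCLM.intervalIntegral_comp_comm (hi c x)
  simp only [Complex.reCLM_apply, Complex.imCLM_apply] at e1 e2
  rw [e1, e2, Complex.re_add_im]

/-- The fundamental theorem of calculus for locally absolutely continuous functions. -/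
lemma LocAC.integral_eq_sub {u f : ℝ → ℂ} (hu : LocAC u) (hf : LocallyIntegrable f)
    (h : ∀ᵐ x, HasDerivAt u (f x) x) (a b : ℝ) : ∫ t in a..b, f t = u b - u a := by
  have hg : LocAC (fun x => u x - ∫ t in a..x, f t) := hu.fun_sub (locAC_integral hf a)
  obtain ⟨C, hC⟩ := (hg a b).const_of_ae_hasDerivAt_zero (by
    filter_upwards [h, LocallyIntegrable.ae_hasDerivAt_integral hf] with x hx hx' _
    simpa using! hx.sub (hx' a))
  have h1 := hC a (by simp)
  have h2 := hC b (by simp)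
  simp only [intervalIntegral.integral_same, sub_zero] at h1
  rw [← h1] at h2
  linear_combination -h2

/-- A locally absolutely continuous function whose derivative vanishes a.e. is constant. -/
lemma LocAC.eq_of_ae_hasDerivAt_zero {u : ℝ → ℂ} (hu : LocAC u)
    (h : ∀ᵐ x, HasDerivAt u 0 x) (a b : ℝ) : u b = u a := by
  have := hu.integral_eq_sub (f := fun _ => 0) locallyIntegrable_zero h a b
  simpa [sub_eq_zero, eq_comm] using this

/-- A locally integrable function has small integral over small intervals. -/
lemma exists_setIntegral_norm_lt {f : ℝ → ℂ} (hf : LocallyIntegrable f) (c : ℝ) {ε : ℝ}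
    (hε : 0 < ε) : ∃ h > 0, ∀ k ∈ Ioc 0 h, ∫ t in Icc (c - k) (c + k), ‖f t‖ < ε := by
  have hi : ∀ a b, IntervalIntegrable (fun t => ‖f t‖) volume a b :=
    fun a b => ((hf.integrableOn_isCompact isCompact_uIcc).intervalIntegrable).norm
  have hcont : Continuous (fun k : ℝ => ∫ t in (c - k)..(c + k), ‖f t‖) := by
    have h1 := intervalIntegral.continuous_primitive hi c
    have h2 : (fun k : ℝ => ∫ t in (c - k)..(c + k), ‖f t‖) =
        fun k => (∫ t in c..(c + k), ‖f t‖) - ∫ t in c..(c - k), ‖f t‖ := by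
      ext k
      rw [intervalIntegral.integral_interval_sub_left (hi _ _) (hi _ _)]
    rw [h2]
    exact (h1.comp (by fun_prop)).sub (h1.comp (by fun_prop))
  have h0 : ∀ᶠ k in 𝓝 (0 : ℝ), ∫ t in (c - k)..(c + k), ‖f t‖ < ε :=
    hcont.continuousAt.eventually_lt continuousAt_const (by simpa using hε)
  obtain ⟨h, hh, hb⟩ := Metric.eventually_nhds_iff.1 h0
  refine ⟨h / 2, by positivity, fun k hk => ?_⟩
  have := @hb k (by rw [Real.dist_eq, sub_zero, abs_of_pos hk.1]; linarith [hk.2])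
  rwa [intervalIntegral.integral_of_le (by linarith [hk.1]),
    ← integral_Icc_eq_integral_Ioc] at this

lemma norm_integral_mul_le {k w : ℝ → ℂ} {s : Set ℝ} {C : ℝ} (hs : MeasurableSet s)
    (hk : IntegrableOn k s) (hw : ∀ t ∈ s, ‖w t‖ ≤ C) :
    ‖∫ t in s, k t * w t‖ ≤ C * ∫ t in s, ‖k t‖ := by
  rw [← integral_const_mul]
  refine norm_integral_le_of_norm_le (hk.norm.const_mul C) ?_
  filter_upwards [ae_restrict_mem hs] with t ht
  rw [norm_mul, mul_comm]
  exact mul_le_mul_of_nonneg_right (hw t ht) (norm_nonneg _)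

lemma locallyIntegrable_ofReal {f : ℝ → ℝ} (hf : LocallyIntegrable f) :
    LocallyIntegrable (fun x => (f x : ℂ)) := by
  rw [locallyIntegrable_iff] at hf ⊢
  exact fun k hk => (hf k hk).ofReal

lemma locallyIntegrable_mul_continuous {k w : ℝ → ℂ} (hk : LocallyIntegrable k)
    (hw : Continuous w) : LocallyIntegrable (fun x => k x * w x) := by
  rw [locallyIntegrable_iff] at hk ⊢
  exact fun K hK => (hk K hK).mul_continuousOn hw.continuousOn hK

/-- Solvability of the Volterra system `u' = k₁ v`, `v' = k₂ u` with small integrable coefficients,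
by the contraction principle in the space of bounded continuous functions. -/
lemma exists_volterra_solution {k₁ k₂ : ℝ → ℂ} (h₁ : Integrable k₁) (h₂ : Integrable k₂)
    (b₁ : ∫ t, ‖k₁ t‖ ≤ 1 / 2) (b₂ : ∫ t, ‖k₂ t‖ ≤ 1 / 2) (c : ℝ) (x y : ℂ) :
    ∃ u v : ℝ → ℂ, Continuous u ∧ Continuous v ∧ (∀ t, u t = x + ∫ s in c..t, k₁ s * v s) ∧
      ∀ t, v t = y + ∫ s in c..t, k₂ s * u s := by
  have hint : ∀ {k : ℝ → ℂ}, Integrable k → ∀ f : BoundedContinuousFunction ℝ ℂ,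
      Integrable (fun s => k s * f s) := fun {k} hk f =>
    hk.mul_bdd f.continuous.aestronglyMeasurable
      (Eventually.of_forall f.norm_coe_le_norm)
  have hbound : ∀ {k : ℝ → ℂ}, Integrable k → (∫ t, ‖k t‖ ≤ 1 / 2) →
      ∀ (f : BoundedContinuousFunction ℝ ℂ) (t : ℝ), ‖∫ s in c..t, k s * f s‖ ≤ 1 / 2 * ‖f‖ := by
    intro k hk hb f t
    calc ‖∫ s in c..t, k s * f s‖ ≤ ∫ s in uIoc c t, ‖k s * f s‖ :=
          intervalIntegral.norm_integral_le_integral_norm_uIoc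
      _ ≤ ∫ s, ‖k s * f s‖ := setIntegral_le_integral (hint hk f).norm
          (Eventually.of_forall fun _ => norm_nonneg _)
      _ ≤ ∫ s, ‖k s‖ * ‖f‖ := by
          refine integral_mono (hint hk f).norm (hk.norm.mul_const _) fun s => ?_
          simp only [norm_mul]
          exact mul_le_mul_of_nonneg_left (f.norm_coe_le_norm s) (norm_nonneg _)
      _ = (∫ s, ‖k s‖) * ‖f‖ := integral_mul_const _ _
      _ ≤ 1 / 2 * ‖f‖ := mul_le_mul_of_nonneg_right hb (norm_nonneg _)
  let G : ∀ {k : ℝ → ℂ}, Integrable k → (∫ t, ‖k t‖ ≤ 1 / 2) → ℂ →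
      BoundedContinuousFunction ℝ ℂ → BoundedContinuousFunction ℝ ℂ := fun {k} hk hb x f =>
    BoundedContinuousFunction.ofNormedAddCommGroup (fun t => x + ∫ s in c..t, k s * f s)
      (continuous_const.add
        (intervalIntegral.continuous_primitive (fun _ _ => (hint hk f).intervalIntegrable) c))
      (‖x‖ + 1 / 2 * ‖f‖)
      (fun t => (norm_add_le _ _).trans (by gcongr; exact hbound hk hb f t))
  have hG : ∀ {k : ℝ → ℂ} (hk : Integrable k) (hb : ∫ t, ‖k t‖ ≤ 1 / 2) (x : ℂ)
      (f g : BoundedContinuousFunction ℝ ℂ),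
      dist (G hk hb x f) (G hk hb x g) ≤ 1 / 2 * dist f g := by
    intro k hk hb x f g
    refine (BoundedContinuousFunction.dist_le (by positivity)).2 fun t => ?_
    have : (G hk hb x f) t - (G hk hb x g) t = ∫ s in c..t, k s * (f - g) s := by
      simp only [G, BoundedContinuousFunction.coe_ofNormedAddCommGroup, add_sub_add_left_eq_sub,
        BoundedContinuousFunction.coe_sub, Pi.sub_apply, mul_sub]
      rw [intervalIntegral.integral_sub (hint hk f).intervalIntegrable
        (hint hk g).intervalIntegrable]
    rw [dist_eq_norm, this, dist_eq_norm]
    exact hbound hk hb _ t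
  let F : BoundedContinuousFunction ℝ ℂ × BoundedContinuousFunction ℝ ℂ →
      BoundedContinuousFunction ℝ ℂ × BoundedContinuousFunction ℝ ℂ := fun w =>
    (G h₁ b₁ x w.2, G h₂ b₂ y w.1)
  have hF : ContractingWith (1 / 2) F := by
    refine ⟨by norm_num, LipschitzWith.of_dist_le_mul fun w w' => ?_⟩
    simp only [F, Prod.dist_eq]
    push_cast
    refine max_le ((hG h₁ b₁ _ _ _).trans ?_) ((hG h₂ b₂ _ _ _).trans ?_)
    · gcongr; exact le_max_right _ _
    · gcongr; exact le_max_left _ _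
  have hfix := hF.fixedPoint_isFixedPt
  set w := hF.fixedPoint
  have e1 : G h₁ b₁ x w.2 = w.1 := congrArg Prod.fst hfix
  have e2 : G h₂ b₂ y w.1 = w.2 := congrArg Prod.snd hfix
  refine ⟨w.1, w.2, w.1.continuous, w.2.continuous, fun t => ?_, fun t => ?_⟩
  · exact (DFunLike.congr_fun e1 t).symm
  · exact (DFunLike.congr_fun e2 t).symm

/-- Local uniqueness for the Volterra system `u' = k₁ v`, `v' = k₂ u`. -/
lemma eventually_eq_zero_of_volterra {k₁ k₂ u v : ℝ → ℂ} (h₁ : LocallyIntegrable k₁)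
    (h₂ : LocallyIntegrable k₂) (hu : Continuous u) (hv : Continuous v) (a : ℝ)
    (eu : ∀ t, u t = ∫ s in a..t, k₁ s * v s) (ev : ∀ t, v t = ∫ s in a..t, k₂ s * u s) :
    ∀ᶠ t in 𝓝 a, u t = 0 ∧ v t = 0 := by
  obtain ⟨d₁, hd₁, hb₁⟩ := exists_setIntegral_norm_lt h₁ a (ε := 1 / 2) (by norm_num)
  obtain ⟨d₂, hd₂, hb₂⟩ := exists_setIntegral_norm_lt h₂ a (ε := 1 / 2) (by norm_num)
  set d := min d₁ d₂
  have hd : 0 < d := lt_min hd₁ hd₂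
  have b₁ := hb₁ d ⟨hd, min_le_left _ _⟩
  have b₂ := hb₂ d ⟨hd, min_le_right _ _⟩
  set I := Icc (a - d) (a + d)
  have hI : IsCompact I := isCompact_Icc
  have haI : a ∈ I := ⟨by linarith, by linarith⟩
  obtain ⟨p, hpI, hp⟩ := hI.exists_isMaxOn ⟨a, haI⟩ hu.norm.continuousOn
  obtain ⟨q, hqI, hq⟩ := hI.exists_isMaxOn ⟨a, haI⟩ hv.norm.continuousOn
  have key : ∀ {k w : ℝ → ℂ} {C : ℝ}, LocallyIntegrable k → (∫ t in I, ‖k t‖ < 1 / 2) →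
      0 ≤ C → (∀ t ∈ I, ‖w t‖ ≤ C) → ∀ t ∈ I, ‖∫ s in a..t, k s * w s‖ ≤ 1 / 2 * C := by
    intro k w C hk hb hC hw t ht
    have hsub : uIoc a t ⊆ I := by
      refine uIoc_subset_uIcc.trans ?_
      exact (ordConnected_Icc).uIcc_subset haI ht
    rw [intervalIntegral.norm_integral_eq_norm_integral_uIoc]
    have hkI : IntegrableOn k I := hk.integrableOn_isCompact hI
    refine (norm_integral_mul_le measurableSet_uIoc (hkI.mono_set hsub)
      (fun s hs => hw s (hsub hs))).trans ?_
    rw [mul_comm]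
    refine mul_le_mul_of_nonneg_right ?_ hC
    exact (setIntegral_mono_set hkI.norm (Eventually.of_forall fun _ => norm_nonneg _)
      (LE.le.eventuallyLE hsub)).trans hb.le
  have m1 : ‖u p‖ ≤ 1 / 2 * ‖v q‖ := by
    rw [eu p]; exact key h₁ b₁ (norm_nonneg _) (fun t ht => hq ht) p hpI
  have m2 : ‖v q‖ ≤ 1 / 2 * ‖u p‖ := by
    rw [ev q]; exact key h₂ b₂ (norm_nonneg _) (fun t ht => hp ht) q hqI
  have n1 : ‖u p‖ ≤ 0 := by linarith [norm_nonneg (u p)]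
  have n2 : ‖v q‖ ≤ 0 := by linarith
  filter_upwards [Icc_mem_nhds (show a - d < a by linarith) (show a < a + d by linarith)] with t ht
  exact ⟨norm_le_zero_iff.1 ((hp ht).trans n1), norm_le_zero_iff.1 ((hq ht).trans n2)⟩

namespace SLCoeff

variable (S : SLCoeff)

/-! ### The weight and the half-lines -/

/-- `s` is one of the half-lines `(c, ∞)` (with `ε = 1`) and `(-∞, c)` (with `ε = -1`). The sign
`ε` is the one of the boundary terms at `c` in Green's identity on `s`. -/
def IsHalfLine (s : Set ℝ) (ε : ℂ) : Prop := (s = Ioi S.c ∧ ε = 1) ∨ (s = Iio S.c ∧ ε = -1)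

variable {S}

lemma IsHalfLine.isOpen {s : Set ℝ} {ε : ℂ} (hs : S.IsHalfLine s ε) : IsOpen s := by
  rcases hs with ⟨rfl, -⟩ | ⟨rfl, -⟩
  · exact isOpen_Ioi
  · exact isOpen_Iio

lemma IsHalfLine.measurableSet {s : Set ℝ} {ε : ℂ} (hs : S.IsHalfLine s ε) : MeasurableSet s :=
  hs.isOpen.measurableSet

lemma IsHalfLine.ne_zero {s : Set ℝ} {ε : ℂ} (hs : S.IsHalfLine s ε) : ε ≠ 0 := by
  rcases hs with ⟨-, rfl⟩ | ⟨-, rfl⟩ <;> simp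

lemma IsHalfLine.notMem {s : Set ℝ} {ε : ℂ} (hs : S.IsHalfLine s ε) : S.c ∉ s := by
  rcases hs with ⟨rfl, -⟩ | ⟨rfl, -⟩ <;> simp

lemma IsHalfLine.mem_closure {s : Set ℝ} {ε : ℂ} (hs : S.IsHalfLine s ε) : S.c ∈ closure s := by
  rcases hs with ⟨rfl, -⟩ | ⟨rfl, -⟩ <;> simp

lemma exists_other_halfLine {s : Set ℝ} {ε : ℂ} (hs : S.IsHalfLine s ε) :
    ∃ s', S.IsHalfLine s' (-ε) ∧ Disjoint s s' ∧ ∀ x ≠ S.c, x ∉ s → x ∈ s' := by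
  rcases hs with ⟨rfl, rfl⟩ | ⟨rfl, rfl⟩
  · refine ⟨Iio S.c, Or.inr ⟨rfl, rfl⟩, ?_, ?_⟩
    · rw [Set.disjoint_left]
      intro x hx hx'
      simp only [mem_Ioi, mem_Iio] at hx hx'
      exact lt_asymm hx hx'
    · intro x hx h; exact lt_of_le_of_ne (not_lt.1 h) hx
  · refine ⟨Ioi S.c, Or.inl ⟨rfl, by simp⟩, ?_, ?_⟩
    · rw [Set.disjoint_left]
      intro x hx hx'
      simp only [mem_Ioi, mem_Iio] at hx hx'
      exact lt_asymm hx hx'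
    · intro x hx h; exact lt_of_le_of_ne (not_lt.1 h) hx.symm

lemma ae_ne_c : ∀ᵐ x : ℝ, x ≠ S.c := by simp [ae_iff, measure_singleton]

variable (S) in
/-- The weight `|r|`, as a complex function. -/
def wt (x : ℝ) : ℂ := ((|S.r x| : ℝ) : ℂ)

lemma locallyIntegrable_wt : LocallyIntegrable S.wt :=
  locallyIntegrable_ofReal (by
    have h := S.r_locInt
    rw [locallyIntegrable_iff] at h ⊢
    exact fun k hk => (h k hk).abs)

lemma aemeasurable_density : AEMeasurable (fun x => ENNReal.ofReal |S.r x|) volume :=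
  (continuous_abs.measurable.comp_aemeasurable
    S.r_locInt.aestronglyMeasurable.aemeasurable).ennreal_ofReal

lemma integrable_mu_iff {f : ℝ → ℂ} :
    Integrable f S.μ ↔ Integrable (fun x => S.wt x * f x) := by
  rw [μ, integrable_withDensity_iff_integrable_smul₀' aemeasurable_density (by simp)]
  simp [wt, ENNReal.toReal_ofReal]

lemma integral_mu (f : ℝ → ℂ) : ∫ x, f x ∂S.μ = ∫ x, S.wt x * f x := by
  rw [μ, integral_withDensity_eq_integral_toReal_smul₀ aemeasurable_density (by simp)]
  simp [wt, ENNReal.toReal_ofReal]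

lemma setIntegral_mu (f : ℝ → ℂ) {s : Set ℝ} (hs : MeasurableSet s) :
    ∫ x in s, f x ∂S.μ = ∫ x in s, S.wt x * f x := by
  rw [← integral_indicator hs, ← integral_indicator hs, integral_mu]
  congr 1
  ext x
  by_cases hx : x ∈ s <;> simp [hx]

lemma integrableOn_mu_iff {f : ℝ → ℂ} {s : Set ℝ} (hs : MeasurableSet s) :
    IntegrableOn f s S.μ ↔ IntegrableOn (fun x => S.wt x * f x) s := by
  rw [← integrable_indicator_iff hs, ← integrable_indicator_iff hs, integrable_mu_iff]
  have : (fun x => S.wt x * s.indicator f x) = s.indicator fun x => S.wt x * f x := by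
    ext x
    by_cases hx : x ∈ s <;> simp [hx]
  rw [this]

lemma mu_lt_top {K : Set ℝ} (hK : IsCompact K) : S.μ K < ⊤ := by
  have h : IntegrableOn (fun _ => (1 : ℂ)) K S.μ := by
    rw [integrableOn_mu_iff hK.measurableSet]
    simpa using locallyIntegrable_wt.integrableOn_isCompact hK
  simpa [integrableOn_const_iff] using h

lemma locallyIntegrable_wt_mul {g : ℝ → ℂ} (hg : MemLp g 2 S.μ) :
    LocallyIntegrable (fun x => S.wt x * g x) := by
  rw [locallyIntegrable_iff]
  intro K hK
  rw [← integrableOn_mu_iff hK.measurableSet]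
  have : IsFiniteMeasure (S.μ.restrict K) := ⟨by simpa using mu_lt_top hK⟩
  exact (hg.restrict K).integrable (by norm_num)

lemma locallyIntegrable_div_p {v : ℝ → ℂ} (hv : Continuous v) :
    LocallyIntegrable (fun x => v x / (S.p x : ℂ)) := by
  have := locallyIntegrable_mul_continuous (locallyIntegrable_ofReal S.inv_p_locInt) hv
  refine this.congr (Eventually.of_forall fun x => ?_)
  simp [div_eq_mul_inv, mul_comm]

lemma locallyIntegrable_q_mul {u : ℝ → ℂ} (hu : Continuous u) :
    LocallyIntegrable (fun x => (S.q x : ℂ) * u x) :=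
  locallyIntegrable_mul_continuous (locallyIntegrable_ofReal S.q_locInt) hu

/-! ### Cutting off at `c`, and uniqueness of solutions -/

lemma locAC_indicator {s : Set ℝ} {ε : ℂ} (hs : S.IsHalfLine s ε) {u f : ℝ → ℂ}
    (hu : LocAC u) (hf : LocallyIntegrable f) (h : ∀ᵐ x, HasDerivAt u (f x) x) (hc : u S.c = 0) :
    LocAC (s.indicator u) := by
  have key := locAC_integral (hf.indicator hs.measurableSet) S.c
  convert key using 1
  ext x
  by_cases hx : x ∈ s
  · rw [indicator_of_mem hx]
    have h1 := hu.integral_eq_sub hf h S.c x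
    rw [hc, sub_zero] at h1
    rw [← h1]
    refine intervalIntegral.integral_congr_ae ?_
    filter_upwards [ae_ne_c (S := S)] with t ht htx
    rw [indicator_of_mem]
    rw [mem_uIoc] at htx
    rcases hs with ⟨rfl, -⟩ | ⟨rfl, -⟩ <;> simp only [mem_Ioi, mem_Iio] at * <;> grind
  · rw [indicator_of_notMem hx]
    symm
    rw [intervalIntegral.integral_congr_ae (g := fun _ => 0)]
    · simp
    filter_upwards [ae_ne_c (S := S)] with t ht htx
    rw [indicator_of_notMem]
    rw [mem_uIoc] at htx
    rcases hs with ⟨rfl, -⟩ | ⟨rfl, -⟩ <;> simp only [mem_Ioi, mem_Iio] at * <;> grind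

lemma hasDerivAt_indicator {s : Set ℝ} {ε : ℂ} (hs : S.IsHalfLine s ε) {u : ℝ → ℂ} {k : ℂ} {x : ℝ}
    (h : HasDerivAt u k x) (hx : x ≠ S.c) :
    HasDerivAt (s.indicator u) (s.indicator (fun _ => k) x) x := by
  by_cases hxs : x ∈ s
  · rw [indicator_of_mem hxs]
    refine h.congr_of_eventuallyEq ?_
    filter_upwards [hs.isOpen.mem_nhds hxs] with y hy
    rw [indicator_of_mem hy]
  · rw [indicator_of_notMem hxs]
    obtain ⟨s', hs', hd, hmem⟩ := exists_other_halfLine hs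
    refine (hasDerivAt_const x (0 : ℂ)).congr_of_eventuallyEq ?_
    filter_upwards [hs'.isOpen.mem_nhds (hmem x hx hxs)] with y hy
    rw [indicator_of_notMem (disjoint_right.1 hd hy)]

lemma IsEll.deriv_integrable {u v g : ℝ → ℂ} (h : S.IsEll u v g)
    (hg : LocallyIntegrable (fun x => S.wt x * g x)) :
    LocallyIntegrable (fun x => (S.q x : ℂ) * u x - ((|S.r x| : ℝ) : ℂ) * g x) :=
  (locallyIntegrable_q_mul h.1.continuous).sub hg

/-- A function with vanishing Cauchy data at `c` may be replaced by `0` on one side of `c`. -/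
lemma IsEll.indicator {s : Set ℝ} {ε : ℂ} (hs : S.IsHalfLine s ε) {u v g : ℝ → ℂ}
    (h : S.IsEll u v g) (hg : LocallyIntegrable (fun x => S.wt x * g x))
    (hu : u S.c = 0) (hv : v S.c = 0) :
    S.IsEll (s.indicator u) (s.indicator v) (s.indicator g) := by
  refine ⟨locAC_indicator hs h.1 (locallyIntegrable_div_p h.2.1.continuous) h.2.2.1 hu,
    locAC_indicator hs h.2.1 (h.deriv_integrable hg) h.2.2.2 hv, ?_, ?_⟩
  · filter_upwards [h.2.2.1, ae_ne_c (S := S)] with x hx hxc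
    refine (hasDerivAt_indicator hs hx hxc).congr_deriv ?_
    by_cases hxs : x ∈ s <;> simp [hxs]
  · filter_upwards [h.2.2.2, ae_ne_c (S := S)] with x hx hxc
    refine (hasDerivAt_indicator hs hx hxc).congr_deriv ?_
    by_cases hxs : x ∈ s <;> simp [hxs]

lemma InD.indicator {s : Set ℝ} {ε : ℂ} (hs : S.IsHalfLine s ε) {u v g : ℝ → ℂ}
    (h : S.InD u v g) (hu : u S.c = 0) (hv : v S.c = 0) :
    S.InD (s.indicator u) (s.indicator v) (s.indicator g) :=
  ⟨h.1.indicator hs (locallyIntegrable_wt_mul h.2.2) hu hv,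
    h.2.1.indicator hs.measurableSet, h.2.2.indicator hs.measurableSet⟩

/-- A solution of `ℓ u = z u` on `ℝ` with vanishing Cauchy data at `c` vanishes. -/
lemma IsEll.eq_zero {u v g : ℝ → ℂ} {z : ℂ} (h : S.IsEll u v g) (hg : ∀ᵐ x, g x = z * u x)
    (hu : u S.c = 0) (hv : v S.c = 0) (x : ℝ) : u x = 0 ∧ v x = 0 := by
  have hcu := h.1.continuous
  have hcv := h.2.1.continuous
  set Z : Set ℝ := {x | u x = 0 ∧ v x = 0}
  have hclosed : IsClosed Z :=
    (isClosed_eq hcu continuous_const).inter (isClosed_eq hcv continuous_const)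
  have hk₁ : LocallyIntegrable (fun x => ((S.p x)⁻¹ : ℝ) : ℝ → ℂ) :=
    locallyIntegrable_ofReal S.inv_p_locInt
  have hk₂ : LocallyIntegrable (fun x => (S.q x : ℂ) - z * S.wt x) :=
    (locallyIntegrable_ofReal S.q_locInt).sub (locallyIntegrable_wt.smul z)
  have hopen : IsOpen Z := by
    rw [isOpen_iff_mem_nhds]
    intro a ha
    refine eventually_eq_zero_of_volterra hk₁ hk₂ hcu hcv a (fun t => ?_) (fun t => ?_)
    · rw [h.1.integral_eq_sub (locallyIntegrable_mul_continuous hk₁ hcv), ha.1, sub_zero]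
      filter_upwards [h.2.2.1] with x hx
      refine hx.congr_deriv ?_
      push_cast
      rw [div_eq_mul_inv, mul_comm]
    · rw [h.2.1.integral_eq_sub (locallyIntegrable_mul_continuous hk₂ hcu), ha.2, sub_zero]
      filter_upwards [h.2.2.2, hg] with x hx hgx
      refine hx.congr_deriv ?_
      rw [hgx, wt]
      ring
  have : Z = univ := IsClopen.eq_univ ⟨hclosed, hopen⟩ ⟨S.c, hu, hv⟩
  have hx : x ∈ Z := this ▸ mem_univ x
  exact hx

/-- A solution of `ℓ u = z u` on a half-line with vanishing Cauchy data at `c` vanishes. -/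
lemma InD.eq_zero_on {s : Set ℝ} {ε : ℂ} (hs : S.IsHalfLine s ε) {u v g : ℝ → ℂ} {z : ℂ}
    (h : S.InD u v g) (hg : ∀ᵐ x, x ∈ s → g x = z * u x) (hu : u S.c = 0) (hv : v S.c = 0) :
    ∀ x ∈ s, u x = 0 := by
  intro x hx
  have := ((h.indicator hs hu hv).1.eq_zero (z := z) ?_ (by simp [hs.notMem])
    (by simp [hs.notMem]) x).1
  · simpa [hx] using this
  · filter_upwards [hg] with y hy
    by_cases hys : y ∈ s
    · simpa [hys] using hy hys
    · simp [hys]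

/-! ### Compactly supported elements of the maximal domain -/

variable (S) in
/-- A fundamental system of `ℓ y = 0` near `c`: it solves the equation on `[c - h, c + h]` and has
the Cauchy data `(1, 0)` and `(0, 1)` at `c`. Outside of that interval the coefficients `1/p` and
`q` are replaced by `0`, which makes the functions defined (and constant) on the rest of `ℝ`. -/
structure FundamentalSystem where
  h : ℝ
  (y₁ v₁ y₂ v₂ : ℝ → ℂ)
  h_pos : 0 < h
  (ac_y₁ : LocAC y₁) (ac_v₁ : LocAC v₁) (ac_y₂ : LocAC y₂) (ac_v₂ : LocAC v₂)
  deriv_y₁ : ∀ᵐ x, HasDerivAt y₁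
    ((Icc (S.c - h) (S.c + h)).indicator (fun x => ((S.p x : ℂ))⁻¹) x * v₁ x) x
  deriv_v₁ : ∀ᵐ x, HasDerivAt v₁
    ((Icc (S.c - h) (S.c + h)).indicator (fun x => (S.q x : ℂ)) x * y₁ x) x
  deriv_y₂ : ∀ᵐ x, HasDerivAt y₂
    ((Icc (S.c - h) (S.c + h)).indicator (fun x => ((S.p x : ℂ))⁻¹) x * v₂ x) x
  deriv_v₂ : ∀ᵐ x, HasDerivAt v₂
    ((Icc (S.c - h) (S.c + h)).indicator (fun x => (S.q x : ℂ)) x * y₂ x) x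
  (y₁_c : y₁ S.c = 1) (v₁_c : v₁ S.c = 0) (y₂_c : y₂ S.c = 0) (v₂_c : v₂ S.c = 1)

lemma nonempty_fundamentalSystem : Nonempty S.FundamentalSystem := by
  have hP : LocallyIntegrable (fun x => ((S.p x : ℂ))⁻¹) := by
    simpa using locallyIntegrable_ofReal S.inv_p_locInt
  have hQ : LocallyIntegrable (fun x => (S.q x : ℂ)) := locallyIntegrable_ofReal S.q_locInt
  obtain ⟨d₁, hd₁, hb₁⟩ := exists_setIntegral_norm_lt hP S.c (ε := 1 / 2) (by norm_num)
  obtain ⟨d₂, hd₂, hb₂⟩ := exists_setIntegral_norm_lt hQ S.c (ε := 1 / 2) (by norm_num)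
  set h := min d₁ d₂
  have hh : 0 < h := lt_min hd₁ hd₂
  set I := Icc (S.c - h) (S.c + h)
  have hI : MeasurableSet I := measurableSet_Icc
  have hk : ∀ {f : ℝ → ℂ}, LocallyIntegrable f → Integrable (I.indicator f) := fun hf =>
    (integrable_indicator_iff hI).2 (hf.integrableOn_isCompact isCompact_Icc)
  have hb : ∀ {f : ℝ → ℂ}, ∫ t in I, ‖f t‖ < 1 / 2 → ∫ t, ‖I.indicator f t‖ ≤ 1 / 2 := by
    intro f hf
    have : (fun t => ‖I.indicator f t‖) = I.indicator fun t => ‖f t‖ := by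
      ext t; rw [norm_indicator_eq_indicator_norm]
    rw [this, integral_indicator hI]
    exact hf.le
  have sol := exists_volterra_solution (hk hP) (hk hQ) (hb (hb₁ h ⟨hh, min_le_left _ _⟩))
    (hb (hb₂ h ⟨hh, min_le_right _ _⟩)) S.c
  have reg : ∀ {f y w : ℝ → ℂ} {a : ℂ}, Integrable f → Continuous w →
      (∀ t, y t = a + ∫ s in S.c..t, f s * w s) →
      LocAC y ∧ (∀ᵐ x, HasDerivAt y (f x * w x) x) ∧ y S.c = a := by
    intro f y w a hf hw hy
    have hi := locallyIntegrable_mul_continuous hf.locallyIntegrable hw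
    obtain rfl : y = fun t => a + ∫ s in S.c..t, f s * w s := funext hy
    refine ⟨(LocAC.const a).fun_add (locAC_integral hi S.c), ?_, by simp⟩
    filter_upwards [LocallyIntegrable.ae_hasDerivAt_integral hi] with x hx
    exact (hx S.c).const_add a
  obtain ⟨y₁, v₁, cy₁, cv₁, ey₁, ev₁⟩ := sol 1 0
  obtain ⟨y₂, v₂, cy₂, cv₂, ey₂, ev₂⟩ := sol 0 1
  have r1 := reg (hk hP) cv₁ ey₁
  have r2 := reg (hk hQ) cy₁ ev₁
  have r3 := reg (hk hP) cv₂ ey₂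
  have r4 := reg (hk hQ) cy₂ ev₂
  exact ⟨⟨h, y₁, v₁, y₂, v₂, hh, r1.1, r2.1, r3.1, r4.1, r1.2.1, r2.2.1, r3.2.1, r4.2.1,
    r1.2.2, r2.2.2, r3.2.2, r4.2.2⟩⟩

lemma memLp_of_bounded {w : ℝ → ℂ} {a b C : ℝ} (hw : AEStronglyMeasurable w S.μ)
    (hC : ∀ x, ‖w x‖ ≤ C) (h0 : ∀ x ∉ Icc a b, w x = 0) : MemLp w 2 S.μ := by
  have : w = (Icc a b).indicator w := by
    ext x
    by_cases hx : x ∈ Icc a b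
    · rw [indicator_of_mem hx]
    · simp only [indicator_of_notMem hx, h0 x hx]
  rw [this, memLp_indicator_iff_restrict measurableSet_Icc]
  have : IsFiniteMeasure (S.μ.restrict (Icc a b)) := ⟨by simpa using mu_lt_top isCompact_Icc⟩
  exact MemLp.of_bound hw.restrict C (Eventually.of_forall hC)

lemma exists_bound_of_continuous {w : ℝ → ℂ} (hw : Continuous w) {a b : ℝ}
    (h0 : ∀ x ∉ Icc a b, w x = 0) : ∃ C, ∀ x, ‖w x‖ ≤ C := by
  obtain ⟨C, hC⟩ := (isCompact_Icc (a := a) (b := b)).exists_bound_of_continuousOn hw.continuousOn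
  refine ⟨max C 0, fun x => ?_⟩
  by_cases hx : x ∈ Icc a b
  · exact (hC x hx).trans (le_max_left _ _)
  · rw [h0 x hx, norm_zero]
    exact le_max_right _ _

lemma setIntegral_Iic_eq {s : Set ℝ} {ε : ℂ} (hs : S.IsHalfLine s ε) {k : ℝ → ℂ}
    (hk : Integrable k) (h0 : ∫ t, k t = 0) : ∫ t in Iic S.c, k t = -ε * ∫ t in s, k t := by
  rcases hs with ⟨rfl, rfl⟩ | ⟨rfl, rfl⟩
  · have := intervalIntegral.integral_Iic_add_Ioi (b := S.c) hk.integrableOn hk.integrableOn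
    rw [h0] at this
    linear_combination this
  · rw [integral_Iic_eq_integral_Iio]
    ring

lemma norm_setIntegral_Iic_le {s : Set ℝ} {ε : ℂ} (hs : S.IsHalfLine s ε) {k : ℝ → ℂ}
    (hk : Integrable k) (h0 : ∫ t, k t = 0) {x : ℝ} (hx : x ∈ s) :
    ‖∫ t in Iic x, k t‖ ≤ ∫ t in s, ‖k t‖ := by
  have key : ∀ A ⊆ s, ‖∫ t in A, k t‖ ≤ ∫ t in s, ‖k t‖ := fun A hA =>
    (norm_integral_le_integral_norm _).trans
      (setIntegral_mono_set hk.norm.integrableOn (Eventually.of_forall fun _ => norm_nonneg _)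
        (LE.le.eventuallyLE hA))
  rcases hs with ⟨rfl, -⟩ | ⟨rfl, -⟩
  · have := intervalIntegral.integral_Iic_add_Ioi (b := x) hk.integrableOn hk.integrableOn
    rw [h0] at this
    rw [eq_neg_of_add_eq_zero_left this, norm_neg]
    exact key _ (Ioi_subset_Ioi (le_of_lt hx))
  · exact key _ (Iic_subset_Iio.2 hx)

namespace FundamentalSystem

variable (F : S.FundamentalSystem)

/-- The interval on which the fundamental system solves the equation. -/
def I : Set ℝ := Icc (S.c - F.h) (S.c + F.h)

lemma wronskian (x : ℝ) : F.y₁ x * F.v₂ x - F.v₁ x * F.y₂ x = 1 := by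
  have h := ((F.ac_y₁.mul F.ac_v₂).fun_sub (F.ac_v₁.mul F.ac_y₂)).eq_of_ae_hasDerivAt_zero ?_ S.c x
  · rw [h, F.y₁_c, F.v₂_c, F.y₂_c]; ring
  · filter_upwards [F.deriv_y₁, F.deriv_v₁, F.deriv_y₂, F.deriv_v₂] with t h1 h2 h3 h4
    refine ((h1.mul h4).sub (h2.mul h3)).congr_deriv ?_
    ring

lemma integrable_wt_mul {y g : ℝ → ℂ} {C : ℝ} (hy : Continuous y)
    (hg : AEStronglyMeasurable g) (hC : ∀ x, ‖g x‖ ≤ C) (h0 : ∀ x ∉ F.I, g x = 0) :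
    Integrable (fun x => S.wt x * (y x * g x)) := by
  have h1 : IntegrableOn (fun x => S.wt x * y x) F.I :=
    (locallyIntegrable_mul_continuous locallyIntegrable_wt hy).integrableOn_isCompact isCompact_Icc
  have h2 : IntegrableOn (fun x => S.wt x * y x * g x) F.I :=
    Integrable.mul_bdd h1 hg.restrict (Eventually.of_forall hC)
  have h3 : Integrable (F.I.indicator fun x => S.wt x * y x * g x) :=
    (integrable_indicator_iff measurableSet_Icc).2 h2
  refine h3.congr (Eventually.of_forall fun x => ?_)
  by_cases hx : x ∈ F.I
  · rw [indicator_of_mem hx, mul_assoc]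
  · simp only [indicator_of_notMem hx, h0 x hx]
    simp

/-- Variation of parameters: if `g` is bounded, supported near `c` and orthogonal to the
solutions of the homogeneous equation, then `ℓ u = g` has a compactly supported solution. -/
lemma exists_inD_of_integral_eq_zero {g : ℝ → ℂ} {C : ℝ} (hg : AEStronglyMeasurable g)
    (hC : ∀ x, ‖g x‖ ≤ C) (h0 : ∀ x ∉ F.I, g x = 0)
    (i₁ : ∫ x, S.wt x * (F.y₁ x * g x) = 0) (i₂ : ∫ x, S.wt x * (F.y₂ x * g x) = 0) :
    ∃ u v : ℝ → ℂ, S.InD u v g ∧ (∀ x ∉ F.I, u x = 0 ∧ v x = 0) ∧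
      (∀ x, u x = (∫ t in Iic x, S.wt t * (F.y₂ t * g t)) * F.y₁ x -
        (∫ t in Iic x, S.wt t * (F.y₁ t * g t)) * F.y₂ x) ∧
      (∀ x, v x = (∫ t in Iic x, S.wt t * (F.y₂ t * g t)) * F.v₁ x -
        (∫ t in Iic x, S.wt t * (F.y₁ t * g t)) * F.v₂ x) := by
  have prim : ∀ {k : ℝ → ℂ}, Integrable k →
      LocAC (fun x => ∫ t in Iic x, k t) ∧
        ∀ᵐ x, HasDerivAt (fun x => ∫ t in Iic x, k t) (k x) x := by
    intro k hk
    have e : (fun x => ∫ t in Iic x, k t) =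
        fun x => (∫ t in Iic S.c, k t) + ∫ t in S.c..x, k t := by
      ext x
      rw [← intervalIntegral.integral_Iic_sub_Iic hk.integrableOn hk.integrableOn]
      ring
    rw [e]
    refine ⟨(LocAC.const _).fun_add (locAC_integral hk.locallyIntegrable _), ?_⟩
    filter_upwards [LocallyIntegrable.ae_hasDerivAt_integral hk.locallyIntegrable] with x hx
    exact (hx S.c).const_add _
  have vanish : ∀ {k : ℝ → ℂ}, Integrable k → (∫ t, k t = 0) → (∀ x ∉ F.I, k x = 0) →
      ∀ x ∉ F.I, ∫ t in Iic x, k t = 0 := by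
    intro k hk hk0 hkI x hx
    rw [I, mem_Icc, not_and_or, not_le, not_le] at hx
    rcases hx with hx | hx
    · refine setIntegral_eq_zero_of_forall_eq_zero fun t ht => hkI t fun htI => ?_
      exact absurd htI.1 (not_le.2 (lt_of_le_of_lt ht hx))
    · have := intervalIntegral.integral_Iic_add_Ioi (b := x) hk.integrableOn hk.integrableOn
      rw [hk0, setIntegral_eq_zero_of_forall_eq_zero (t := Ioi x), add_zero] at this
      · exact this
      · refine fun t ht => hkI t fun htI => ?_
        exact absurd htI.2 (not_le.2 (lt_trans hx ht))
  have hk₁ := F.integrable_wt_mul F.ac_y₁.continuous hg hC h0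
  have hk₂ := F.integrable_wt_mul F.ac_y₂.continuous hg hC h0
  have z₁ := vanish hk₁ i₁ (fun x hx => by simp [h0 x hx])
  have z₂ := vanish hk₂ i₂ (fun x hx => by simp [h0 x hx])
  obtain ⟨ac₁, d₁⟩ := prim hk₁
  obtain ⟨ac₂, d₂⟩ := prim hk₂
  set η₁ := fun x => ∫ t in Iic x, S.wt t * (F.y₁ t * g t)
  set η₂ := fun x => ∫ t in Iic x, S.wt t * (F.y₂ t * g t)
  set u : ℝ → ℂ := fun x => η₂ x * F.y₁ x - η₁ x * F.y₂ x
  set v : ℝ → ℂ := fun x => η₂ x * F.v₁ x - η₁ x * F.v₂ x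
  have acu : LocAC u := (ac₂.mul F.ac_y₁).fun_sub (ac₁.mul F.ac_y₂)
  have acv : LocAC v := (ac₂.mul F.ac_v₁).fun_sub (ac₁.mul F.ac_v₂)
  have hu0 : ∀ x ∉ F.I, u x = 0 := fun x hx => by simp [u, η₁, η₂, z₁ x hx, z₂ x hx]
  have hv0 : ∀ x ∉ F.I, v x = 0 := fun x hx => by simp [v, η₁, η₂, z₁ x hx, z₂ x hx]
  obtain ⟨Cu, hCu⟩ := exists_bound_of_continuous acu.continuous hu0
  refine ⟨u, v, ⟨⟨acu, acv, ?_, ?_⟩, ?_, ?_⟩, fun x hx => ⟨hu0 x hx, hv0 x hx⟩,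
    fun x => rfl, fun x => rfl⟩
  · filter_upwards [F.deriv_y₁, F.deriv_y₂, d₁, d₂] with x h1 h2 h3 h4
    refine ((h4.mul h1).sub (h3.mul h2)).congr_deriv ?_
    by_cases hx : x ∈ F.I
    · have hx' := hx
      simp only [I] at hx'
      simp only [indicator_of_mem hx', v, div_eq_mul_inv]
      ring
    · simp only [hv0 x hx, h0 x hx]
      have e1 : η₁ x = 0 := z₁ x hx
      have e2 : η₂ x = 0 := z₂ x hx
      simp [e1, e2]
  · filter_upwards [F.deriv_v₁, F.deriv_v₂, d₁, d₂] with x h1 h2 h3 h4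
    refine ((h4.mul h1).sub (h3.mul h2)).congr_deriv ?_
    by_cases hx : x ∈ F.I
    · have hx' := hx
      simp only [I] at hx'
      have hw := F.wronskian x
      simp only [indicator_of_mem hx', u]
      change _ = (S.q x : ℂ) * _ - S.wt x * g x
      linear_combination (-S.wt x * g x) * hw
    · simp only [hu0 x hx, h0 x hx]
      have e1 : η₁ x = 0 := z₁ x hx
      have e2 : η₂ x = 0 := z₂ x hx
      simp [e1, e2]
  · exact memLp_of_bounded acu.continuous.aestronglyMeasurable hCu hu0
  · exact memLp_of_bounded (hg.mono_ac (withDensity_absolutelyContinuous _ _)) hC h0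

/-- The functionals `g ↦ ∫ yᵢ g |r|` are linearly independent on the bounded functions supported
near `c` on a given side of `c`, by nondegeneracy of the Gram matrix. -/
lemma exists_integral_eq {s : Set ℝ} {ε : ℂ} (hs : S.IsHalfLine s ε) (α β : ℂ) :
    ∃ (g : ℝ → ℂ) (C : ℝ), AEStronglyMeasurable g ∧ (∀ x, ‖g x‖ ≤ C) ∧
      (∀ x ∉ F.I ∩ s, g x = 0) ∧ ∫ x, S.wt x * (F.y₁ x * g x) = α ∧
      ∫ x, S.wt x * (F.y₂ x * g x) = β := by
  set J : Set ℝ := Ioo (S.c - F.h) (S.c + F.h) ∩ s with hJ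
  have hJo : IsOpen J := isOpen_Ioo.inter hs.isOpen
  have hcJ : S.c ∈ closure J := by
    rw [mem_closure_iff_nhdsWithin_neBot, hJ, nhdsWithin_inter_of_mem,
      ← mem_closure_iff_nhdsWithin_neBot]
    · exact hs.mem_closure
    · exact mem_nhdsWithin_of_mem_nhds
        (Ioo_mem_nhds (by linarith [F.h_pos]) (by linarith [F.h_pos]))
  have hJI : J ⊆ F.I ∩ s := inter_subset_inter_left _ Ioo_subset_Icc_self
  have cy₁ := F.ac_y₁.continuous
  have cy₂ := F.ac_y₂.continuous
  let g : ℂ × ℂ → ℝ → ℂ := fun a =>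
    J.indicator fun x => a.1 * conj (F.y₁ x) + a.2 * conj (F.y₂ x)
  have hcont : ∀ a : ℂ × ℂ, Continuous fun x => a.1 * conj (F.y₁ x) + a.2 * conj (F.y₂ x) := by
    intro a
    have c1 : Continuous fun x => conj (F.y₁ x) := Complex.continuous_conj.comp cy₁
    have c2 : Continuous fun x => conj (F.y₂ x) := Complex.continuous_conj.comp cy₂
    fun_prop
  have hgm : ∀ a, AEStronglyMeasurable (g a) := fun a =>
    ((hcont a).stronglyMeasurable.indicator hJo.measurableSet).aestronglyMeasurable
  have hgb : ∀ a, ∃ C, ∀ x, ‖g a x‖ ≤ C := by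
    intro a
    obtain ⟨C, hC⟩ := (isCompact_Icc (a := S.c - F.h)
      (b := S.c + F.h)).exists_bound_of_continuousOn (hcont a).continuousOn
    refine ⟨max C 0, fun x => ?_⟩
    by_cases hx : x ∈ J
    · simp only [g, indicator_of_mem hx]
      exact (hC x (hJI hx).1).trans (le_max_left _ _)
    · simp [g, indicator_of_notMem hx]
  have hg0 : ∀ a, ∀ x ∉ F.I ∩ s, g a x = 0 := fun a x hx =>
    indicator_of_notMem (fun h => hx (hJI h)) _
  have hg0' : ∀ a, ∀ x ∉ F.I, g a x = 0 := fun a x hx => hg0 a x fun h => hx h.1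
  have hint : ∀ (a : ℂ × ℂ) {y : ℝ → ℂ}, Continuous y →
      Integrable fun x => S.wt x * (y x * g a x) := by
    intro a y hy
    obtain ⟨C, hC⟩ := hgb a
    exact F.integrable_wt_mul hy (hgm a) hC (hg0' a)
  have hadd : ∀ (a b : ℂ × ℂ) (x : ℝ), g (a + b) x = g a x + g b x := by
    intro a b x
    by_cases hx : x ∈ J
    · simp only [g, indicator_of_mem hx, Prod.fst_add, Prod.snd_add]; ring
    · simp [g, indicator_of_notMem hx]
  have hsmul : ∀ (k : ℂ) (a : ℂ × ℂ) (x : ℝ), g (k • a) x = k * g a x := by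
    intro k a x
    by_cases hx : x ∈ J
    · simp only [g, indicator_of_mem hx, Prod.smul_fst, Prod.smul_snd, smul_eq_mul]; ring
    · simp [g, indicator_of_notMem hx]
  have ladd : ∀ (a b : ℂ × ℂ) {y : ℝ → ℂ}, Continuous y → ∫ x, S.wt x * (y x * g (a + b) x) =
      (∫ x, S.wt x * (y x * g a x)) + ∫ x, S.wt x * (y x * g b x) := by
    intro a b y hy
    rw [← integral_add (hint a hy) (hint b hy)]
    congr 1; ext x; rw [hadd]; ring
  have lsmul : ∀ (k : ℂ) (a : ℂ × ℂ) {y : ℝ → ℂ}, Continuous y →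
      ∫ x, S.wt x * (y x * g (k • a) x) = k * ∫ x, S.wt x * (y x * g a x) := by
    intro k a y hy
    rw [← integral_const_mul]
    congr 1; ext x; rw [hsmul]; ring
  let G : ℂ × ℂ →ₗ[ℂ] ℂ × ℂ :=
    { toFun := fun a => (∫ x, S.wt x * (F.y₁ x * g a x), ∫ x, S.wt x * (F.y₂ x * g a x))
      map_add' := fun a b => by rw [ladd a b cy₁, ladd a b cy₂]; rfl
      map_smul' := fun k a => by rw [lsmul k a cy₁, lsmul k a cy₂]; rfl }
  have hinj : Function.Injective G := by
    rw [injective_iff_map_eq_zero]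
    intro a ha
    have e1 : ∫ x, S.wt x * (F.y₁ x * g a x) = 0 := congrArg Prod.fst ha
    have e2 : ∫ x, S.wt x * (F.y₂ x * g a x) = 0 := congrArg Prod.snd ha
    have hw : Continuous fun x => conj a.1 * F.y₁ x + conj a.2 * F.y₂ x := by fun_prop
    have hsq : ∀ x, (conj a.1 * F.y₁ x + conj a.2 * F.y₂ x) * g a x =
        ((‖g a x‖ ^ 2 : ℝ) : ℂ) := by
      intro x
      by_cases hx : x ∈ J
      · rw [Complex.ofReal_pow, ← Complex.conj_mul']
        simp [g, indicator_of_mem hx]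
      · simp [g, indicator_of_notMem hx]
    have e3 : ∫ x, S.wt x * ((conj a.1 * F.y₁ x + conj a.2 * F.y₂ x) * g a x) = 0 := by
      have : (fun x => S.wt x * ((conj a.1 * F.y₁ x + conj a.2 * F.y₂ x) * g a x)) = fun x =>
          conj a.1 * (S.wt x * (F.y₁ x * g a x)) + conj a.2 * (S.wt x * (F.y₂ x * g a x)) := by
        ext x; ring
      rw [this, integral_add ((hint a cy₁).const_mul _) ((hint a cy₂).const_mul _),
        integral_const_mul, integral_const_mul, e1, e2]
      simp
    have hi := hint a hw
    simp only [hsq] at e3 hi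
    have e4 : (fun x => S.wt x * ((‖g a x‖ ^ 2 : ℝ) : ℂ)) =
        fun x => ((|S.r x| * ‖g a x‖ ^ 2 : ℝ) : ℂ) := by
      ext x; simp [wt]
    rw [e4] at e3 hi
    rw [integral_complex_ofReal, Complex.ofReal_eq_zero,
      integral_eq_zero_iff_of_nonneg (fun x => by positivity) (by
        have := hi.re
        simpa only [RCLike.re_eq_complex_re, Complex.ofReal_re] using this)] at e3
    have hgJ : ∀ᵐ x, x ∈ J → conj a.1 * F.y₁ x + conj a.2 * F.y₂ x = 0 := by
      filter_upwards [e3, r_ne_zero (S := S)] with x hx hr hxJ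
      have : g a x = 0 := by simpa [hr] using hx
      simp only [g, indicator_of_mem hxJ] at this
      have := congrArg conj this
      simpa using this
    have hz := eq_zero_of_ae hJo hw hgJ
    have hzc : conj a.1 * F.y₁ S.c + conj a.2 * F.y₂ S.c = 0 :=
      closure_minimal hz (isClosed_eq hw continuous_const) hcJ
    have cv₁ := F.ac_v₁.continuous
    have cv₂ := F.ac_v₂.continuous
    have hv : Continuous fun x => conj a.1 * F.v₁ x + conj a.2 * F.v₂ x := by fun_prop
    have hvJ : ∀ᵐ x, x ∈ J → conj a.1 * F.v₁ x + conj a.2 * F.v₂ x = 0 := by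
      filter_upwards [F.deriv_y₁, F.deriv_y₂, S.p_pos] with x h1 h2 hp hxJ
      have d0 : HasDerivAt (fun x => conj a.1 * F.y₁ x + conj a.2 * F.y₂ x) 0 x :=
        (hasDerivAt_const x (0 : ℂ)).congr_of_eventuallyEq
          (by filter_upwards [hJo.mem_nhds hxJ] with y hy using hz y hy)
      have := ((h1.const_mul (conj a.1)).add (h2.const_mul (conj a.2))).unique d0
      have hxI := (hJI hxJ).1
      simp only [I] at hxI
      simp only [indicator_of_mem hxI] at this
      have hp' : ((S.p x : ℂ))⁻¹ ≠ 0 := inv_ne_zero (by exact_mod_cast hp.ne')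
      refine (mul_eq_zero.1 (?_ : ((S.p x : ℂ))⁻¹ * _ = 0)).resolve_left hp'
      rw [← this]; ring
    have hvz : conj a.1 * F.v₁ S.c + conj a.2 * F.v₂ S.c = 0 :=
      closure_minimal (eq_zero_of_ae hJo hv hvJ) (isClosed_eq hv continuous_const) hcJ
    simp only [F.y₁_c, F.y₂_c, F.v₁_c, F.v₂_c] at hzc hvz
    ext <;> simp_all
  obtain ⟨a, ha⟩ := LinearMap.injective_iff_surjective.1 hinj (α, β)
  obtain ⟨C, hC⟩ := hgb a
  exact ⟨g a, C, hgm a, hC, hg0 a, congrArg Prod.fst ha, congrArg Prod.snd ha⟩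

/-- A bounded function supported near `c` on one side of `c` is there of the form `ℓ u` for a
compactly supported `u`. -/
lemma exists_inD_extension {s : Set ℝ} {ε : ℂ} (hs : S.IsHalfLine s ε) {g₀ : ℝ → ℂ} {C₀ : ℝ}
    (hg₀ : AEStronglyMeasurable g₀) (hC₀ : ∀ x, ‖g₀ x‖ ≤ C₀) (h₀ : ∀ x ∉ F.I ∩ s, g₀ x = 0) :
    ∃ u v g : ℝ → ℂ, S.InD u v g ∧ (∀ x ∉ F.I, u x = 0 ∧ v x = 0 ∧ g x = 0) ∧
      (∀ x ∈ s, g x = g₀ x) ∧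
      u S.c = -ε * ∫ x, S.wt x * (F.y₂ x * g₀ x) ∧
      v S.c = ε * ∫ x, S.wt x * (F.y₁ x * g₀ x) ∧
      ∀ x ∈ s, ‖u x‖ ≤ (∫ t, ‖S.wt t * (F.y₂ t * g₀ t)‖) * ‖F.y₁ x‖ +
        (∫ t, ‖S.wt t * (F.y₁ t * g₀ t)‖) * ‖F.y₂ x‖ := by
  have cy₁ := F.ac_y₁.continuous
  have cy₂ := F.ac_y₂.continuous
  obtain ⟨s', hs', hd, -⟩ := exists_other_halfLine hs
  obtain ⟨g₁, C₁, hg₁, hC₁, h₁, i₁, i₂⟩ := F.exists_integral_eq hs'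
    (-∫ x, S.wt x * (F.y₁ x * g₀ x)) (-∫ x, S.wt x * (F.y₂ x * g₀ x))
  have h₀' : ∀ x ∉ F.I, g₀ x = 0 := fun x hx => h₀ x fun h => hx h.1
  have h₁' : ∀ x ∉ F.I, g₁ x = 0 := fun x hx => h₁ x fun h => hx h.1
  set g : ℝ → ℂ := fun x => g₀ x + g₁ x
  have hg : AEStronglyMeasurable g := hg₀.add hg₁
  have hC : ∀ x, ‖g x‖ ≤ C₀ + C₁ := fun x => (norm_add_le _ _).trans (add_le_add (hC₀ x) (hC₁ x))
  have h : ∀ x ∉ F.I, g x = 0 := fun x hx => by simp [g, h₀' x hx, h₁' x hx]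
  have hgs : ∀ x ∈ s, g x = g₀ x := fun x hx => by
    simp [g, h₁ x (fun hh => disjoint_left.1 hd hx hh.2)]
  have total : ∀ {y : ℝ → ℂ}, Continuous y →
      ∫ x, S.wt x * (y x * g₁ x) = -∫ x, S.wt x * (y x * g₀ x) →
      ∫ x, S.wt x * (y x * g x) = 0 := by
    intro y hy e
    have : (fun x => S.wt x * (y x * g x)) =
        fun x => S.wt x * (y x * g₀ x) + S.wt x * (y x * g₁ x) := by
      ext x; simp only [g]; ring
    rw [this, integral_add (F.integrable_wt_mul hy hg₀ hC₀ h₀')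
      (F.integrable_wt_mul hy hg₁ hC₁ h₁'), e]
    ring
  have onS : ∀ y : ℝ → ℂ, ∫ x in s, S.wt x * (y x * g x) = ∫ x, S.wt x * (y x * g₀ x) := by
    intro y
    rw [← integral_indicator hs.measurableSet]
    congr 1; ext x
    by_cases hx : x ∈ s
    · rw [indicator_of_mem hx, hgs x hx]
    · rw [indicator_of_notMem hx, h₀ x fun hh => hx hh.2]; simp
  have onS' : ∀ y : ℝ → ℂ,
      ∫ x in s, ‖S.wt x * (y x * g x)‖ = ∫ x, ‖S.wt x * (y x * g₀ x)‖ := by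
    intro y
    rw [← integral_indicator hs.measurableSet]
    congr 1; ext x
    by_cases hx : x ∈ s
    · rw [indicator_of_mem hx, hgs x hx]
    · rw [indicator_of_notMem hx, h₀ x fun hh => hx hh.2]; simp
  have t₁ := total cy₁ i₁
  have t₂ := total cy₂ i₂
  have k₁ := F.integrable_wt_mul cy₁ hg hC h
  have k₂ := F.integrable_wt_mul cy₂ hg hC h
  obtain ⟨u, v, hD, huv, hu, hv⟩ := F.exists_inD_of_integral_eq_zero hg hC h t₁ t₂
  refine ⟨u, v, g, hD, fun x hx => ⟨(huv x hx).1, (huv x hx).2, h x hx⟩, hgs, ?_, ?_, ?_⟩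
  · rw [hu, F.y₁_c, F.y₂_c, setIntegral_Iic_eq hs k₂ t₂, onS]; ring
  · rw [hv, F.v₁_c, F.v₂_c, setIntegral_Iic_eq hs k₁ t₁, onS]; ring
  · intro x hx
    rw [hu]
    refine (norm_sub_le _ _).trans ?_
    rw [norm_mul, norm_mul, ← onS', ← onS']
    gcongr
    · exact norm_setIntegral_Iic_le hs k₂ t₂ hx
    · exact norm_setIntegral_Iic_le hs k₁ t₁ hx

end FundamentalSystem

/-- Arbitrary Cauchy data at `c` are attained by compactly supported elements of the domain. -/
lemma exists_inD_cauchyData (x y : ℂ) : ∃ u v g : ℝ → ℂ, S.InD u v g ∧ u S.c = x ∧ v S.c = y ∧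
    ∃ h > 0, ∀ t ∉ Icc (S.c - h) (S.c + h), u t = 0 ∧ v t = 0 ∧ g t = 0 := by
  obtain ⟨F⟩ := nonempty_fundamentalSystem (S := S)
  have hs : S.IsHalfLine (Ioi S.c) 1 := Or.inl ⟨rfl, rfl⟩
  obtain ⟨g₀, C, hg₀, hC, h0, i₁, i₂⟩ := F.exists_integral_eq hs y (-x)
  obtain ⟨u, v, g, hD, h, -, hu, hv, -⟩ := F.exists_inD_extension hs hg₀ hC h0
  refine ⟨u, v, g, hD, ?_, ?_, F.h, F.h_pos, h⟩
  · rw [hu, i₂]; ring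
  · rw [hv, i₁]; ring

/-- There are elements `u` of the domain with `(p u')(c) = 1` whose value at `c` and whose energy
on a given side of `c` are arbitrarily small. In other words, `u ↦ (p u')(c)` is not continuous
with respect to the energy norm, so that the Dirichlet condition is the form condition. -/
lemma exists_inD_small_energy {s : Set ℝ} {ε : ℂ} (hs : S.IsHalfLine s ε) {δ : ℝ} (hδ : 0 < δ) :
    ∃ u v g : ℝ → ℂ, S.InD u v g ∧ v S.c = 1 ∧ ‖u S.c‖ ≤ δ ∧
      ‖∫ x in s, conj (g x) * u x ∂S.μ‖ ≤ δ := by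
  obtain ⟨F⟩ := nonempty_fundamentalSystem (S := S)
  have cy₁ := F.ac_y₁.continuous
  have cy₂ := F.ac_y₂.continuous
  -- with this `η` the function constructed satisfies `‖u x‖ ≤ 6 η` on the support of `g`
  -- in `s`, and its energy on `s` is at most `12 η`
  set η : ℝ := δ / 12 with hη
  have hη0 : 0 < η := by positivity
  obtain ⟨d, hd, hball⟩ : ∃ d > 0, ∀ x, |x - S.c| < d → ‖F.y₁ x - 1‖ ≤ 1 / 2 ∧ ‖F.y₂ x‖ ≤ η := by
    have e1 : ∀ᶠ x in 𝓝 S.c, ‖F.y₁ x - 1‖ < 1 / 2 :=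
      (by fun_prop : Continuous fun x => ‖F.y₁ x - 1‖).continuousAt.eventually_lt
        continuousAt_const (by rw [F.y₁_c]; norm_num)
    have e2 : ∀ᶠ x in 𝓝 S.c, ‖F.y₂ x‖ < η :=
      (by fun_prop : Continuous fun x => ‖F.y₂ x‖).continuousAt.eventually_lt
        continuousAt_const (by rw [F.y₂_c]; simpa using hη0)
    obtain ⟨d, hd, hb⟩ := Metric.eventually_nhds_iff.1 (e1.and e2)
    exact ⟨d, hd, fun x hx =>
      ⟨(hb (by rwa [Real.dist_eq])).1.le, (hb (by rwa [Real.dist_eq])).2.le⟩⟩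
  set d' := min d F.h
  have hd' : 0 < d' := lt_min hd F.h_pos
  set J : Set ℝ := Ioo (S.c - d') (S.c + d') ∩ s
  have hJo : IsOpen J := isOpen_Ioo.inter hs.isOpen
  have hJm := hJo.measurableSet
  have hJne : J.Nonempty :=
    mem_closure_iff_nhds.1 hs.mem_closure _ (Ioo_mem_nhds (by linarith) (by linarith))
  have hJI : J ⊆ F.I ∩ s := by
    refine inter_subset_inter_left _ fun x hx => ?_
    have := min_le_right d F.h
    exact ⟨by linarith [hx.1], by linarith [hx.2]⟩
  have hJb : ∀ x ∈ J, ‖F.y₁ x - 1‖ ≤ 1 / 2 ∧ ‖F.y₂ x‖ ≤ η := by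
    intro x hx
    have := min_le_left d F.h
    refine hball x (abs_lt.2 ⟨by linarith [hx.1.1], by linarith [hx.1.2]⟩)
  have hy₁ : ∀ x ∈ J, ‖F.y₁ x‖ ≤ 3 / 2 := fun x hx => by
    have := norm_le_norm_add_norm_sub' (F.y₁ x) 1
    rw [norm_one] at this
    linarith [(hJb x hx).1]
  have hJfin : S.μ J < ⊤ := (measure_mono fun x hx => (hJI hx).1).trans_lt (mu_lt_top isCompact_Icc)
  -- the mass of the interval on which `g₀` is supported
  set m : ℝ := (S.μ J).toReal
  have hm : 0 < m := by
    refine ENNReal.toReal_pos (fun h => ?_) hJfin.ne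
    have h1 : ∀ᵐ x ∂S.μ, x ∉ J := by rwa [ae_iff, show {a | ¬ a ∉ J} = J by ext; simp]
    rw [ae_mu_iff, ae_iff, show {a | ¬ a ∉ J} = J by ext; simp] at h1
    exact (hJo.measure_pos volume hJne).ne' h1
  have hμJ : IsFiniteMeasure (S.μ.restrict J) := ⟨by simpa using hJfin⟩
  have hi₁ : IntegrableOn F.y₁ J S.μ :=
    Integrable.of_bound cy₁.aestronglyMeasurable (3 / 2)
      (by filter_upwards [ae_restrict_mem hJm] with x hx using hy₁ x hx)
  have hi₂ : IntegrableOn F.y₂ J S.μ :=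
    Integrable.of_bound cy₂.aestronglyMeasurable η
      (by filter_upwards [ae_restrict_mem hJm] with x hx using (hJb x hx).2)
  set A : ℂ := ∫ x in J, F.y₁ x ∂S.μ
  have hA : m / 2 ≤ ‖A‖ := by
    have h1 : ‖∫ x in J, (F.y₁ x - 1) ∂S.μ‖ ≤ 1 / 2 * m :=
      norm_setIntegral_le_of_norm_le_const hJfin fun x hx => (hJb x hx).1
    rw [integral_sub hi₁ (integrable_const _)] at h1
    have h2 : ∫ x in J, (1 : ℂ) ∂S.μ = (m : ℂ) := by
      simp [m, Measure.real]
    rw [h2] at h1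
    have h3 := norm_sub_norm_le (m : ℂ) A
    rw [norm_sub_rev, Complex.norm_real, Real.norm_of_nonneg hm.le] at h3
    linarith
  have hA0 : A ≠ 0 := fun h => by rw [h, norm_zero] at hA; linarith
  have hκ : ‖A⁻¹‖ ≤ 2 / m := by
    rw [norm_inv, inv_le_comm₀ (by linarith) (by positivity)]
    rw [inv_div]
    exact hA
  have hε : ‖ε‖ = 1 := by rcases hs with ⟨-, rfl⟩ | ⟨-, rfl⟩ <;> simp
  have hε2 : ε * ε = 1 := by rcases hs with ⟨-, rfl⟩ | ⟨-, rfl⟩ <;> simp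
  -- `ℓ u` is constant on `J`, and the constant is normalized by `(p u')(c) = 1`
  set g₀ : ℝ → ℂ := J.indicator fun _ => ε * A⁻¹
  have hg₀n : ∀ x, ‖g₀ x‖ ≤ ‖A⁻¹‖ := by
    intro x
    refine (norm_indicator_le_norm_self _ _).trans ?_
    rw [norm_mul, hε, one_mul]
  have hg₀0 : ∀ x ∉ F.I ∩ s, g₀ x = 0 := fun x hx => indicator_of_notMem (fun h => hx (hJI h)) _
  have hint : ∀ y : ℝ → ℂ,
      ∫ x, S.wt x * (y x * g₀ x) = ε * A⁻¹ * ∫ x in J, y x ∂S.μ := by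
    intro y
    rw [← integral_mu, ← integral_const_mul, ← integral_indicator hJm]
    congr 1; ext x
    by_cases hx : x ∈ J
    · simp only [g₀, indicator_of_mem hx]; ring
    · simp [g₀, indicator_of_notMem hx]
  have hnorm : ∀ (y : ℝ → ℂ) (K : ℝ), (∀ x ∈ J, ‖y x‖ ≤ K) → 0 ≤ K → IntegrableOn y J S.μ →
      ∫ x, ‖S.wt x * (y x * g₀ x)‖ ≤ 2 * K := by
    intro y K hK hK0 hy
    have e1 : (∫ x, ‖S.wt x * (y x * g₀ x)‖ : ℝ) = ‖A⁻¹‖ * ∫ x in J, ‖y x‖ ∂S.μ := by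
      have h1 := integral_mu (S := S) fun x => ((‖y x * g₀ x‖ : ℝ) : ℂ)
      have h2 : (fun x => S.wt x * ((‖y x * g₀ x‖ : ℝ) : ℂ)) =
          fun x => ((‖S.wt x * (y x * g₀ x)‖ : ℝ) : ℂ) := by
        ext x; simp [wt]
      rw [h2, integral_complex_ofReal, integral_complex_ofReal, Complex.ofReal_inj] at h1
      rw [← h1, ← integral_const_mul, ← integral_indicator hJm]
      congr 1; ext x
      by_cases hx : x ∈ J
      · simp only [g₀, indicator_of_mem hx, norm_mul, hε]; ring
      · simp [g₀, indicator_of_notMem hx]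
    rw [e1]
    have e2 : ∫ x in J, ‖y x‖ ∂S.μ ≤ K * m := by
      have := norm_setIntegral_le_of_norm_le_const (μ := S.μ) (f := fun x => ‖y x‖) (C := K) hJfin
        fun x hx => by simpa using hK x hx
      exact (le_abs_self _).trans this
    calc ‖A⁻¹‖ * ∫ x in J, ‖y x‖ ∂S.μ ≤ 2 / m * (K * m) := by
          gcongr
      _ = 2 * K := by field_simp
  obtain ⟨u, v, g, hD, -, hg, huc, hvc, hub⟩ := F.exists_inD_extension hs
    (g₀ := g₀) (aestronglyMeasurable_const.indicator hJm) hg₀n hg₀0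
  have n₁ := hnorm F.y₁ (3 / 2) hy₁ (by norm_num) hi₁
  have n₂ := hnorm F.y₂ η (fun x hx => (hJb x hx).2) hη0.le hi₂
  have huJ : ∀ x ∈ J, ‖u x‖ ≤ 6 * η := by
    intro x hx
    refine (hub x hx.2).trans ?_
    calc _ ≤ (2 * η) * (3 / 2) + (2 * (3 / 2)) * η := by
          gcongr
          · exact hy₁ x hx
          · exact (hJb x hx).2
      _ = 6 * η := by ring
  refine ⟨u, v, g, hD, ?_, ?_, ?_⟩
  · rw [hvc, hint]
    change ε * (ε * A⁻¹ * A) = 1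
    rw [mul_assoc, inv_mul_cancel₀ hA0, mul_one, hε2]
  · rw [huc, norm_mul, norm_neg, hε, one_mul]
    refine (norm_integral_le_integral_norm _).trans (n₂.trans ?_)
    rw [hη]; linarith
  · have e : ∫ x in s, conj (g x) * u x ∂S.μ = ∫ x in J, conj (g x) * u x ∂S.μ := by
      refine setIntegral_eq_of_subset_of_forall_sdiff_eq_zero hs.measurableSet
        (fun x hx => hx.2) fun x hx => ?_
      rw [hg x hx.1]
      simp [g₀, indicator_of_notMem hx.2]
    rw [e]
    refine (norm_setIntegral_le_of_norm_le_const (C := 2 / m * (6 * η)) hJfin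
      fun x hx => ?_).trans ?_
    · rw [norm_mul, RCLike.norm_conj, hg x hx.2]
      gcongr
      · exact (hg₀n x).trans hκ
      · exact huJ x hx
    · change 2 / m * (6 * η) * m ≤ δ
      rw [hη]
      field_simp
      norm_num

end SLCoeff

/-! ### Positivity of the inverse of an operator with positive spectrum -/

lemma opShift_apply {E : Type*} [NormedAddCommGroup E] [NormedSpace ℂ E] (T : E →ₗ.[ℂ] E) (z : ℂ)
    (f : T.domain) : opShift T z f = T f - z • (f : E) := rfl

section Abstract

variable {E : Type*} [NormedAddCommGroup E] [InnerProductSpace ℂ E] [CompleteSpace E]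

/-- The inverse of a symmetric operator whose spectrum contains no number `≤ 0` is positive. -/
lemma isPositive_inverse {T : E →ₗ.[ℂ] E} (hT : T.IsFormalAdjoint T) {R : E →L[ℂ] E}
    (hR : ∀ g, ∃ h : R g ∈ T.domain, T ⟨R g, h⟩ = g) (hR' : ∀ f : T.domain, R (T f) = f)
    (hneg : ∀ x : ℝ, x < 0 → (x : ℂ) ∈ opResolventSet T) : R.IsPositive := by
  have hsymm : IsSelfAdjoint R := by
    rw [ContinuousLinearMap.isSelfAdjoint_iff_isSymmetric]
    intro f g
    obtain ⟨hf, ef⟩ := hR f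
    obtain ⟨hg, eg⟩ := hR g
    have := hT ⟨R f, hf⟩ ⟨R g, hg⟩
    rw [ef, eg] at this
    exact this.symm
  rw [← ContinuousLinearMap.nonneg_iff_isPositive,
    StarOrderedRing.nonneg_iff_spectrum_nonneg (R := ℝ) R hsymm]
  intro x hx
  by_contra! hx0
  obtain ⟨R', h1, h2⟩ := hneg x⁻¹ (inv_lt_zero.2 hx0)
  refine hx ?_
  set k : ℂ := ((x⁻¹ : ℝ) : ℂ) with hk
  -- the resolvent identity between `0` and `1 / x`, in both orders
  have e1 : ∀ g, R' g = R g + k • R (R' g) := by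
    intro g
    obtain ⟨h, e⟩ := h1 g
    have e' : T ⟨R' g, h⟩ = g + k • R' g := by
      rw [opShift_apply] at e
      exact eq_add_of_sub_eq e
    have := hR' ⟨R' g, h⟩
    rw [e', map_add, map_smul] at this
    exact this.symm
  have e2 : ∀ g, R' g = R g + k • R' (R g) := by
    intro g
    obtain ⟨h, e⟩ := hR g
    have := h2 ⟨R g, h⟩
    have e' : opShift T k ⟨R g, h⟩ = g - k • R g := by
      rw [opShift_apply, e]
    rw [e', map_sub, map_smul] at this
    exact eq_add_of_sub_eq this
  have hxc : (x : ℂ) * k = 1 := by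
    rw [hk, ← Complex.ofReal_mul, mul_inv_cancel₀ hx0.ne, Complex.ofReal_one]
  have u : IsUnit (1 - k • R) := by
    refine ⟨⟨1 - k • R, 1 + k • R', ?_, ?_⟩, rfl⟩
    · ext g
      simp only [mul_apply_eq_comp, sub_apply,
        add_apply, one_apply_eq_self,
        smul_apply, map_add, map_smul]
      nth_rw 1 [e1 g]
      module
    · ext g
      simp only [mul_apply_eq_comp, sub_apply,
        add_apply, one_apply_eq_self,
        smul_apply, map_sub, map_smul]
      nth_rw 1 [e2 g]
      module
  have e : algebraMap ℝ (E →L[ℂ] E) x - R = (x : ℂ) • (1 - k • R) := by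
    rw [smul_sub, smul_smul, hxc, one_smul]
    congr 1
  rw [spectrum.mem_resolventSet_iff, e]
  have hx1 : (x : ℂ) ≠ 0 := by exact_mod_cast hx0.ne
  exact u.smul (Units.mk0 (x : ℂ) hx1)

/-- A positive operator satisfies `‖R g‖² ≤ C ⟪g, R g⟫`, since it is of the form `b* b`. -/
lemma ContinuousLinearMap.IsPositive.exists_norm_sq_le {R : E →L[ℂ] E} (hR : R.IsPositive) :
    ∃ C > 0, ∀ g, ‖R g‖ ^ 2 ≤ C * RCLike.re (inner ℂ g (R g)) := by
  obtain ⟨b, rfl⟩ := CStarAlgebra.nonneg_iff_eq_star_mul_self.1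
    ((ContinuousLinearMap.nonneg_iff_isPositive R).2 hR)
  refine ⟨‖star b‖ ^ 2 + 1, by positivity, fun g => ?_⟩
  have h1 : RCLike.re (inner ℂ g ((star b * b) g)) = ‖b g‖ ^ 2 := by
    rw [mul_apply_eq_comp, ContinuousLinearMap.star_eq_adjoint,
      ContinuousLinearMap.adjoint_inner_right, inner_self_eq_norm_sq]
  rw [h1, mul_apply_eq_comp]
  have h2 := (star b).le_opNorm (b g)
  have h3 : ‖(star b) (b g)‖ ^ 2 ≤ (‖star b‖ * ‖b g‖) ^ 2 := by gcongr
  nlinarith [sq_nonneg ‖b g‖]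

end Abstract

namespace SLCoeff

variable {S : SLCoeff}

/-! ### The operator `A` and its inverse -/

lemma inner_toLp {f g : ℝ → ℂ} {ν : Measure ℝ} (hf : MemLp f 2 ν) (hg : MemLp g 2 ν) :
    inner ℂ (hf.toLp f) (hg.toLp g) = ∫ x, conj (f x) * g x ∂ν := by
  rw [L2.inner_def]
  refine integral_congr_ae ?_
  filter_upwards [hf.coeFn_toLp, hg.coeFn_toLp] with x h1 h2
  rw [h1, h2, RCLike.inner_apply, mul_comm]

lemma integrable_conj_mul {f g : ℝ → ℂ} {ν : Measure ℝ} (hf : MemLp f 2 ν) (hg : MemLp g 2 ν) :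
    Integrable (fun x => conj (f x) * g x) ν := by
  have := L2.integrable_inner (𝕜 := ℂ) (hf.toLp f) (hg.toLp g)
  refine this.congr ?_
  filter_upwards [hf.coeFn_toLp, hg.coeFn_toLp] with x h1 h2
  rw [h1, h2, RCLike.inner_apply, mul_comm]

lemma InD.mem_graphA {u v g : ℝ → ℂ} (h : S.InD u v g) :
    (h.2.1.toLp u, h.2.2.toLp g) ∈ S.A.graph := by
  rw [A_graph]
  exact ⟨u, v, g, h, h.2.1.coeFn_toLp, h.2.2.coeFn_toLp⟩

lemma InD.exists_domain {u v g : ℝ → ℂ} (h : S.InD u v g) :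
    ∃ x : S.A.domain, (x : S.H) = h.2.1.toLp u ∧ S.A x = h.2.2.toLp g := by
  obtain ⟨x, h1, h2⟩ := (LinearPMap.mem_graph_iff _).1 h.mem_graphA
  exact ⟨x, h1, h2⟩

lemma exists_inD_of_domain (x : S.A.domain) :
    ∃ u v g, S.InD u v g ∧ (x : S.H) =ᵐ[S.μ] u ∧ S.A x =ᵐ[S.μ] g := by
  have := S.A.mem_graph x
  rw [A_graph] at this
  exact this

lemma LeftDefinite.isFormalAdjoint (hS : S.LeftDefinite) : S.A.IsFormalAdjoint S.A := by
  have h1 := LinearPMap.adjoint_isFormalAdjoint hS.1.dense_domain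
  rwa [LinearPMap.isSelfAdjoint_def.1 hS.1] at h1

lemma LeftDefinite.symm (hS : S.LeftDefinite) {u v g u' v' g' : ℝ → ℂ} (h : S.InD u v g)
    (h' : S.InD u' v' g') :
    ∫ x, conj (g x) * u' x ∂S.μ = ∫ x, conj (u x) * g' x ∂S.μ := by
  obtain ⟨x, ex, eAx⟩ := h.exists_domain
  obtain ⟨y, ey, eAy⟩ := h'.exists_domain
  have := hS.isFormalAdjoint x y
  rwa [ex, ey, eAx, eAy, inner_toLp, inner_toLp] at this

/-- The inverse `R` of `A`: it is bounded, positive, and `R g` is a solution of `ℓ u = g`. -/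
lemma LeftDefinite.exists_inverse (hS : S.LeftDefinite) : ∃ R : S.H →L[ℂ] S.H,
    R.IsPositive ∧ (∀ f : S.H, ∃ u v g, S.InD u v g ∧ R f =ᵐ[S.μ] u ∧ f =ᵐ[S.μ] g) ∧
    ∀ {u v g : ℝ → ℂ} (h : S.InD u v g), R (h.2.2.toLp g) = h.2.1.toLp u := by
  obtain ⟨m, hm, hm0⟩ := hS.2
  have hres : ∀ x : ℝ, x < m → (x : ℂ) ∈ opResolventSet S.A := by
    intro x hx
    by_contra h
    exact absurd (hm.2 (show x ∈ {x : ℝ | (x : ℂ) ∈ opSpectrum S.A} from h)) (not_le.2 hx)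
  obtain ⟨R, h1, h2⟩ := hres 0 hm0
  have h1' : ∀ g, ∃ h : R g ∈ S.A.domain, S.A ⟨R g, h⟩ = g := by
    intro g
    obtain ⟨h, e⟩ := h1 g
    refine ⟨h, ?_⟩
    simpa [opShift] using e
  have h2' : ∀ f : S.A.domain, R (S.A f) = f := by
    intro f
    simpa [opShift] using h2 f
  refine ⟨R, isPositive_inverse hS.isFormalAdjoint h1' h2'
    (fun x hx => hres x (hx.trans hm0)), ?_, ?_⟩
  · intro f
    obtain ⟨h, e⟩ := h1' f
    have := exists_inD_of_domain ⟨R f, h⟩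
    rwa [e] at this
  · intro u v g h
    obtain ⟨x, ex, eAx⟩ := h.exists_domain
    rw [← ex, ← eAx, h2']

/-- `A` is bounded below by a positive constant. -/
lemma LeftDefinite.exists_lower_bound (hS : S.LeftDefinite) :
    ∃ δ > 0, ∀ {u v g : ℝ → ℂ}, S.InD u v g →
      δ * ∫ x, ‖u x‖ ^ 2 ∂S.μ ≤ (∫ x, conj (g x) * u x ∂S.μ).re := by
  obtain ⟨R, hR, -, hR'⟩ := hS.exists_inverse
  obtain ⟨C, hC, hb⟩ := hR.exists_norm_sq_le
  refine ⟨C⁻¹, by positivity, fun {u v g} h => ?_⟩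
  have h1 := hb (h.2.2.toLp g)
  rw [hR' h, inner_toLp] at h1
  have h2 : ‖h.2.1.toLp u‖ ^ 2 = ∫ x, ‖u x‖ ^ 2 ∂S.μ := by
    have : ((‖h.2.1.toLp u‖ ^ 2 : ℝ) : ℂ) = ((∫ x, ‖u x‖ ^ 2 ∂S.μ : ℝ) : ℂ) := by
      rw [← integral_complex_ofReal, Complex.ofReal_pow]
      have := inner_self_eq_norm_sq_to_K (𝕜 := ℂ) (h.2.1.toLp u)
      rw [inner_toLp] at this
      refine this.symm.trans ?_
      congr 1; ext x
      rw [Complex.conj_mul']; simp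
    exact_mod_cast this
  rw [h2] at h1
  rw [inv_mul_le_iff₀ hC]
  exact h1

/-! ### Green's identity on a half-line -/

/-- The Lagrange identity on a half-line, one of the functions having bounded support. -/
lemma IsEll.integral_lagrange {s : Set ℝ} {ε : ℂ} (hs : S.IsHalfLine s ε)
    {u v g u' v' g' : ℝ → ℂ} (hD : S.InD u v g) (hD' : S.InD u' v' g') {h : ℝ} (hh : 0 < h)
    (h0 : ∀ t ∉ Icc (S.c - h) (S.c + h), u t = 0 ∧ v t = 0 ∧ g t = 0) :
    ∫ x in s, (conj (g x) * u' x - conj (u x) * g' x) ∂S.μ =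
      ε * (conj (v S.c) * u' S.c - conj (u S.c) * v' S.c) := by
  rw [setIntegral_mu _ hs.measurableSet]
  set W : ℝ → ℂ := fun x => conj (u x) * v' x - conj (v x) * u' x
  set k : ℝ → ℂ := fun x => S.wt x * (conj (g x) * u' x - conj (u x) * g' x)
  have acW : LocAC W := (hD.1.1.conj.mul hD'.1.2.1).fun_sub (hD.1.2.1.conj.mul hD'.1.1)
  have hk : LocallyIntegrable k := by
    have : Integrable (fun x => conj (g x) * u' x - conj (u x) * g' x) S.μ :=
      (integrable_conj_mul hD.2.2 hD'.2.1).sub (integrable_conj_mul hD.2.1 hD'.2.2)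
    exact (integrable_mu_iff.1 this).locallyIntegrable
  have hder : ∀ᵐ x, HasDerivAt W (k x) x := by
    filter_upwards [hD.1.2.2.1, hD.1.2.2.2, hD'.1.2.2.1, hD'.1.2.2.2] with x h1 h2 h3 h4
    have c1 := h1.star
    have c2 := h2.star
    refine ((c1.mul h4).sub (c2.mul h3)).congr_deriv ?_
    simp only [k, wt, star_sub, star_mul', star_div₀, Complex.star_def, Complex.conj_ofReal]
    ring
  have ftc := acW.integral_eq_sub hk hder
  have hk0 : ∀ x ∉ Icc (S.c - h) (S.c + h), k x = 0 := fun x hx => by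
    simp [k, (h0 x hx).1, (h0 x hx).2.2]
  have hW0 : ∀ x ∉ Icc (S.c - h) (S.c + h), W x = 0 := fun x hx => by
    simp [W, (h0 x hx).1, (h0 x hx).2.1]
  change ∫ x in s, k x = _
  rcases hs with ⟨rfl, rfl⟩ | ⟨rfl, rfl⟩
  · have e : ∫ x in Ioi S.c, k x = ∫ x in Ioc S.c (S.c + h + 1), k x := by
      refine setIntegral_eq_of_subset_of_forall_sdiff_eq_zero measurableSet_Ioi
        (fun x hx => hx.1) fun x hx => hk0 x fun hxI => hx.2 ⟨hx.1, by linarith [hxI.2]⟩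
    rw [e, ← intervalIntegral.integral_of_le (by linarith), ftc,
      hW0 _ (fun hx => by linarith [hx.2])]
    simp only [W]; ring
  · have e : ∫ x in Iio S.c, k x = ∫ x in Ioc (S.c - h - 1) S.c, k x := by
      rw [integral_Ioc_eq_integral_Ioo]
      refine setIntegral_eq_of_subset_of_forall_sdiff_eq_zero measurableSet_Iio
        (fun x hx => hx.2) fun x hx => hk0 x fun hxI => hx.2 ⟨by linarith [hxI.1], hx.1⟩
    rw [e, ← intervalIntegral.integral_of_le (by linarith), ftc,
      hW0 (S.c - h - 1) (fun hx => by linarith [hx.1])]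
    simp only [W]; ring

lemma InD.sub {u v g u' v' g' : ℝ → ℂ} (h : S.InD u v g) (h' : S.InD u' v' g') :
    S.InD (u - u') (v - v') (g - g') := by
  have := h.add (h'.const_smul (-1))
  simpa [sub_eq_add_neg] using this

lemma setIntegral_conj_mul_indicator {s : Set ℝ} {ν : Measure ℝ} (hs : MeasurableSet s)
    (f g : ℝ → ℂ) :
    ∫ x, conj (s.indicator f x) * g x ∂ν = ∫ x in s, conj (f x) * g x ∂ν := by
  rw [← integral_indicator hs]
  congr 1; ext x
  by_cases hx : x ∈ s <;> simp [hx]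

/-- Green's identity on a half-line: there is no boundary term at infinity. -/
lemma LeftDefinite.green (hS : S.LeftDefinite) {s : Set ℝ} {ε : ℂ} (hs : S.IsHalfLine s ε)
    {u v g u' v' g' : ℝ → ℂ} (h : S.InD u v g) (h' : S.InD u' v' g') :
    (∫ x in s, conj (g x) * u' x ∂S.μ) - ∫ x in s, conj (u x) * g' x ∂S.μ =
      ε * (conj (v S.c) * u' S.c - conj (u S.c) * v' S.c) := by
  -- subtract from `u` a function of bounded support with the same Cauchy data, and cut off
  obtain ⟨φ, ψ, k, hφ, e1, e2, d, hd, h0⟩ := exists_inD_cauchyData (S := S) (u S.c) (v S.c)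
  have hl := IsEll.integral_lagrange hs hφ h' hd h0
  rw [e1, e2] at hl
  rw [← hl]
  have hc := (h.sub hφ).indicator hs (by simp [e1]) (by simp [e2])
  have hsym := hS.symm hc h'
  rw [setIntegral_conj_mul_indicator hs.measurableSet,
    setIntegral_conj_mul_indicator hs.measurableSet] at hsym
  have i1 := (integrable_conj_mul h.2.2 h'.2.1).integrableOn (s := s)
  have i2 := (integrable_conj_mul hφ.2.2 h'.2.1).integrableOn (s := s)
  have i3 := (integrable_conj_mul h.2.1 h'.2.2).integrableOn (s := s)
  have i4 := (integrable_conj_mul hφ.2.1 h'.2.2).integrableOn (s := s)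
  simp only [Pi.sub_apply, map_sub, sub_mul] at hsym
  rw [integral_sub i1 i2, integral_sub i3 i4] at hsym
  rw [integral_sub i2 i4]
  linear_combination hsym

/-! ### Positivity of the Dirichlet eigenvalues -/

lemma integral_eq_add_halfLines {s s' : Set ℝ} {ε' : ℂ}
    (hs' : S.IsHalfLine s' ε') (hd : Disjoint s s') (hmem : ∀ x ≠ S.c, x ∉ s → x ∈ s')
    {E : Type*} [NormedAddCommGroup E] [NormedSpace ℝ E] {f : ℝ → E} (hf : Integrable f S.μ) :
    ∫ x, f x ∂S.μ = (∫ x in s, f x ∂S.μ) + ∫ x in s', f x ∂S.μ := by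
  rw [← setIntegral_union hd hs'.measurableSet hf.integrableOn hf.integrableOn,
    ← setIntegral_univ]
  refine setIntegral_congr_set ?_
  have : ∀ᵐ x ∂S.μ, x ≠ S.c := ae_mu_iff.2 ae_ne_c
  filter_upwards [this] with x hx
  refine propext ⟨fun _ => ?_, fun _ => trivial⟩
  by_cases h : x ∈ s
  · exact Or.inl h
  · exact Or.inr (hmem x hx h)

lemma setIntegral_norm_sq_eq {ν : Measure ℝ} {s : Set ℝ} (f : ℝ → ℂ) :
    ∫ x in s, conj (f x) * f x ∂ν = ((∫ x in s, ‖f x‖ ^ 2 ∂ν : ℝ) : ℂ) := by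
  rw [← integral_complex_ofReal]
  congr 1; ext x
  rw [Complex.conj_mul']; simp

lemma eq_zero_on_of_integral_norm_sq {s : Set ℝ} (hs : IsOpen s) {u : ℝ → ℂ} (hc : Continuous u)
    (hu : MemLp u 2 S.μ) (h : ∫ x in s, ‖u x‖ ^ 2 ∂S.μ = 0) : ∀ x ∈ s, u x = 0 := by
  have hi : IntegrableOn (fun x => ‖u x‖ ^ 2) s S.μ :=
    ((memLp_two_iff_integrable_sq_norm hu.1).1 hu).integrableOn
  rw [integral_eq_zero_iff_of_nonneg (fun x => by positivity) hi] at h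
  have h' := (ae_mu_restrict_iff (S := S) hs.measurableSet).1 h
  refine eq_zero_of_ae hs hc ?_
  filter_upwards [h'] with x hx hxs
  simpa using hx hxs

lemma IsEll.cauchyData_eq_zero {s : Set ℝ} {ε : ℂ} (hs : S.IsHalfLine s ε) {u v g : ℝ → ℂ}
    (h : S.IsEll u v g) (h0 : ∀ x ∈ s, u x = 0) : u S.c = 0 ∧ v S.c = 0 := by
  refine ⟨closure_minimal h0 (isClosed_eq h.1.continuous continuous_const) hs.mem_closure, ?_⟩
  have hv : ∀ᵐ x, x ∈ s → v x = 0 := by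
    filter_upwards [h.2.2.1, S.p_pos] with x hx hp hxs
    have d0 : HasDerivAt u 0 x := (hasDerivAt_const x (0 : ℂ)).congr_of_eventuallyEq
      (by filter_upwards [hs.isOpen.mem_nhds hxs] with y hy using h0 y hy)
    have hp' : (S.p x : ℂ) ≠ 0 := by exact_mod_cast hp.ne'
    simpa [hp'] using hx.unique d0
  exact closure_minimal (eq_zero_of_ae hs.isOpen h.2.1.continuous hv)
    (isClosed_eq h.2.1.continuous continuous_const) hs.mem_closure

lemma integral_sesquilinear_expand {ν : Measure ℝ} {f₁ f₂ f₃ f₄ : ℝ → ℂ} (h₁ : Integrable f₁ ν)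
    (h₂ : Integrable f₂ ν) (h₃ : Integrable f₃ ν) (h₄ : Integrable f₄ ν) (a b c : ℂ) :
    ∫ x, (f₁ x + a * f₂ x + b * f₃ x + c * f₄ x) ∂ν =
      (∫ x, f₁ x ∂ν) + a * (∫ x, f₂ x ∂ν) + b * (∫ x, f₃ x ∂ν) + c * ∫ x, f₄ x ∂ν := by
  have i₂ := h₂.const_mul a
  have i₃ := h₃.const_mul b
  have i₄ := h₄.const_mul c
  have i₁₂ : Integrable (fun x => f₁ x + a * f₂ x) ν := h₁.add i₂
  have i₁₂₃ : Integrable (fun x => f₁ x + a * f₂ x + b * f₃ x) ν := i₁₂.add i₃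
  rw [integral_add i₁₂₃ i₄, integral_add i₁₂ i₃, integral_add h₁ i₂,
    integral_const_mul, integral_const_mul, integral_const_mul]

/-- The eigenvalues of the Dirichlet operators are positive: extended by `0`, an eigenfunction is
a limit, in the energy norm, of elements of the domain of `A`, by `exists_inD_small_energy`. -/
lemma LeftDefinite.eigenvalue_pos (hS : S.LeftDefinite) {s : Set ℝ} {ε : ℂ}
    (hs : S.IsHalfLine s ε) {u v g : ℝ → ℂ} {z : ℂ} (h : S.InD u v g)
    (hg : ∀ᵐ x, x ∈ s → g x = z * u x) (hc : u S.c = 0) (hne : ∃ x ∈ s, u x ≠ 0) :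
    ∃ t : ℝ, 0 < t ∧ z = t := by
  have hv : v S.c ≠ 0 := by
    intro hv
    obtain ⟨x, hx, hux⟩ := hne
    exact hux (h.eq_zero_on hs hg hc hv x hx)
  -- normalize the eigenfunction to have slope `1` at `c`
  have he := h.const_smul (v S.c)⁻¹
  set e : ℝ → ℂ := (v S.c)⁻¹ • u with he_def
  have hge : ∀ᵐ x, x ∈ s → ((v S.c)⁻¹ • g) x = z * e x := by
    filter_upwards [hg] with x hx hxs
    simp only [he_def, Pi.smul_apply, smul_eq_mul, hx hxs]
    ring
  have hec : e S.c = 0 := by simp [he_def, hc]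
  have hvc : ((v S.c)⁻¹ • v) S.c = 1 := by simp [hv]
  have hene : ∃ x ∈ s, e x ≠ 0 := by
    obtain ⟨x, hx, hux⟩ := hne
    exact ⟨x, hx, by simp [he_def, hv, hux]⟩
  generalize (v S.c)⁻¹ • v = ve at he hvc
  generalize (v S.c)⁻¹ • g = ge at he hge
  clear_value e
  clear hg hv hc hne h
  set N : ℝ := ∫ x in s, ‖e x‖ ^ 2 ∂S.μ with hN
  have hN0 : 0 < N := by
    refine lt_of_le_of_ne (integral_nonneg fun x => by positivity) fun hN0 => ?_
    obtain ⟨x, hx, hex⟩ := hene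
    exact hex (eq_zero_on_of_integral_norm_sq hs.isOpen he.1.1.continuous he.2.1 hN0.symm x hx)
  have hge' : ∀ᵐ x ∂S.μ.restrict s, ge x = z * e x :=
    (ae_mu_restrict_iff hs.measurableSet).2 hge
  -- the eigenvalue is real
  have hzr : conj z = z := by
    have hgr := hS.green hs he he
    rw [hec] at hgr
    have e1 : ∫ x in s, conj (ge x) * e x ∂S.μ = conj z * N := by
      rw [hN, ← setIntegral_norm_sq_eq, ← integral_const_mul]
      refine integral_congr_ae ?_
      filter_upwards [hge'] with x hx
      rw [hx, map_mul]; ring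
    have e2 : ∫ x in s, conj (e x) * ge x ∂S.μ = z * N := by
      rw [hN, ← setIntegral_norm_sq_eq, ← integral_const_mul]
      refine integral_congr_ae ?_
      filter_upwards [hge'] with x hx
      rw [hx]; ring
    rw [e1, e2, ← sub_mul] at hgr
    have hN' : (N : ℂ) ≠ 0 := by exact_mod_cast hN0.ne'
    have : conj z - z = 0 := by simpa [hN'] using hgr
    exact sub_eq_zero.1 this
  obtain ⟨δ, hδ, hlow⟩ := hS.exists_lower_bound
  obtain ⟨s', hs', hd, hmem⟩ := exists_other_halfLine hs
  obtain ⟨ρ, σ, k, hρ, hρc, hσc, -⟩ := exists_inD_cauchyData (S := S) 1 0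
  have i11 := (integrable_conj_mul he.2.1 he.2.1).integrableOn (s := s)
  have i12 := (integrable_conj_mul he.2.1 hρ.2.1).integrableOn (s := s)
  have i21 := (integrable_conj_mul hρ.2.1 he.2.1).integrableOn (s := s)
  have i22 := (integrable_conj_mul hρ.2.1 hρ.2.1).integrableOn (s := s)
  have j11 := (integrable_conj_mul he.2.2 he.2.1).integrableOn (s := s)
  have j12 := (integrable_conj_mul he.2.2 hρ.2.1).integrableOn (s := s)
  have j21 := (integrable_conj_mul hρ.2.2 he.2.1).integrableOn (s := s)
  have j22 := (integrable_conj_mul hρ.2.2 hρ.2.1).integrableOn (s := s)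
  let X : ℂ → ℂ := fun a => (∫ x in s, conj (e x) * e x ∂S.μ) +
    a * (∫ x in s, conj (e x) * ρ x ∂S.μ) + conj a * (∫ x in s, conj (ρ x) * e x ∂S.μ) +
    conj a * a * ∫ x in s, conj (ρ x) * ρ x ∂S.μ
  let Y : ℂ → ℂ := fun a => (∫ x in s, conj (ge x) * e x ∂S.μ) +
    a * (∫ x in s, conj (ge x) * ρ x ∂S.μ) + conj a * (∫ x in s, conj (k x) * e x ∂S.μ) +
    conj a * a * ∫ x in s, conj (k x) * ρ x ∂S.μ
  have key : ∀ η : ℝ, 0 < η → ∃ a : ℂ, ‖a‖ ≤ η ∧ δ * (X a).re ≤ (Y a).re + η := by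
    intro η hη
    obtain ⟨φ, ψ, κ, hφ, hψc, hφc, hen⟩ := exists_inD_small_energy hs' hη
    set a := φ S.c
    refine ⟨a, hφc, ?_⟩
    have hb := he.add (hρ.const_smul a)
    have hf := hb.add ((hφ.sub hb).indicator hs' (by simp [hec, hρc, a]) (by simp [hvc, hσc, hψc]))
    have hlo := hlow hf
    set f := e + a • ρ + s'.indicator (φ - (e + a • ρ))
    set gf := ge + a • k + s'.indicator (κ - (ge + a • k))
    have fs : ∀ x ∈ s, f x = e x + a * ρ x := fun x hx => by
      simp [f, indicator_of_notMem (disjoint_left.1 hd hx)]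
    have gs : ∀ x ∈ s, gf x = ge x + a * k x := fun x hx => by
      simp [gf, indicator_of_notMem (disjoint_left.1 hd hx)]
    have fs' : ∀ x ∈ s', f x = φ x := fun x hx => by simp [f, hx]
    have gs' : ∀ x ∈ s', gf x = κ x := fun x hx => by simp [gf, hx]
    have hfi : Integrable (fun x => ‖f x‖ ^ 2) S.μ :=
      (memLp_two_iff_integrable_sq_norm hf.2.1.1).1 hf.2.1
    have h1 : ∫ x in s, ‖f x‖ ^ 2 ∂S.μ ≤ ∫ x, ‖f x‖ ^ 2 ∂S.μ :=
      setIntegral_le_integral hfi (Eventually.of_forall fun x => by positivity)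
    have h2 : ((∫ x in s, ‖f x‖ ^ 2 ∂S.μ : ℝ) : ℂ) = X a := by
      rw [← setIntegral_norm_sq_eq]
      simp only [X]
      rw [← integral_sesquilinear_expand i11 i12 i21 i22]
      refine setIntegral_congr_fun hs.measurableSet fun x hx => ?_
      simp only [fs x hx, map_add, map_mul]
      ring
    have h3 : ∫ x in s, conj (gf x) * f x ∂S.μ = Y a := by
      simp only [Y]
      rw [← integral_sesquilinear_expand j11 j12 j21 j22]
      refine setIntegral_congr_fun hs.measurableSet fun x hx => ?_
      simp only [fs x hx, gs x hx, map_add, map_mul]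
      ring
    have h4 : ∫ x in s', conj (gf x) * f x ∂S.μ = ∫ x in s', conj (κ x) * φ x ∂S.μ := by
      refine setIntegral_congr_fun hs'.measurableSet fun x hx => ?_
      simp only [fs' x hx, gs' x hx]
    rw [integral_eq_add_halfLines hs' hd hmem (integrable_conj_mul hf.2.2 hf.2.1), h3, h4,
      Complex.add_re] at hlo
    have h5 := (Complex.re_le_norm _).trans hen
    have h6 : (X a).re = ∫ x in s, ‖f x‖ ^ 2 ∂S.μ := by rw [← h2, Complex.ofReal_re]
    rw [h6]
    have h7 := mul_le_mul_of_nonneg_left h1 hδ.le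
    linarith
  choose a ha hXY using fun n : ℕ => key (1 / ((n : ℝ) + 1)) (by positivity)
  have hη := tendsto_one_div_add_atTop_nhds_zero_nat (𝕜 := ℝ)
  have ha0 : Tendsto a atTop (𝓝 0) := squeeze_zero_norm ha hη
  have cX : Continuous X := by
    have := Complex.continuous_conj
    simp only [X]; fun_prop
  have cY : Continuous Y := by
    have := Complex.continuous_conj
    simp only [Y]; fun_prop
  have tX := (Complex.continuous_re.comp cX).continuousAt.tendsto.comp ha0
  have tY := (Complex.continuous_re.comp cY).continuousAt.tendsto.comp ha0
  have hlim := le_of_tendsto_of_tendsto' (tX.const_mul δ) (tY.add hη) hXY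
  have hX0 : X 0 = N := by simp only [X]; rw [setIntegral_norm_sq_eq]; simp [hN]
  have hY0 : Y 0 = conj z * N := by
    simp only [Y, map_zero, zero_mul, add_zero]
    rw [hN, ← setIntegral_norm_sq_eq, ← integral_const_mul]
    refine integral_congr_ae ?_
    filter_upwards [hge'] with x hx
    rw [hx, map_mul]; ring
  simp only [Function.comp_apply, hX0, hY0, hzr, add_zero, Complex.ofReal_re] at hlim
  refine ⟨z.re, ?_, (Complex.conj_eq_iff_re.1 hzr).symm⟩
  rw [Complex.re_mul_ofReal] at hlim
  exact hδ.trans_le (le_of_mul_le_mul_right hlim hN0)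

/-! ### The Weyl solution at `0` and the inverse of a Dirichlet operator -/

/-- A Dirichlet solution of `ℓ u = 0` on a half-line vanishes there. -/
lemma LeftDefinite.eq_zero_on_of_ell_eq_zero (hS : S.LeftDefinite) {s : Set ℝ} {ε : ℂ}
    (hs : S.IsHalfLine s ε) {u v g : ℝ → ℂ} (h : S.InD u v g) (hg : ∀ᵐ x, x ∈ s → g x = 0)
    (hc : u S.c = 0) : ∀ x ∈ s, u x = 0 := by
  by_contra! hne
  obtain ⟨t, ht, h0⟩ := hS.eigenvalue_pos hs (z := 0) h (by simpa using hg) hc hne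
  exact ht.ne (by exact_mod_cast h0)

/-- On each half-line there is a solution of `ℓ u = 0` from the domain with `u(c) = 1`. Otherwise
the inverse of `A` would be decoupled at `c`, and all elements of the domain would vanish at `c`. -/
lemma LeftDefinite.exists_weylSolution_zero (hS : S.LeftDefinite) {s : Set ℝ} {ε : ℂ}
    (hs : S.IsHalfLine s ε) :
    ∃ u v g, S.InD u v g ∧ (∀ᵐ x, x ∈ s → g x = 0) ∧ u S.c = 1 := by
  by_contra! hcon
  have hall : ∀ u v g, S.InD u v g → (∀ᵐ x, x ∈ s → g x = 0) → ∀ x ∈ s, u x = 0 := by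
    intro u v g h hg
    refine hS.eq_zero_on_of_ell_eq_zero hs h hg ?_
    by_contra hne
    refine hcon _ _ _ (h.const_smul (u S.c)⁻¹) ?_ (by simp [hne])
    filter_upwards [hg] with x hx hxs
    simp [hx hxs]
  obtain ⟨s', hs', hd, hmem⟩ := exists_other_halfLine hs
  obtain ⟨R, hR, hsol, hinv⟩ := hS.exists_inverse
  obtain ⟨u, v, g, h, huc, -, -⟩ := exists_inD_cauchyData (S := S) 1 0
  have m1 : MemLp (s.indicator g) 2 S.μ := h.2.2.indicator hs.measurableSet
  have m2 : MemLp (s'.indicator g) 2 S.μ := h.2.2.indicator hs'.measurableSet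
  obtain ⟨u1, v1, g1, h1, e1, f1⟩ := hsol (m1.toLp _)
  obtain ⟨u2, v2, g2, h2, e2, f2⟩ := hsol (m2.toLp _)
  have hg1 : ∀ᵐ x, g1 x = s.indicator g x :=
    ae_mu_iff.1 (f1.symm.trans m1.coeFn_toLp)
  have hg2 : ∀ᵐ x, g2 x = s'.indicator g x :=
    ae_mu_iff.1 (f2.symm.trans m2.coeFn_toLp)
  have z2 : ∀ x ∈ s, u2 x = 0 := hall u2 v2 g2 h2 (by
    filter_upwards [hg2] with x hx hxs
    rw [hx, indicator_of_notMem (disjoint_left.1 hd hxs)])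
  have z1 : ∀ x ∈ s', u1 x = 0 := by
    have m3 : MemLp (s'.indicator u1) 2 S.μ := h1.2.1.indicator hs'.measurableSet
    obtain ⟨w, y, k, hw, ew, fw⟩ := hsol (m3.toLp _)
    have hk : ∀ᵐ x, k x = s'.indicator u1 x := ae_mu_iff.1 (fw.symm.trans m3.coeFn_toLp)
    have zw : ∀ x ∈ s, w x = 0 := hall w y k hw (by
      filter_upwards [hk] with x hx hxs
      rw [hx, indicator_of_notMem (disjoint_left.1 hd hxs)])
    have hsym := hS.symm h1 hw
    have e3 : ∫ x, conj (g1 x) * w x ∂S.μ = 0 := by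
      refine integral_eq_zero_of_ae ?_
      filter_upwards [ae_mu_iff.2 hg1] with x hx
      by_cases hxs : x ∈ s
      · simp [zw x hxs]
      · simp [hx, hxs]
    have e4 : ∫ x, conj (u1 x) * k x ∂S.μ = ∫ x in s', conj (u1 x) * u1 x ∂S.μ := by
      rw [← integral_indicator hs'.measurableSet]
      refine integral_congr_ae ?_
      filter_upwards [ae_mu_iff.2 hk] with x hx
      rw [hx]
      by_cases hxs : x ∈ s' <;> simp [hxs]
    rw [e3, e4, setIntegral_norm_sq_eq] at hsym
    refine eq_zero_on_of_integral_norm_sq hs'.isOpen h1.1.1.continuous h1.2.1 ?_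
    exact_mod_cast hsym.symm
  have hc1 := (h1.1.cauchyData_eq_zero hs' z1).1
  have hc2 := (h2.1.cauchyData_eq_zero hs z2).1
  have hsum : ∀ᵐ x, u x - (u1 x + u2 x) = 0 := by
    rw [← ae_mu_iff (S := S)]
    have e5 : h.2.2.toLp g = m1.toLp _ + m2.toLp _ := by
      rw [← MemLp.toLp_add]
      refine MemLp.toLp_congr _ _ (ae_mu_iff.2 ?_)
      filter_upwards [ae_ne_c (S := S)] with x hx
      by_cases hxs : x ∈ s
      · simp [hxs, disjoint_left.1 hd hxs]
      · simp [hxs, hmem x hx hxs]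
    have e6 := hinv h
    rw [e5, map_add] at e6
    filter_upwards [e1, e2, h.2.1.coeFn_toLp, Lp.coeFn_add (R (m1.toLp _)) (R (m2.toLp _))]
      with x k1 k2 k3 k4
    rw [e6, k3, Pi.add_apply, k1, k2] at k4
    rw [k4, sub_self]
  have hcont : Continuous fun x => u x - (u1 x + u2 x) :=
    h.1.1.continuous.sub (h1.1.1.continuous.add h2.1.1.continuous)
  have := eq_zero_of_ae isOpen_univ hcont (by filter_upwards [hsum] with x hx _ using hx) S.c
    (mem_univ _)
  rw [huc, hc1, hc2] at this
  simp at this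

lemma mem_dirichlet_graph {s : Set ℝ} {ε : ℂ} (hs : S.IsHalfLine s ε) {x g : S.HOn s} :
    (x, g) ∈ (S.dirichlet s).graph ↔ ∃ u v k : ℝ → ℂ, S.InD u v k ∧ u S.c = 0 ∧
      x =ᵐ[S.μ.restrict s] u ∧ g =ᵐ[S.μ.restrict s] k := by
  rw [S.dirichlet_graph hs.isOpen]
  rfl

lemma inner_HOn {s : Set ℝ} {x y : S.HOn s} {u w : ℝ → ℂ} (hx : x =ᵐ[S.μ.restrict s] u)
    (hy : y =ᵐ[S.μ.restrict s] w) : inner ℂ x y = ∫ t in s, conj (u t) * w t ∂S.μ := by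
  rw [L2.inner_def]
  refine integral_congr_ae ?_
  filter_upwards [hx, hy] with t h1 h2
  rw [h1, h2, RCLike.inner_apply, mul_comm]

/-- The Dirichlet operator on a half-line has a bounded selfadjoint inverse. -/
lemma LeftDefinite.exists_dirichlet_inverse (hS : S.LeftDefinite) {s : Set ℝ} {ε : ℂ}
    (hs : S.IsHalfLine s ε) : ∃ T : S.HOn s →L[ℂ] S.HOn s, IsSelfAdjoint T ∧
      ∀ x g, (x, g) ∈ (S.dirichlet s).graph ↔ x = T g := by
  obtain ⟨u₀, v₀, g₀, h₀, hg₀, hc₀⟩ := hS.exists_weylSolution_zero hs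
  obtain ⟨R, -, hsol, -⟩ := hS.exists_inverse
  have hex : ∀ g : S.HOn s, ∃ x, (x, g) ∈ (S.dirichlet s).graph := by
    intro g
    have m : MemLp (s.indicator g) 2 S.μ :=
      (memLp_indicator_iff_restrict hs.measurableSet).2 (Lp.memLp g)
    obtain ⟨u, v, k, h, -, hk⟩ := hsol (m.toLp _)
    have hD := h.sub (h₀.const_smul (u S.c))
    refine ⟨(hD.2.1.restrict s).toLp _, (mem_dirichlet_graph hs).2
      ⟨_, _, _, hD, by simp [hc₀], (hD.2.1.restrict s).coeFn_toLp, ?_⟩⟩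
    have hk' := ae_restrict_of_ae (s := s) (hk.symm.trans m.coeFn_toLp)
    filter_upwards [hk', (ae_mu_restrict_iff hs.measurableSet).2 hg₀,
      ae_restrict_mem hs.measurableSet] with x h1 h2 hx
    simp [h1, h2, hx]
  have huniq : ∀ {x : S.HOn s}, (x, 0) ∈ (S.dirichlet s).graph → x = 0 := by
    intro x hx
    obtain ⟨u, v, k, h, hc, e1, e2⟩ := (mem_dirichlet_graph hs).1 hx
    have hk : ∀ᵐ t, t ∈ s → k t = 0 := by
      rw [← ae_mu_restrict_iff (S := S) hs.measurableSet]
      filter_upwards [e2, Lp.coeFn_zero ℂ 2 (S.μ.restrict s)] with t h1 h2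
      rw [← h1, h2]; rfl
    have hu := hS.eq_zero_on_of_ell_eq_zero hs h hk hc
    refine Lp.eq_zero_iff_ae_eq_zero.2 ?_
    filter_upwards [e1, ae_restrict_mem hs.measurableSet] with t h1 ht
    rw [h1, hu t ht]; rfl
  have huniq' : ∀ {x y g : S.HOn s}, (x, g) ∈ (S.dirichlet s).graph →
      (y, g) ∈ (S.dirichlet s).graph → x = y := by
    intro x y g hx hy
    have := Submodule.sub_mem _ hx hy
    rw [Prod.mk_sub_mk, sub_self] at this
    exact sub_eq_zero.1 (huniq this)
  choose t ht using hex
  let T₀ : S.HOn s →ₗ[ℂ] S.HOn s :=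
    { toFun := t
      map_add' := fun f g => huniq' (ht _) (Submodule.add_mem _ (ht f) (ht g))
      map_smul' := fun k f => huniq' (ht _) (Submodule.smul_mem _ k (ht f)) }
  have hsymm : T₀.IsSymmetric := by
    intro f g
    obtain ⟨u, v, k, h, hc, e1, e2⟩ := (mem_dirichlet_graph hs).1 (ht f)
    obtain ⟨u', v', k', h', hc', e1', e2'⟩ := (mem_dirichlet_graph hs).1 (ht g)
    have hgr := hS.green hs h h'
    rw [hc, hc', map_zero, mul_zero, zero_mul, sub_zero, mul_zero] at hgr
    change inner ℂ (t f) g = inner ℂ f (t g)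
    rw [inner_HOn e1 e2', inner_HOn e2 e1']
    exact (sub_eq_zero.1 hgr).symm
  refine ⟨⟨T₀, hsymm.continuous⟩, ?_, fun x g => ⟨fun h => huniq' h (ht g), ?_⟩⟩
  · rw [ContinuousLinearMap.isSelfAdjoint_iff_isSymmetric]
    exact hsymm
  · rintro rfl
    exact ht g

end SLCoeff

/-! ### Subspaces of finite codimension -/

/-- If a surjective linear map sends a subspace of finite codimension into `K ⊔ span {a}`, then
`K` has finite codimension. -/
lemma Submodule.CoFG.of_map_le_sup_span {k V W : Type*} [Field k] [AddCommGroup V] [Module k V]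
    [AddCommGroup W] [Module k W] {L : Submodule k V} (hL : L.CoFG) {f : V →ₗ[k] W}
    {K : Submodule k W} {a : W} (hf : Function.Surjective f)
    (h : ∀ y ∈ L, f y ∈ K ⊔ k ∙ a) : K.CoFG := by
  set N := K ⊔ k ∙ a
  have h2 : (N.comap f).CoFG := Submodule.CoFG.of_le h hL
  have h3 : N.CoFG := by
    refine Module.Finite.of_surjective ((N.comap f).mapQ N f le_rfl) ?_
    intro q
    obtain ⟨y, rfl⟩ := N.mkQ_surjective q
    obtain ⟨x, rfl⟩ := hf y
    exact ⟨Submodule.Quotient.mk x, rfl⟩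
  obtain ⟨C, hC⟩ := Submodule.exists_isCompl N
  have h4 : (k ∙ a ⊔ C).FG := (Submodule.fg_span_singleton a).sup (h3.fg_of_isCompl hC)
  refine h4.cofg_of_codisjoint ?_
  rw [codisjoint_iff, sup_comm, ← sup_assoc]
  exact hC.sup_eq_top

/-! ### Operators with a bounded selfadjoint inverse -/

section Inverse

variable {E : Type*} [NormedAddCommGroup E] [InnerProductSpace ℂ E] [CompleteSpace E]

/-- The range of a bounded selfadjoint operator is closed if it has finite codimension. -/
lemma range_eq_orthogonal_ker_of_cofg {D : E →L[ℂ] E} (hD : IsSelfAdjoint D)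
    (hc : D.range.CoFG) : D.range = D.kerᗮ := by
  have : CompleteSpace D.ker := D.isClosed_ker.completeSpace_coe
  have horth : D.rangeᗮ = D.ker := by
    rw [ContinuousLinearMap.orthogonal_range, ContinuousLinearMap.isSelfAdjoint_iff'.1 hD]
  -- the restriction of `D` to the orthogonal complement of its kernel
  set f : D.kerᗮ →L[ℂ] E := D ∘L (D.kerᗮ).subtypeL with hf
  have hrange : f.range = D.range := by
    apply le_antisymm
    · rintro _ ⟨x, rfl⟩
      exact ⟨x, rfl⟩
    · rintro _ ⟨x, rfl⟩
      refine ⟨⟨x - D.ker.starProjection x, D.ker.sub_starProjection_mem_orthogonal x⟩, ?_⟩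
      have : D (D.ker.starProjection x) = 0 := D.ker.starProjection_apply_mem x
      simp [hf, this]
  have hker : f.ker = ⊥ := by
    rw [Submodule.eq_bot_iff]
    intro x hx
    have h1 : (x : E) ∈ D.ker := hx
    have h2 := x.2 _ h1
    exact Subtype.ext (inner_self_eq_zero.1 h2)
  obtain ⟨G, hG⟩ := Submodule.exists_isCompl f.range
  have hGfg : G.FG := Submodule.CoFG.fg_of_isCompl hG (by rw [hrange]; exact hc)
  have : FiniteDimensional ℂ G := .of_fg hGfg
  have hclosed := f.closed_complemented_range_of_isCompl_of_ker_eq_bot G hG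
    G.closed_of_finiteDimensional hker
  rw [hrange] at hclosed
  rw [← horth, Submodule.orthogonal_orthogonal_eq_closure,
    hclosed.submodule_topologicalClosure_eq]

/-- If the range of a bounded selfadjoint operator has finite codimension, then the sum of the
operator and of the orthogonal projection onto its kernel is invertible. -/
lemma isUnit_add_starProjection_ker {D : E →L[ℂ] E} (hD : IsSelfAdjoint D)
    (hc : D.range.CoFG) [D.ker.HasOrthogonalProjection] :
    IsUnit (D + D.ker.starProjection) := by
  have hr := range_eq_orthogonal_ker_of_cofg hD hc
  have hP : ∀ x, D (D.ker.starProjection x) = 0 := fun x => D.ker.starProjection_apply_mem x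
  rw [ContinuousLinearMap.isUnit_iff_bijective]
  constructor
  · rw [injective_iff_map_eq_zero]
    intro x hx
    rw [add_apply] at hx
    have h1 : D x ∈ D.kerᗮ := by rw [← hr]; exact ⟨x, rfl⟩
    have h2 : D.ker.starProjection x = 0 := by
      have h3 : D.ker.starProjection x ∈ D.kerᗮ := by
        rw [eq_neg_of_add_eq_zero_right hx]
        exact Submodule.neg_mem _ h1
      exact inner_self_eq_zero.1 (h3 _ (D.ker.starProjection_apply_mem x))
    rw [h2, add_zero] at hx
    have h4 : D.ker.starProjection x = x := Submodule.starProjection_eq_self_iff.2 hx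
    rw [← h4, h2]
  · intro y
    have h1 : y - D.ker.starProjection y ∈ D.range := by
      rw [hr]; exact D.ker.sub_starProjection_mem_orthogonal y
    obtain ⟨x, hx⟩ := h1
    replace hx : D x = y - D.ker.starProjection y := hx
    refine ⟨x - D.ker.starProjection x + D.ker.starProjection y, ?_⟩
    have hid : ∀ z, D.ker.starProjection (D.ker.starProjection z) = D.ker.starProjection z :=
      fun z => Submodule.starProjection_eq_self_iff.2 (D.ker.starProjection_apply_mem z)
    simp [hP, hx, hid]

variable {T : E →L[ℂ] E}

lemma isSelfAdjoint_one_sub_smul (hT : IsSelfAdjoint T) (t : ℝ) :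
    IsSelfAdjoint (1 - (t : ℂ) • T) := by
  refine (IsSelfAdjoint.one _).sub ?_
  exact IsSelfAdjoint.smul (by simp [isSelfAdjoint_iff]) hT

/-- A point that is not an eigenvalue, and at which the range has finite codimension, is regular.
For real `z` the range is closed, hence the orthogonal complement of the kernel; other `z` are regular
because the spectrum of `T` is real. -/
lemma isUnit_one_sub_smul (hT : IsSelfAdjoint T) {z : ℂ} (hc : (1 - z • T).range.CoFG)
    (hker : ∀ f, f = z • T f → f = 0) : IsUnit (1 - z • T) := by
  by_cases him : z.im = 0
  · obtain ⟨t, rfl⟩ : ∃ t : ℝ, z = t := ⟨z.re, by apply Complex.ext <;> simp [him]⟩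
    set D := 1 - (t : ℂ) • T with hD
    have hs : IsSelfAdjoint D := isSelfAdjoint_one_sub_smul hT t
    have hk : D.ker = ⊥ := by
      rw [Submodule.eq_bot_iff]
      intro x hx
      refine hker x (sub_eq_zero.1 ?_)
      simpa [hD] using hx
    have : CompleteSpace D.ker := D.isClosed_ker.completeSpace_coe
    have := isUnit_add_starProjection_ker hs hc
    have h0 : D.ker.starProjection = 0 := by
      ext x
      exact (Submodule.eq_bot_iff _).1 hk _ (D.ker.starProjection_apply_mem x)
    rwa [h0, add_zero] at this
  · have hz : z ≠ 0 := fun h => him (by simp [h])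
    have h1 : z⁻¹ ∉ spectrum ℂ T := by
      intro h
      have := hT.im_eq_zero_of_mem_spectrum h
      rw [Complex.inv_im, div_eq_zero_iff, neg_eq_zero] at this
      rcases this with h | h
      · exact him h
      · exact hz (Complex.normSq_eq_zero.1 h)
    rw [spectrum.notMem_iff] at h1
    have e : 1 - z • T = z • (algebraMap ℂ (E →L[ℂ] E) z⁻¹ - T) := by
      rw [smul_sub, Algebra.algebraMap_eq_smul_one, smul_smul, mul_inv_cancel₀ hz, one_smul]
    rw [e]
    exact h1.smul (Units.mk0 z hz)

/-- Near a point `t ≠ 0` at which `1 - t T` has a kernel and a range of finite codimension, the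
function `⟪a, (1 - w T)⁻¹ a⟫` has a pole of first order, unless `a` is orthogonal to the kernel.
With `P` the orthogonal projection onto the kernel,
`(1 - w T)⁻¹ = (1 - w T + P)⁻¹ (1 - P) + t (t - w)⁻¹ P`. -/
lemma exists_simple_pole (hT : IsSelfAdjoint T) {t : ℝ} (ht : t ≠ 0)
    (hc : (1 - (t : ℂ) • T).range.CoFG) {a e : E}
    (he : e = (t : ℂ) • T e) (hae : inner ℂ a e ≠ 0) :
    (∀ᶠ w in 𝓝[≠] (t : ℂ), IsUnit (1 - w • T)) ∧
    ∃ (h : ℂ → ℂ) (κ : ℂ), AnalyticAt ℂ h t ∧ κ ≠ 0 ∧ ∀ᶠ w in 𝓝[≠] (t : ℂ),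
      inner ℂ a ((Ring.inverse (1 - w • T) : E →L[ℂ] E) a) = h w + κ / (w - t) := by
  have ht' : (t : ℂ) ≠ 0 := by exact_mod_cast ht
  set D := 1 - (t : ℂ) • T with hD
  have hs : IsSelfAdjoint D := isSelfAdjoint_one_sub_smul hT t
  have : CompleteSpace D.ker := D.isClosed_ker.completeSpace_coe
  have hu := isUnit_add_starProjection_ker hs hc
  set P := D.ker.starProjection with hPdef
  have hPP : P * P = P := D.ker.isIdempotentElem_starProjection
  have hPs : IsSelfAdjoint P := isSelfAdjoint_starProjection D.ker
  have hDP : D * P = 0 := by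
    ext x
    exact D.ker.starProjection_apply_mem x
  have hPD : P * D = 0 := by
    have := congrArg star hDP
    rwa [star_mul, star_zero, hs.star_eq, hPs.star_eq] at this
  have hTP : T * P = (t : ℂ)⁻¹ • P := by
    rw [hD, sub_mul, one_mul, smul_mul_assoc, sub_eq_zero] at hDP
    nth_rw 2 [hDP]
    rw [smul_smul, inv_mul_cancel₀ ht', one_smul]
  have hPT : P * T = (t : ℂ)⁻¹ • P := by
    rw [hD, mul_sub, mul_one, mul_smul_comm, sub_eq_zero] at hPD
    nth_rw 2 [hPD]
    rw [smul_smul, inv_mul_cancel₀ ht', one_smul]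
  set C : ℂ → E →L[ℂ] E := fun w => 1 - w • T + P with hC
  have hCcont : Continuous C := by fun_prop
  have hCan : AnalyticAt ℂ C t := by
    simp only [hC]
    fun_prop
  obtain ⟨U, hU⟩ := hu
  have hCt : C t = U := hU.symm
  have hCu : ∀ᶠ w in 𝓝 (t : ℂ), IsUnit (C w) := by
    refine hCcont.continuousAt.eventually_mem (IsOpen.mem_nhds Units.isOpen ?_)
    rw [hCt]
    exact U.isUnit
  have hinv : ∀ w, IsUnit (C w) → w ≠ t →
      (1 - w • T) * (Ring.inverse (C w) * (1 - P) + (t / (t - w) : ℂ) • P) = 1 ∧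
      (Ring.inverse (C w) * (1 - P) + (t / (t - w) : ℂ) • P) * (1 - w • T) = 1 := by
    intro w hw hwt
    set V := Ring.inverse (C w)
    have hCV : C w * V = 1 := Ring.mul_inverse_cancel _ hw
    have hVC : V * C w = 1 := Ring.inverse_mul_cancel _ hw
    have hcomm : Commute P (C w) := by
      change P * C w = C w * P
      simp only [hC, mul_add, add_mul, mul_sub, sub_mul, mul_smul_comm, smul_mul_assoc, hTP, hPT,
        one_mul, mul_one]
    have hPV : P * V = V * P := by
      calc P * V = V * C w * P * V := by rw [hVC, one_mul]
        _ = V * (C w * P) * V := by rw [mul_assoc V]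
        _ = V * (P * C w) * V := by rw [hcomm.eq]
        _ = V * P * (C w * V) := by simp only [mul_assoc]
        _ = V * P := by rw [hCV, mul_one]
    have hwt' : (t : ℂ) - w ≠ 0 := sub_ne_zero.2 hwt.symm
    have e1 : 1 - w • T = C w - P := by simp [hC]
    have e2 : (1 - w • T) * P = ((t - w) / t : ℂ) • P := by
      rw [sub_mul, one_mul, smul_mul_assoc, hTP, smul_smul, sub_div, div_self ht', sub_smul,
        one_smul, div_eq_mul_inv]
    have e3 : P * (1 - w • T) = ((t - w) / t : ℂ) • P := by
      rw [mul_sub, mul_one, mul_smul_comm, hPT, smul_smul, sub_div, div_self ht', sub_smul,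
        one_smul, div_eq_mul_inv]
    have hkk : (t / (t - w) : ℂ) * ((t - w) / t) = 1 := by field_simp
    constructor
    · rw [mul_add, mul_smul_comm, e2, smul_smul, hkk, one_smul, e1, sub_mul, ← mul_assoc, hCV,
        one_mul, ← mul_assoc, hPV, mul_assoc, mul_sub, mul_one, hPP, sub_self, mul_zero, sub_zero,
        sub_add_cancel]
    · rw [add_mul, smul_mul_assoc, e3, smul_smul, hkk, one_smul, e1, mul_sub, mul_assoc, mul_assoc,
        sub_mul, sub_mul, one_mul, one_mul, hPP, sub_self, mul_zero, sub_zero, hcomm.eq, mul_sub,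
        hVC, ← mul_assoc, hVC, one_mul, sub_add_cancel]
  have hev : ∀ᶠ w in 𝓝[≠] (t : ℂ), IsUnit (C w) ∧ w ≠ t :=
    (hCu.filter_mono nhdsWithin_le_nhds).and self_mem_nhdsWithin
  have hP0 : inner ℂ a (P a) ≠ 0 := by
    intro h0
    apply hae
    have h1 : P a = 0 := by
      have h2 : inner ℂ (P a) (P a) = inner ℂ a (P a) := by
        rw [hPdef, ← Submodule.inner_starProjection_left_eq_right]
        conv_lhs => rw [← hPdef]
        rw [← Submodule.inner_starProjection_left_eq_right, ← hPdef]
        change inner ℂ ((P * P) a) a = _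
        rw [hPP]
      rw [h0] at h2
      exact inner_self_eq_zero.1 h2
    have h2 : P e = e := by
      refine Submodule.starProjection_eq_self_iff.2 ?_
      change D e = 0
      rw [hD, sub_apply, one_apply_eq_self, smul_apply, ← he, sub_self]
    rw [← h2, hPdef, ← Submodule.inner_starProjection_left_eq_right, ← hPdef, h1, inner_zero_left]
  refine ⟨?_, fun w => inner ℂ a (Ring.inverse (C w) (a - P a)), -t * inner ℂ a (P a), ?_, ?_, ?_⟩
  · filter_upwards [hev] with w hw
    obtain ⟨h1, h2⟩ := hinv w hw.1 hw.2
    exact ⟨⟨_, _, h1, h2⟩, rfl⟩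
  · have h1 : AnalyticAt ℂ (fun w => Ring.inverse (C w)) t := by
      have := analyticAt_inverse (𝕜 := ℂ) U
      rw [← hCt] at this
      exact this.comp hCan
    have h2 : AnalyticAt ℂ (fun w => Ring.inverse (C w) (a - P a)) t :=
      (ContinuousLinearMap.apply ℂ E (a - P a)).analyticAt _ |>.comp h1
    exact (innerSL ℂ a).analyticAt _ |>.comp h2
  · exact mul_ne_zero (neg_ne_zero.2 ht') hP0
  · filter_upwards [hev] with w hw
    obtain ⟨h1, h2⟩ := hinv w hw.1 hw.2
    have h3 : Ring.inverse (1 - w • T) =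
        Ring.inverse (C w) * (1 - P) + (t / (t - w) : ℂ) • P :=
      Ring.inverse_unit ⟨_, _, h1, h2⟩
    have hwt' : (t : ℂ) - w ≠ 0 := sub_ne_zero.2 hw.2.symm
    have hwt'' : w - (t : ℂ) ≠ 0 := sub_ne_zero.2 hw.2
    rw [h3]
    simp only [add_apply, mul_apply_eq_comp, sub_apply, one_apply_eq_self, smul_apply,
      inner_add_right, inner_smul_right]
    congr 1
    field_simp
    ring

/-- The function `⟪a, (1 - w T)⁻¹ a⟫` is analytic where it is defined. -/
lemma analyticAt_inner_inverse {z : ℂ} (hz : IsUnit (1 - z • T)) (a : E) :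
    AnalyticAt ℂ (fun w => inner ℂ a ((Ring.inverse (1 - w • T) : E →L[ℂ] E) a)) z := by
  obtain ⟨U, hU⟩ := hz
  have h0 : AnalyticAt ℂ (fun w : ℂ => 1 - w • T) z := by fun_prop
  have h1 : AnalyticAt ℂ (fun w => (Ring.inverse (1 - w • T) : E →L[ℂ] E)) z := by
    have := analyticAt_inverse (𝕜 := ℂ) U
    rw [hU] at this
    exact AnalyticAt.comp (f := fun w : ℂ => 1 - w • T) this h0
  have h2 : AnalyticAt ℂ (fun w => (Ring.inverse (1 - w • T) : E →L[ℂ] E) a) z :=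
    (ContinuousLinearMap.apply ℂ E a).analyticAt _ |>.comp h1
  exact (innerSL ℂ a).analyticAt _ |>.comp h2

end Inverse

/-! ### Spectra of unbounded operators through their graphs -/

section Graph

variable {E : Type*} [NormedAddCommGroup E] [NormedSpace ℂ E]

lemma mem_opPointSpectrum_iff {B : E →ₗ.[ℂ] E} {z : ℂ} :
    z ∈ opPointSpectrum B ↔ ∃ f, f ≠ 0 ∧ (f, z • f) ∈ B.graph := by
  constructor
  · rintro ⟨f, hf, h⟩
    exact ⟨f, hf, (LinearPMap.mem_graph_iff _).2 ⟨f, rfl, h⟩⟩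
  · rintro ⟨f, hf, h⟩
    obtain ⟨y, rfl, hy⟩ := (LinearPMap.mem_graph_iff _).1 h
    exact ⟨y, hf, hy⟩

lemma mem_graph_neg_iff {B : E →ₗ.[ℂ] E} {x g : E} : (x, g) ∈ (-B).graph ↔ (x, -g) ∈ B.graph := by
  simp only [LinearPMap.mem_graph_iff]
  constructor
  · rintro ⟨y, h1, h2⟩
    refine ⟨y, h1, ?_⟩
    rw [LinearPMap.neg_apply] at h2
    exact neg_eq_iff_eq_neg.1 h2
  · rintro ⟨y, h1, h2⟩
    refine ⟨y, h1, ?_⟩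
    rw [LinearPMap.neg_apply]
    exact neg_eq_iff_eq_neg.2 h2

lemma mem_opPointSpectrum_neg_iff {B : E →ₗ.[ℂ] E} {z : ℂ} :
    z ∈ opPointSpectrum (-B) ↔ -z ∈ opPointSpectrum B := by
  simp only [mem_opPointSpectrum_iff, mem_graph_neg_iff, neg_smul]

variable {B : E →ₗ.[ℂ] E} {T : E →L[ℂ] E}

lemma mem_opPointSpectrum_iff_of_inverse (hBT : ∀ x g, (x, g) ∈ B.graph ↔ x = T g) {z : ℂ} :
    z ∈ opPointSpectrum B ↔ ∃ f, f ≠ 0 ∧ f = z • T f := by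
  simp only [mem_opPointSpectrum_iff, hBT, map_smul]

lemma range_opShift_of_inverse (hBT : ∀ x g, (x, g) ∈ B.graph ↔ x = T g) (z : ℂ) :
    LinearMap.range (opShift B z) = (1 - z • T).range := by
  ext g
  constructor
  · rintro ⟨f, rfl⟩
    have hf := (hBT _ _).1 (B.mem_graph f)
    refine ⟨B f, ?_⟩
    rw [opShift_apply]
    rw [hf]
    rfl
  · rintro ⟨k, rfl⟩
    obtain ⟨y, h1, h2⟩ := (LinearPMap.mem_graph_iff _).1 ((hBT (T k) k).2 rfl)
    refine ⟨y, ?_⟩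
    rw [opShift_apply, h1, h2]
    rfl

lemma notMem_opPointSpectrum_of_mem_opResolventSet {z : ℂ} (hz : z ∈ opResolventSet B) :
    z ∉ opPointSpectrum B := by
  rintro ⟨f, hf, h⟩
  obtain ⟨R, -, h2⟩ := hz
  apply hf
  rw [← h2 f, opShift_apply, h, sub_self, map_zero]

variable [CompleteSpace E]

lemma mem_opResolventSet_iff_of_inverse (hBT : ∀ x g, (x, g) ∈ B.graph ↔ x = T g) {z : ℂ} :
    z ∈ opResolventSet B ↔ IsUnit (1 - z • T) := by
  constructor
  · rintro ⟨R, h1, h2⟩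
    rw [ContinuousLinearMap.isUnit_iff_bijective]
    constructor
    · rw [injective_iff_map_eq_zero]
      intro g hg
      obtain ⟨y, e1, e2⟩ := (LinearPMap.mem_graph_iff _).1 ((hBT (T g) g).2 rfl)
      have h3 : opShift B z y = 0 := by
        rw [opShift_apply, e1, e2]
        exact hg
      have h4 := h2 y
      rw [h3, map_zero] at h4
      have h5 : T g = 0 := by rw [h4, e1]
      have h6 : g - z • T g = 0 := hg
      rwa [h5, smul_zero, sub_zero] at h6
    · intro g
      obtain ⟨h, e⟩ := h1 g
      have : g ∈ LinearMap.range (opShift B z) := ⟨_, e⟩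
      rw [range_opShift_of_inverse hBT] at this
      exact this
  · rintro ⟨U, hU⟩
    set V : E →L[ℂ] E := ↑U⁻¹ with hV
    have hUV : (1 - z • T) * V = 1 := by rw [← hU]; exact U.mul_inv
    have hVU : V * (1 - z • T) = 1 := by rw [← hU]; exact U.inv_mul
    refine ⟨T * V, fun g => ?_, fun f => ?_⟩
    · obtain ⟨y, e1, e2⟩ := (LinearPMap.mem_graph_iff _).1 ((hBT (T (V g)) (V g)).2 rfl)
      have hd : (T * V) g ∈ B.domain := by
        rw [show (T * V) g = y from e1.symm]
        exact y.2
      refine ⟨hd, ?_⟩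
      have : (⟨(T * V) g, hd⟩ : B.domain) = y := Subtype.ext e1.symm
      rw [this, opShift_apply, e1, e2]
      exact DFunLike.congr_fun hUV g
    · have hf := (hBT _ _).1 (B.mem_graph f)
      have h1 : opShift B z f = (1 - z • T) (B f) := by
        rw [opShift_apply]
        rw [hf]
        rfl
      rw [h1]
      change T ((V * (1 - z • T)) (B f)) = f
      rw [hVU]
      exact hf.symm

lemma mem_opResolventSet_neg_iff_of_inverse (hBT : ∀ x g, (x, g) ∈ B.graph ↔ x = T g) {z : ℂ} :
    z ∈ opResolventSet (-B) ↔ -z ∈ opResolventSet B := by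
  have h : ∀ x g, (x, g) ∈ (-B).graph ↔ x = (-T) g := by
    intro x g
    rw [mem_graph_neg_iff, hBT, map_neg]
    rfl
  rw [mem_opResolventSet_iff_of_inverse h, mem_opResolventSet_iff_of_inverse hBT, smul_neg,
    neg_smul]

lemma isOpen_opResolventSet_of_inverse (hBT : ∀ x g, (x, g) ∈ B.graph ↔ x = T g) :
    IsOpen (opResolventSet B) := by
  have : opResolventSet B = (fun w : ℂ => 1 - w • T) ⁻¹' {D | IsUnit D} := by
    ext w
    exact mem_opResolventSet_iff_of_inverse hBT
  rw [this]
  exact Units.isOpen.preimage (by fun_prop)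

end Graph

/-! ### Poles of first order -/

/-- Adding a simple principal part to an analytic function produces a pole. -/
lemma isPoleOf_of_eventually_eq {U : Set ℂ} {F h : ℂ → ℂ} {z κ : ℂ} (hU : ∀ᶠ w in 𝓝[≠] z, w ∈ U)
    (hh : AnalyticAt ℂ h z) (hκ : κ ≠ 0) (hF : ∀ᶠ w in 𝓝[≠] z, F w = h w + κ / (w - z)) :
    IsPoleOf U F z := by
  refine ⟨hU, ?_⟩
  have hG : AnalyticAt ℂ (fun w => h w * (w - z) + κ) z := by fun_prop
  have hev : ∀ᶠ w in 𝓝[≠] z, F w = (w - z) ^ (-1 : ℤ) • (h w * (w - z) + κ) := by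
    filter_upwards [hF, self_mem_nhdsWithin] with w hw hne
    have : w - z ≠ 0 := sub_ne_zero.2 hne
    rw [hw, zpow_neg_one, smul_eq_mul]
    field_simp
  have hm : MeromorphicAt F z := by
    refine MeromorphicAt.congr (f := fun w => (w - z) ^ (-1 : ℤ) • (h w * (w - z) + κ)) ?_ ?_
    · have h1 : MeromorphicAt (fun w : ℂ => w - z) z := by fun_prop
      exact (h1.zpow (-1)).smul hG.meromorphicAt
    · filter_upwards [hev] with w hw using hw.symm
  rw [(meromorphicOrderAt_eq_int_iff hm (n := -1)).2 ⟨_, hG, by simpa using hκ, hev⟩]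
  decide

lemma not_isPoleOf_of_analyticAt {U : Set ℂ} {F : ℂ → ℂ} {z : ℂ} (hF : AnalyticAt ℂ F z) :
    ¬ IsPoleOf U F z := fun h => h.2.not_ge hF.meromorphicOrderAt_nonneg

namespace SLCoeff

variable {S : SLCoeff}

/-! ### The Weyl function of a half-line -/

lemma mem_opPointSpectrum_dirichlet_iff {s : Set ℝ} {ε : ℂ} (hs : S.IsHalfLine s ε) {z : ℂ} :
    z ∈ opPointSpectrum (S.dirichlet s) ↔ ∃ u v, S.IsWeylSolution s z u v ∧ u S.c = 0 := by
  rw [mem_opPointSpectrum_iff]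
  constructor
  · rintro ⟨f, hf, h⟩
    obtain ⟨u, v, k, hD, hc, e1, e2⟩ := (mem_dirichlet_graph hs).1 h
    refine ⟨u, v, ⟨k, hD, ?_, ?_⟩, hc⟩
    · rw [← ae_mu_restrict_iff (S := S) hs.measurableSet]
      filter_upwards [e1, e2, Lp.coeFn_smul z f] with t h1 h2 h3
      rw [← h1, ← h2, h3]; rfl
    · by_contra! h0
      refine hf (Lp.eq_zero_iff_ae_eq_zero.2 ?_)
      filter_upwards [e1, ae_restrict_mem hs.measurableSet] with t h1 ht
      rw [h1, h0 t ht]; rfl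
  · rintro ⟨u, v, ⟨g, hD, hg, x, hx, hne⟩, hc⟩
    have e := (hD.2.1.restrict s).coeFn_toLp
    refine ⟨(hD.2.1.restrict s).toLp _, fun h0 => hne ?_, (mem_dirichlet_graph hs).2
      ⟨u, v, g, hD, hc, e, ?_⟩⟩
    · refine eq_zero_of_ae hs.isOpen hD.1.1.continuous ?_ x hx
      rw [← ae_mu_restrict_iff (S := S) hs.measurableSet]
      rw [h0] at e
      filter_upwards [e, Lp.coeFn_zero ℂ 2 (S.μ.restrict s)] with t h1 h2
      rw [← h1, h2]; rfl
    · filter_upwards [Lp.coeFn_smul z ((hD.2.1.restrict s).toLp _), e,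
        (ae_mu_restrict_iff hs.measurableSet).2 hg] with t h1 h2 h3
      rw [h1, Pi.smul_apply, h2, h3, smul_eq_mul]

lemma IsWeylSolution.ne_zero_of_eq_zero {s : Set ℝ} {ε : ℂ} (hs : S.IsHalfLine s ε) {z : ℂ}
    {u v : ℝ → ℂ} (h : S.IsWeylSolution s z u v) (hu : u S.c = 0) : v S.c ≠ 0 := by
  obtain ⟨g, hD, hg, x, hx, hne⟩ := h
  exact fun hv => hne (hD.eq_zero_on hs hg hu hv x hx)

lemma IsWeylSolution.ne_zero {s : Set ℝ} {ε : ℂ} (hs : S.IsHalfLine s ε) {z : ℂ}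
    {u v : ℝ → ℂ} (h : S.IsWeylSolution s z u v) (hz : z ∉ opPointSpectrum (S.dirichlet s)) :
    u S.c ≠ 0 :=
  fun hu => hz ((mem_opPointSpectrum_dirichlet_iff hs).2 ⟨u, v, h, hu⟩)

/-- Nonzero Cauchy data at `c` force a solution to be nontrivial on the half-line. -/
lemma InD.isWeylSolution {s : Set ℝ} {ε : ℂ} (hs : S.IsHalfLine s ε) {z : ℂ}
    {u v g : ℝ → ℂ} (h : S.InD u v g) (hg : ∀ᵐ x, x ∈ s → g x = z * u x)
    (hc : u S.c ≠ 0 ∨ v S.c ≠ 0) : S.IsWeylSolution s z u v := by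
  refine ⟨g, h, hg, ?_⟩
  by_contra! h0
  obtain ⟨h1, h2⟩ := h.1.cauchyData_eq_zero hs h0
  exact hc.elim (· h1) (· h2)

/-- Off the Dirichlet eigenvalues the Weyl function is the quotient of the Cauchy data of any
Weyl solution, since that solution is unique up to a constant multiple. -/
lemma IsWeylSolution.titchmarshWeyl_eq {s : Set ℝ} {ε : ℂ} (hs : S.IsHalfLine s ε) {z : ℂ}
    {u v : ℝ → ℂ} (h : S.IsWeylSolution s z u v) (hz : z ∉ opPointSpectrum (S.dirichlet s)) :
    S.titchmarshWeyl s z = v S.c / u S.c := by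
  obtain ⟨w, hwm, hw⟩ : ∃ w : (ℝ → ℂ) × (ℝ → ℂ), S.titchmarshWeyl s z = w.2 S.c / w.1 S.c ∧
      S.IsWeylSolution s z w.1 w.2 :=
    ⟨_, rfl, Classical.epsilon_spec
      (p := fun w : (ℝ → ℂ) × (ℝ → ℂ) => S.IsWeylSolution s z w.1 w.2) ⟨(u, v), h⟩⟩
  rw [hwm]
  have hu := h.ne_zero hs hz
  have hwu := hw.ne_zero hs hz
  obtain ⟨g, hD, hg, -⟩ := h
  obtain ⟨k, hwD, hk, -⟩ := hw
  have hd := (hwD.const_smul (u S.c)).sub (hD.const_smul (w.1 S.c))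
  have hdg : ∀ᵐ x, x ∈ s → (u S.c • k - w.1 S.c • g) x =
      z * (u S.c • w.1 - w.1 S.c • u) x := by
    filter_upwards [hg, hk] with x h1 h2 hx
    simp only [Pi.sub_apply, Pi.smul_apply, smul_eq_mul, h1 hx, h2 hx]
    ring
  have hv : (u S.c • w.2 - w.1 S.c • v) S.c = 0 := by
    by_contra hne
    refine (hd.isWeylSolution hs hdg (Or.inr hne)).ne_zero hs hz ?_
    simp [mul_comm]
  rw [div_eq_div_iff hwu hu]
  simp only [Pi.sub_apply, Pi.smul_apply, smul_eq_mul] at hv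
  linear_combination hv

/-- The Dirichlet operator on a half-line as a perturbation problem: `T` is its inverse, `a` the
Weyl solution at `0`, normalized by `u(c) = 1`, and `b` its derivative `(p u')(c)`. The Weyl
solution at `w` is `(1 - w T)⁻¹ a`, which makes the Weyl function equal to
`b ± w ⟪a, (1 - w T)⁻¹ a⟫`; eigenfunctions are not orthogonal to `a`; and the domain of `ℓ` on
the half-line is obtained from the Dirichlet domain by adjoining `a`. -/
lemma LeftDefinite.exists_weylModel (hS : S.LeftDefinite) {s : Set ℝ} {ε : ℂ}
    (hs : S.IsHalfLine s ε) : ∃ (T : S.HOn s →L[ℂ] S.HOn s) (a : S.HOn s) (b : ℂ),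
      IsSelfAdjoint T ∧ (∀ x g, (x, g) ∈ (S.dirichlet s).graph ↔ x = T g) ∧
      (∀ (z : ℂ) (e : S.HOn s), e ≠ 0 → e = z • T e → inner ℂ a e ≠ 0) ∧
      (∀ w : ℂ, IsUnit (1 - w • T) → ∃ u v, S.IsWeylSolution s w u v ∧ u S.c = 1 ∧
        v S.c = b + ε * w * inner ℂ a ((Ring.inverse (1 - w • T) : S.HOn s →L[ℂ] S.HOn s) a)) ∧
      (∀ (z : ℂ) (u v g : ℝ → ℂ), S.InD u v g → ∀ y : S.HOn s,
        y =ᵐ[S.μ.restrict s] g - z • u → y ∈ (1 - z • T).range ⊔ ℂ ∙ a) := by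
  obtain ⟨u₀, v₀, g₀, h₀, hg₀, hc₀⟩ := hS.exists_weylSolution_zero hs
  obtain ⟨T, hT, hBT⟩ := hS.exists_dirichlet_inverse hs
  have hε : ε * ε = 1 := by rcases hs with ⟨-, rfl⟩ | ⟨-, rfl⟩ <;> norm_num
  have ea := (h₀.2.1.restrict s).coeFn_toLp
  set a : S.HOn s := (h₀.2.1.restrict s).toLp _ with ha
  have hg₀' := (ae_mu_restrict_iff (S := S) hs.measurableSet).2 hg₀
  -- Green's identity with the Weyl solution determines the slope at `c` on the Dirichlet domain
  have hrep : ∀ k : S.HOn s, ∃ u v g, S.InD u v g ∧ u S.c = 0 ∧ T k =ᵐ[S.μ.restrict s] u ∧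
      k =ᵐ[S.μ.restrict s] g ∧ v S.c = ε * inner ℂ a k := by
    intro k
    obtain ⟨u, v, g, h, hc, e1, e2⟩ := (mem_dirichlet_graph hs).1 ((hBT (T k) k).2 rfl)
    refine ⟨u, v, g, h, hc, e1, e2, ?_⟩
    have hgr := hS.green hs h₀ h
    have h0 : ∫ x in s, conj (g₀ x) * u x ∂S.μ = 0 := by
      refine integral_eq_zero_of_ae ?_
      filter_upwards [hg₀'] with x hx
      simp [hx]
    rw [h0, ← inner_HOn ea e2, hc, hc₀, map_one] at hgr
    linear_combination (-v S.c) * hε + ε * hgr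
  refine ⟨T, a, v₀ S.c, hT, hBT, ?_, ?_, ?_⟩
  · intro z e hne he h0
    obtain ⟨u, v, g, h, hc, e1, e2, hv⟩ := hrep e
    rw [h0, mul_zero] at hv
    have hg : ∀ᵐ x, x ∈ s → g x = z * u x := by
      rw [← ae_mu_restrict_iff (S := S) hs.measurableSet]
      have e3 := Lp.coeFn_smul z (T e)
      rw [← he] at e3
      filter_upwards [e1, e2, e3] with x h1 h2 h3
      rw [← h2, h3, Pi.smul_apply, h1, smul_eq_mul]
    have hu := h.eq_zero_on hs hg hc hv
    have hTe : T e = 0 := by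
      refine Lp.eq_zero_iff_ae_eq_zero.2 ?_
      filter_upwards [e1, ae_restrict_mem hs.measurableSet] with t h1 ht
      rw [h1, hu t ht]; rfl
    exact hne (by rw [he, hTe, smul_zero])
  · intro w hw
    set k := (Ring.inverse (1 - w • T) : S.HOn s →L[ℂ] S.HOn s) a with hk
    have hka : k = a + w • T k := by
      have h1 : (1 - w • T) k = a := DFunLike.congr_fun (Ring.mul_inverse_cancel _ hw) a
      rw [← h1]
      exact (sub_add_cancel _ _).symm
    obtain ⟨u, v, g, h, hc, e1, e2, hv⟩ := hrep k
    refine ⟨u₀ + w • u, v₀ + w • v,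
      (h₀.add (h.const_smul w)).isWeylSolution hs ?_ (Or.inl (by simp [hc, hc₀])),
      by simp [hc, hc₀], by simp [hv]; ring⟩
    rw [← ae_mu_restrict_iff (S := S) hs.measurableSet]
    have e3 := Lp.coeFn_add a (w • T k)
    rw [← hka] at e3
    filter_upwards [e1, e2, e3, Lp.coeFn_smul w (T k), ea, hg₀']
      with x h1 h2 h3 h4 h5 h6
    rw [h2, Pi.add_apply, h4, Pi.smul_apply, h1, h5] at h3
    simp [h6, h3]
  · intro z u v g h y hy
    -- subtracting a multiple of the Weyl solution enforces the Dirichlet condition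
    have hD := h.sub (h₀.const_smul (u S.c))
    set k : S.HOn s := (h.2.2.restrict s).toLp g with hk
    have ek := (h.2.2.restrict s).coeFn_toLp
    have hgr : ((h.2.1.restrict s).toLp u - u S.c • a, k) ∈ (S.dirichlet s).graph := by
      refine (mem_dirichlet_graph hs).2 ⟨_, _, _, hD, by simp [hc₀], ?_, ?_⟩
      · filter_upwards [Lp.coeFn_sub ((h.2.1.restrict s).toLp u) (u S.c • a),
          Lp.coeFn_smul (u S.c) a, ea, (h.2.1.restrict s).coeFn_toLp] with x h1 h2 h3 h4
        rw [h1, Pi.sub_apply, h2, Pi.smul_apply, h3, h4]; rfl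
      · filter_upwards [ek, hg₀'] with x h1 h2
        rw [h1]
        simp [h2]
    rw [hBT] at hgr
    have hy' : y = (1 - z • T) k + (-(z * u S.c)) • a := by
      have h1 : (1 - z • T) k = k - z • T k := rfl
      have h2 : y = k - z • (h.2.1.restrict s).toLp u := by
        refine Lp.ext ?_
        filter_upwards [hy, Lp.coeFn_sub k (z • (h.2.1.restrict s).toLp u),
          Lp.coeFn_smul z ((h.2.1.restrict s).toLp u), ek, (h.2.1.restrict s).coeFn_toLp]
          with x h1 h2 h3 h4 h5
        rw [h1, h2, Pi.sub_apply, Pi.sub_apply, Pi.smul_apply, h3, Pi.smul_apply, h5, hk, h4]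
      rw [h1, ← hgr, h2]
      module
    rw [hy']
    exact Submodule.add_mem_sup ⟨k, rfl⟩
      (Submodule.smul_mem _ _ (Submodule.mem_span_singleton_self a))

lemma LeftDefinite.analyticAt_titchmarshWeyl (hS : S.LeftDefinite) {s : Set ℝ} {ε : ℂ}
    (hs : S.IsHalfLine s ε) {z : ℂ} (hz : z ∈ opResolventSet (S.dirichlet s)) :
    AnalyticAt ℂ (S.titchmarshWeyl s) z := by
  obtain ⟨T, a, b, -, hBT, -, hsol, -⟩ := hS.exists_weylModel hs
  have h1 := analyticAt_inner_inverse ((mem_opResolventSet_iff_of_inverse hBT).1 hz) a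
  have h2 : AnalyticAt ℂ (fun w => b + ε * w *
      inner ℂ a ((Ring.inverse (1 - w • T) : S.HOn s →L[ℂ] S.HOn s) a)) z := by fun_prop
  refine h2.congr ?_
  filter_upwards [(isOpen_opResolventSet_of_inverse hBT).mem_nhds hz] with w hw
  obtain ⟨u, v, h, hu, hv⟩ := hsol w ((mem_opResolventSet_iff_of_inverse hBT).1 hw)
  rw [h.titchmarshWeyl_eq hs (notMem_opPointSpectrum_of_mem_opResolventSet hw), hu, hv, div_one]

lemma LeftDefinite.exists_isWeylSolution (hS : S.LeftDefinite) {s : Set ℝ} {ε : ℂ}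
    (hs : S.IsHalfLine s ε) {z : ℂ} (hz : z ∈ opResolventSet (S.dirichlet s)) :
    ∃ u v, S.IsWeylSolution s z u v ∧ u S.c = 1 ∧ v S.c = S.titchmarshWeyl s z := by
  obtain ⟨T, a, b, -, hBT, -, hsol, -⟩ := hS.exists_weylModel hs
  obtain ⟨u, v, h, hu, hv⟩ := hsol z ((mem_opResolventSet_iff_of_inverse hBT).1 hz)
  refine ⟨u, v, h, hu, ?_⟩
  rw [h.titchmarshWeyl_eq hs (notMem_opPointSpectrum_of_mem_opResolventSet hz), hu, div_one]

lemma LeftDefinite.isOpen_opResolventSet (hS : S.LeftDefinite) {s : Set ℝ} {ε : ℂ}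
    (hs : S.IsHalfLine s ε) : IsOpen (opResolventSet (S.dirichlet s)) := by
  obtain ⟨T, -, hBT⟩ := hS.exists_dirichlet_inverse hs
  exact isOpen_opResolventSet_of_inverse hBT

lemma LeftDefinite.mem_opResolventSet_neg (hS : S.LeftDefinite) {s : Set ℝ} {ε : ℂ}
    (hs : S.IsHalfLine s ε) {z : ℂ} :
    z ∈ opResolventSet (-S.dirichlet s) ↔ -z ∈ opResolventSet (S.dirichlet s) := by
  obtain ⟨T, -, hBT⟩ := hS.exists_dirichlet_inverse hs
  exact mem_opResolventSet_neg_iff_of_inverse hBT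

lemma LeftDefinite.eigenvalue_dirichlet_pos (hS : S.LeftDefinite) {s : Set ℝ} {ε : ℂ}
    (hs : S.IsHalfLine s ε) {z : ℂ} (hz : z ∈ opPointSpectrum (S.dirichlet s)) :
    ∃ t : ℝ, 0 < t ∧ z = t := by
  obtain ⟨u, v, ⟨g, hD, hg, hne⟩, hc⟩ := (mem_opPointSpectrum_dirichlet_iff hs).1 hz
  exact hS.eigenvalue_pos hs hD hg hc hne

lemma LeftDefinite.mem_opResolventSet_of_cofg (hS : S.LeftDefinite) {s : Set ℝ} {ε : ℂ}
    (hs : S.IsHalfLine s ε) {z : ℂ} (hc : (LinearMap.range (opShift (S.dirichlet s) z)).CoFG)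
    (hz : z ∉ opPointSpectrum (S.dirichlet s)) : z ∈ opResolventSet (S.dirichlet s) := by
  obtain ⟨T, hT, hBT⟩ := hS.exists_dirichlet_inverse hs
  rw [range_opShift_of_inverse hBT] at hc
  rw [mem_opPointSpectrum_iff_of_inverse hBT] at hz
  push Not at hz
  rw [mem_opResolventSet_iff_of_inverse hBT]
  refine isUnit_one_sub_smul hT hc fun f hf => ?_
  by_contra hne
  exact hz f hne hf

/-- An eigenvalue of the Dirichlet operator at which the range has finite codimension is a
simple pole of the Weyl function. -/
lemma LeftDefinite.exists_titchmarshWeyl_eq_add_div (hS : S.LeftDefinite) {s : Set ℝ} {ε : ℂ}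
    (hs : S.IsHalfLine s ε) {z : ℂ} (hc : (LinearMap.range (opShift (S.dirichlet s) z)).CoFG)
    (hz : z ∈ opPointSpectrum (S.dirichlet s)) :
    (∀ᶠ w in 𝓝[≠] z, w ∈ opResolventSet (S.dirichlet s)) ∧
    ∃ (h : ℂ → ℂ) (κ : ℂ), AnalyticAt ℂ h z ∧ κ ≠ 0 ∧ ∀ᶠ w in 𝓝[≠] z,
      S.titchmarshWeyl s w = h w + κ / (w - z) := by
  obtain ⟨t, ht, rfl⟩ := hS.eigenvalue_dirichlet_pos hs hz
  obtain ⟨T, a, b, hT, hBT, hne, hsol, -⟩ := hS.exists_weylModel hs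
  rw [range_opShift_of_inverse hBT] at hc
  obtain ⟨e, he0, he⟩ := (mem_opPointSpectrum_iff_of_inverse hBT).1 hz
  obtain ⟨hU, h, κ, hh, hκ, hev⟩ := exists_simple_pole hT ht.ne' hc he (hne _ e he0 he)
  have hU' : ∀ᶠ w in 𝓝[≠] (t : ℂ), w ∈ opResolventSet (S.dirichlet s) := by
    filter_upwards [hU] with w hw using (mem_opResolventSet_iff_of_inverse hBT).2 hw
  have ht' : (t : ℂ) ≠ 0 := by exact_mod_cast ht.ne'
  -- `w κ / (w - t) = κ + t κ / (w - t)`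
  refine ⟨hU', fun w => b + ε * w * h w + ε * κ, ε * t * κ, by fun_prop,
    mul_ne_zero (mul_ne_zero hs.ne_zero ht') hκ, ?_⟩
  filter_upwards [hU, hU', hev, self_mem_nhdsWithin] with w h1 h2 h3 hwt
  obtain ⟨u, v, hW, hu, hv⟩ := hsol w h1
  have : w - (t : ℂ) ≠ 0 := sub_ne_zero.2 hwt
  rw [hW.titchmarshWeyl_eq hs (notMem_opPointSpectrum_of_mem_opResolventSet h2), hu, hv, div_one,
    h3]
  field_simp
  ring

lemma LeftDefinite.isPoleOf_titchmarshWeyl_iff (hS : S.LeftDefinite) {s : Set ℝ} {ε : ℂ}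
    (hs : S.IsHalfLine s ε) {z : ℂ} (hc : (LinearMap.range (opShift (S.dirichlet s) z)).CoFG) :
    IsPoleOf (opResolventSet (S.dirichlet s)) (S.titchmarshWeyl s) z ↔
      z ∈ opPointSpectrum (S.dirichlet s) := by
  constructor
  · intro hp
    by_contra hz
    exact not_isPoleOf_of_analyticAt (hS.analyticAt_titchmarshWeyl hs
      (hS.mem_opResolventSet_of_cofg hs hc hz)) hp
  · intro hz
    obtain ⟨hU, h, κ, hh, hκ, hev⟩ := hS.exists_titchmarshWeyl_eq_add_div hs hc hz
    exact isPoleOf_of_eventually_eq hU hh hκ hev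

/-! ### Finite codimension on the half-lines -/

lemma restr_coeFn (s : Set ℝ) (f : S.H) : S.restr s f =ᵐ[S.μ.restrict s] f :=
  LpToLpRestrictCLM_coeFn ℂ s f

lemma exists_restr_eq {s : Set ℝ} {ε : ℂ} (hs : S.IsHalfLine s ε) (f : S.HOn s) :
    ∃ F : S.H, S.restr s F = f ∧ ∀ t, Disjoint s t → MeasurableSet t → S.restr t F = 0 := by
  have m : MemLp (s.indicator f) 2 S.μ :=
    (memLp_indicator_iff_restrict hs.measurableSet).2 (Lp.memLp f)
  refine ⟨m.toLp _, Lp.ext ?_, fun t hd ht => Lp.eq_zero_iff_ae_eq_zero.2 ?_⟩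
  · filter_upwards [restr_coeFn s (m.toLp _), ae_restrict_of_ae (s := s) m.coeFn_toLp,
      ae_restrict_mem hs.measurableSet] with x h1 h2 hx
    rw [h1, h2, indicator_of_mem hx]
  · filter_upwards [restr_coeFn t (m.toLp _), ae_restrict_of_ae (s := t) m.coeFn_toLp,
      ae_restrict_mem ht] with x h1 h2 hx
    rw [h1, h2, indicator_of_notMem (disjoint_right.1 hd hx)]; rfl

/-- If a subspace of finite codimension consists of functions that are, on the half-line `s`,
multiples of `ℓ u - z u` with `u` in the maximal domain, then the range of the Dirichlet operator
minus `z` has finite codimension: the boundary condition costs at most one dimension. -/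
lemma LeftDefinite.cofg_of_restr (hS : S.LeftDefinite) {s : Set ℝ} {ε : ℂ}
    (hs : S.IsHalfLine s ε) {z : ℂ} {L : Submodule ℂ S.H} (hL : L.CoFG)
    (h : ∀ y ∈ L, ∃ u v g, S.InD u v g ∧ ∃ k : ℂ,
      S.restr s y =ᵐ[S.μ.restrict s] k • (g - z • u)) :
    (LinearMap.range (opShift (S.dirichlet s) z)).CoFG := by
  obtain ⟨T, a, b, hT, hBT, -, -, hmem⟩ := hS.exists_weylModel hs
  rw [range_opShift_of_inverse hBT]
  refine hL.of_map_le_sup_span (f := S.restr s) (a := a) ?_ ?_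
  · intro f
    obtain ⟨F, hF, -⟩ := exists_restr_eq hs f
    exact ⟨F, hF⟩
  · intro y hy
    obtain ⟨u, v, g, hD, k, hk⟩ := h y hy
    refine hmem z _ _ _ (hD.const_smul k) _ ?_
    filter_upwards [hk] with x hx
    rw [hx]
    simp only [Pi.smul_apply, Pi.sub_apply, smul_eq_mul]
    ring

/-! ### Coupling the half-lines -/

lemma isHalfLine_Ioi : S.IsHalfLine (Ioi S.c) 1 := Or.inl ⟨rfl, rfl⟩

lemma isHalfLine_Iio : S.IsHalfLine (Iio S.c) (-1) := Or.inr ⟨rfl, rfl⟩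

variable (S) in
/-- There is a nonzero `u` in the maximal domain with `ℓ u = z u` on the right and `ℓ u = z' u` on
the left of `c`. For `z' = z` these `u` are the eigenfunctions of `A`, for `z' = -z` those
of `JA`. -/
def HasCoupledSolution (z z' : ℂ) : Prop :=
  ∃ u v g, S.InD u v g ∧ (∀ᵐ x, x ∈ Ioi S.c → g x = z * u x) ∧
    (∀ᵐ x, x ∈ Iio S.c → g x = z' * u x) ∧ ∃ x, u x ≠ 0

lemma ae_of_ae_halfLines {P : ℝ → Prop} (h₁ : ∀ᵐ x, x ∈ Ioi S.c → P x)
    (h₂ : ∀ᵐ x, x ∈ Iio S.c → P x) : ∀ᵐ x, P x := by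
  filter_upwards [h₁, h₂, ae_ne_c (S := S)] with x k1 k2 k3
  rcases lt_or_gt_of_ne k3 with h | h
  · exact k2 h
  · exact k1 h

lemma mem_A_graph_iff {x y : S.H} :
    (x, y) ∈ S.A.graph ↔ ∃ u v g, S.InD u v g ∧ x =ᵐ[S.μ] u ∧ y =ᵐ[S.μ] g := by
  rw [S.A_graph]
  rfl

lemma J_coeFn (f : S.H) :
    S.J f =ᵐ[S.μ] fun x => ((Real.sign (S.r x) : ℝ) : ℂ) * f x :=
  (S.memLp_sign_mul f).coeFn_toLp

lemma ae_sign_eq_one : ∀ᵐ x, x ∈ Ioi S.c → ((Real.sign (S.r x) : ℝ) : ℂ) = 1 := by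
  filter_upwards [S.r_pos] with x h hx
  rw [Real.sign_of_pos (h hx), Complex.ofReal_one]

lemma ae_sign_eq_neg_one : ∀ᵐ x, x ∈ Iio S.c → ((Real.sign (S.r x) : ℝ) : ℂ) = -1 := by
  filter_upwards [S.r_neg] with x h hx
  rw [Real.sign_of_neg (h hx), Complex.ofReal_neg, Complex.ofReal_one]

lemma mem_JA_graph_iff {x y : S.H} :
    (x, y) ∈ S.JA.graph ↔ ∃ k, (x, k) ∈ S.A.graph ∧ y = S.J k := by
  simp only [LinearPMap.mem_graph_iff]
  constructor
  · rintro ⟨f, h1, h2⟩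
    exact ⟨S.A f, ⟨f, h1, rfl⟩, h2.symm⟩
  · rintro ⟨k, ⟨f, h1, h2⟩, rfl⟩
    exact ⟨f, h1, congrArg S.J h2⟩

lemma exists_ne_zero_iff {u : ℝ → ℂ} (hu : Continuous u) {f : S.H} (hf : f =ᵐ[S.μ] u) :
    f ≠ 0 ↔ ∃ x, u x ≠ 0 := by
  rw [← not_iff_not, not_not, not_exists]
  push Not
  rw [Lp.eq_zero_iff_ae_eq_zero]
  constructor
  · intro h x
    refine eq_zero_of_ae isOpen_univ hu ?_ x (mem_univ _)
    filter_upwards [ae_mu_iff.1 (hf.symm.trans h)] with t ht _ using ht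
  · intro h
    filter_upwards [hf] with x hx
    rw [hx, h]; rfl

lemma mem_opPointSpectrum_A_iff {z : ℂ} :
    z ∈ opPointSpectrum S.A ↔ S.HasCoupledSolution z z := by
  rw [mem_opPointSpectrum_iff]
  constructor
  · rintro ⟨f, hf, h⟩
    obtain ⟨u, v, g, hD, e1, e2⟩ := mem_A_graph_iff.1 h
    have hg : ∀ᵐ x, g x = z * u x := by
      rw [← ae_mu_iff (S := S)]
      filter_upwards [e1, e2, Lp.coeFn_smul z f] with x h1 h2 h3
      rw [← h2, h3, Pi.smul_apply, h1, smul_eq_mul]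
    exact ⟨u, v, g, hD, hg.mono fun x hx _ => hx, hg.mono fun x hx _ => hx,
      (exists_ne_zero_iff hD.1.1.continuous e1).1 hf⟩
  · rintro ⟨u, v, g, hD, h1, h2, hne⟩
    have e := hD.2.1.coeFn_toLp
    refine ⟨hD.2.1.toLp _, (exists_ne_zero_iff hD.1.1.continuous e).2 hne,
      mem_A_graph_iff.2 ⟨u, v, g, hD, e, ?_⟩⟩
    filter_upwards [ae_mu_iff.2 (ae_of_ae_halfLines h1 h2), e,
      Lp.coeFn_smul z (hD.2.1.toLp u)] with x k1 k2 k3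
    rw [k3, Pi.smul_apply, k2, k1, smul_eq_mul]

lemma mem_opPointSpectrum_JA_iff {z : ℂ} :
    z ∈ opPointSpectrum S.JA ↔ S.HasCoupledSolution z (-z) := by
  rw [mem_opPointSpectrum_iff]
  constructor
  · rintro ⟨f, hf, h⟩
    obtain ⟨k, hk, hJ⟩ := mem_JA_graph_iff.1 h
    obtain ⟨u, v, g, hD, e1, e2⟩ := mem_A_graph_iff.1 hk
    have hg : ∀ᵐ x, ((Real.sign (S.r x) : ℝ) : ℂ) * g x = z * u x := by
      rw [← ae_mu_iff (S := S)]
      have e3 := Lp.coeFn_smul z f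
      rw [hJ] at e3
      filter_upwards [e1, e2, e3, J_coeFn k] with x h1 h2 h3 h4
      rw [← h2, ← h4, h3, Pi.smul_apply, h1, smul_eq_mul]
    refine ⟨u, v, g, hD, ?_, ?_, (exists_ne_zero_iff hD.1.1.continuous e1).1 hf⟩
    · filter_upwards [hg, ae_sign_eq_one (S := S)] with x h1 h2 hx
      rw [h2 hx, one_mul] at h1
      exact h1
    · filter_upwards [hg, ae_sign_eq_neg_one (S := S)] with x h1 h2 hx
      rw [h2 hx] at h1
      linear_combination -h1
  · rintro ⟨u, v, g, hD, h1, h2, hne⟩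
    have e := hD.2.1.coeFn_toLp
    refine ⟨hD.2.1.toLp _, (exists_ne_zero_iff hD.1.1.continuous e).2 hne,
      mem_JA_graph_iff.2 ⟨hD.2.2.toLp _, mem_A_graph_iff.2 ⟨u, v, g, hD, e,
        hD.2.2.coeFn_toLp⟩, Lp.ext ?_⟩⟩
    have hg : ∀ᵐ x, ((Real.sign (S.r x) : ℝ) : ℂ) * g x = z * u x := by
      refine ae_of_ae_halfLines (S := S) ?_ ?_
      · filter_upwards [h1, ae_sign_eq_one (S := S)] with x h1 h2 hx
        rw [h2 hx, one_mul, h1 hx]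
      · filter_upwards [h2, ae_sign_eq_neg_one (S := S)] with x h1 h2 hx
        rw [h2 hx, h1 hx]
        ring
    filter_upwards [ae_mu_iff.2 hg, e, Lp.coeFn_smul z (hD.2.1.toLp u), J_coeFn (hD.2.2.toLp g),
      hD.2.2.coeFn_toLp] with x k1 k2 k3 k4 k5
    rw [k3, Pi.smul_apply, k2, k4, k5, k1, smul_eq_mul]

lemma mem_opPointSpectrum_orthSum_iff {T : S.HOn (Ioi S.c) →ₗ.[ℂ] S.HOn (Ioi S.c)}
    {T' : S.HOn (Iio S.c) →ₗ.[ℂ] S.HOn (Iio S.c)} {z : ℂ} :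
    z ∈ opPointSpectrum (S.orthSum T T') ↔ z ∈ opPointSpectrum T ∨ z ∈ opPointSpectrum T' := by
  have hd : Disjoint (Ioi S.c) (Iio S.c) :=
    disjoint_left.2 fun x (h : S.c < x) (h' : x < S.c) => lt_asymm h h'
  simp only [mem_opPointSpectrum_iff, S.orthSum_graph, S.mem_graphOrthSum, map_smul]
  constructor
  · rintro ⟨f, hf, h1, h2⟩
    by_cases h : S.restr (Ioi S.c) f = 0
    · exact Or.inr ⟨_, fun h' => hf (S.eq_zero_of_restr h h'), h2⟩
    · exact Or.inl ⟨_, h, h1⟩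
  · rintro (⟨f, hf, h⟩ | ⟨f, hf, h⟩)
    · obtain ⟨F, rfl, hF⟩ := exists_restr_eq isHalfLine_Ioi f
      refine ⟨F, fun h0 => hf (by rw [h0, map_zero]), h, ?_⟩
      rw [hF _ hd measurableSet_Iio, smul_zero]
      exact zero_mem _
    · obtain ⟨F, rfl, hF⟩ := exists_restr_eq isHalfLine_Iio f
      refine ⟨F, fun h0 => hf (by rw [h0, map_zero]), ?_, h⟩
      rw [hF _ hd.symm measurableSet_Ioi, smul_zero]
      exact zero_mem _

/-- Two elements of the domain with the same Cauchy data at `c` can be glued at `c`. -/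
lemma InD.exists_glue {u v g u' v' g' : ℝ → ℂ} (h : S.InD u v g) (h' : S.InD u' v' g')
    (hu : u S.c = u' S.c) (hv : v S.c = v' S.c) : ∃ w y k, S.InD w y k ∧
      (∀ x ∈ Ioi S.c, w x = u x ∧ k x = g x) ∧ (∀ x ∈ Iio S.c, w x = u' x ∧ k x = g' x) := by
  refine ⟨_, _, _, h'.add ((h.sub h').indicator isHalfLine_Ioi (by simp [hu]) (by simp [hv])),
    fun x hx => ?_, fun x hx => ?_⟩
  · simp [indicator_of_mem hx]
  · have : x ∉ Ioi S.c := fun h1 : S.c < x => lt_asymm h1 hx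
    simp [indicator_of_notMem this]

lemma HasCoupledSolution.of_isWeylSolution {z z' : ℂ} {u v u' v' : ℝ → ℂ}
    (h : S.IsWeylSolution (Ioi S.c) z u v) (h' : S.IsWeylSolution (Iio S.c) z' u' v')
    (hu : u S.c = u' S.c) (hv : v S.c = v' S.c) : S.HasCoupledSolution z z' := by
  obtain ⟨g, hD, hg, x, hx, hne⟩ := h
  obtain ⟨g', hD', hg', -⟩ := h'
  obtain ⟨w, y, k, hw, hr, hl⟩ := hD.exists_glue hD' hu hv
  refine ⟨w, y, k, hw, ?_, ?_, x, by rwa [(hr x hx).1]⟩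
  · filter_upwards [hg] with t ht hts
    rw [(hr t hts).1, (hr t hts).2, ht hts]
  · filter_upwards [hg'] with t ht hts
    rw [(hl t hts).1, (hl t hts).2, ht hts]

lemma IsWeylSolution.const_smul {s : Set ℝ} {z k : ℂ} {u v : ℝ → ℂ}
    (h : S.IsWeylSolution s z u v) (hk : k ≠ 0) : S.IsWeylSolution s z (k • u) (k • v) := by
  obtain ⟨g, hD, hg, x, hx, hne⟩ := h
  refine ⟨_, hD.const_smul k, ?_, x, hx, by simpa [hk] using hne⟩
  filter_upwards [hg] with t ht hts
  simp only [Pi.smul_apply, smul_eq_mul, ht hts]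
  ring

/-- A Dirichlet eigenvalue admits no solution with `u(c) ≠ 0`, by Green's identity. -/
lemma LeftDefinite.notMem_opPointSpectrum (hS : S.LeftDefinite) {s : Set ℝ} {ε : ℂ}
    (hs : S.IsHalfLine s ε) {z : ℂ} {u v g : ℝ → ℂ} (h : S.InD u v g)
    (hg : ∀ᵐ x, x ∈ s → g x = z * u x) (hu : u S.c ≠ 0) :
    z ∉ opPointSpectrum (S.dirichlet s) := by
  intro hz
  obtain ⟨t, -, rfl⟩ := hS.eigenvalue_dirichlet_pos hs hz
  obtain ⟨e, y, hW, hc⟩ := (mem_opPointSpectrum_dirichlet_iff hs).1 hz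
  have hy := hW.ne_zero_of_eq_zero hs hc
  obtain ⟨k, hD, hk, -⟩ := hW
  have hgr := hS.green hs hD h
  have e1 : ∫ x in s, starRingEnd ℂ (k x) * u x ∂S.μ =
      ∫ x in s, starRingEnd ℂ (e x) * g x ∂S.μ := by
    refine integral_congr_ae ?_
    filter_upwards [(ae_mu_restrict_iff hs.measurableSet).2 hk,
      (ae_mu_restrict_iff hs.measurableSet).2 hg] with x h1 h2
    rw [h1, h2, map_mul, Complex.conj_ofReal]
    ring
  rw [e1, sub_self, hc, map_zero, zero_mul, sub_zero] at hgr
  have := mul_ne_zero hs.ne_zero (mul_ne_zero ((map_ne_zero (starRingEnd ℂ)).2 hy) hu)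
  exact this hgr.symm

/-- A coupled solution either does not vanish at `c`, and then the Weyl functions agree, or it
consists of Dirichlet eigenfunctions on both sides. -/
lemma LeftDefinite.hasCoupledSolution_iff (hS : S.LeftDefinite) {z z' : ℂ}
    (hc : (LinearMap.range (opShift S.Bplus z)).CoFG)
    (hc' : (LinearMap.range (opShift S.Bminus z')).CoFG) :
    S.HasCoupledSolution z z' ↔
      (z ∈ opResolventSet S.Bplus ∧ z' ∈ opResolventSet S.Bminus ∧ S.mPlus z = S.mMinus z') ∨
      (z ∈ opPointSpectrum S.Bplus ∧ z' ∈ opPointSpectrum S.Bminus) := by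
  have hr := isHalfLine_Ioi (S := S)
  have hl := isHalfLine_Iio (S := S)
  constructor
  · rintro ⟨u, v, g, hD, h1, h2, x, hx⟩
    by_cases hu : u S.c = 0
    · right
      have hv : v S.c ≠ 0 := by
        intro hv
        apply hx
        rcases lt_trichotomy x S.c with h | h | h
        · exact hD.eq_zero_on hl h2 hu hv x h
        · rw [h, hu]
        · exact hD.eq_zero_on hr h1 hu hv x h
      exact ⟨(mem_opPointSpectrum_dirichlet_iff hr).2
          ⟨u, v, hD.isWeylSolution hr h1 (Or.inr hv), hu⟩,
        (mem_opPointSpectrum_dirichlet_iff hl).2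
          ⟨u, v, hD.isWeylSolution hl h2 (Or.inr hv), hu⟩⟩
    · left
      have n1 := hS.notMem_opPointSpectrum hr hD h1 hu
      have n2 := hS.notMem_opPointSpectrum hl hD h2 hu
      refine ⟨hS.mem_opResolventSet_of_cofg hr hc n1, hS.mem_opResolventSet_of_cofg hl hc' n2, ?_⟩
      rw [mPlus, mMinus, (hD.isWeylSolution hr h1 (Or.inl hu)).titchmarshWeyl_eq hr n1,
        (hD.isWeylSolution hl h2 (Or.inl hu)).titchmarshWeyl_eq hl n2]
  · rintro (⟨h1, h2, hm⟩ | ⟨h1, h2⟩)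
    · obtain ⟨u, v, hW, hu, hv⟩ := hS.exists_isWeylSolution hr h1
      obtain ⟨u', v', hW', hu', hv'⟩ := hS.exists_isWeylSolution hl h2
      exact .of_isWeylSolution hW hW' (hu.trans hu'.symm) (hv.trans (hm.trans hv'.symm))
    · obtain ⟨u, v, hW, hu⟩ := (mem_opPointSpectrum_dirichlet_iff hr).1 h1
      obtain ⟨u', v', hW', hu'⟩ := (mem_opPointSpectrum_dirichlet_iff hl).1 h2
      refine .of_isWeylSolution (hW.const_smul (hW'.ne_zero_of_eq_zero hl hu'))
        (hW'.const_smul (hW.ne_zero_of_eq_zero hr hu)) ?_ ?_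
      · simp [hu, hu']
      · simp [mul_comm]

/-! ### Essential spectra -/

lemma LeftDefinite.cofg_of_notMem_opEssSpectrum_A (hS : S.LeftDefinite) {s : Set ℝ} {ε : ℂ}
    (hs : S.IsHalfLine s ε) {z : ℂ} (hz : z ∉ opEssSpectrum S.A) :
    (LinearMap.range (opShift (S.dirichlet s) z)).CoFG := by
  obtain ⟨-, -, hL⟩ := not_not.1 hz
  refine hS.cofg_of_restr hs hL ?_
  rintro _ ⟨f, rfl⟩
  obtain ⟨u, v, g, hD, e1, e2⟩ := mem_A_graph_iff.1 (S.A.mem_graph f)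
  refine ⟨u, v, g, hD, 1, (restr_coeFn s _).trans ?_⟩
  rw [opShift_apply]
  filter_upwards [ae_restrict_of_ae (s := s) (Lp.coeFn_sub (S.A f) (z • (f : S.H))),
    ae_restrict_of_ae (s := s) (Lp.coeFn_smul z (f : S.H)), ae_restrict_of_ae (s := s) e1,
    ae_restrict_of_ae (s := s) e2] with x h1 h2 h3 h4
  rw [h1, Pi.sub_apply, h2, Pi.smul_apply, h3, h4, one_smul]
  rfl

/-- On the half-line with sign `ε` the operator `JA - z` acts as `ε (ℓ - ε z)`. -/
lemma LeftDefinite.cofg_of_notMem_opEssSpectrum_JA (hS : S.LeftDefinite) {s : Set ℝ} {ε : ℂ}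
    (hs : S.IsHalfLine s ε) {z : ℂ} (hz : z ∉ opEssSpectrum S.JA) :
    (LinearMap.range (opShift (S.dirichlet s) (ε * z))).CoFG := by
  obtain ⟨-, -, hL⟩ := not_not.1 hz
  refine hS.cofg_of_restr hs hL ?_
  rintro _ ⟨f, rfl⟩
  obtain ⟨k, hk, hJ⟩ := mem_JA_graph_iff.1 (S.JA.mem_graph f)
  obtain ⟨u, v, g, hD, e1, e2⟩ := mem_A_graph_iff.1 hk
  refine ⟨u, v, g, hD, ε, (restr_coeFn s _).trans ?_⟩
  rw [opShift_apply, hJ]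
  have hε : ε * ε = 1 := by rcases hs with ⟨-, rfl⟩ | ⟨-, rfl⟩ <;> norm_num
  have hsign : ∀ᵐ x, x ∈ s → ((Real.sign (S.r x) : ℝ) : ℂ) = ε := by
    rcases hs with ⟨rfl, rfl⟩ | ⟨rfl, rfl⟩
    · exact ae_sign_eq_one
    · exact ae_sign_eq_neg_one
  filter_upwards [ae_restrict_of_ae (s := s) (Lp.coeFn_sub (S.J k) (z • (f : S.H))),
    ae_restrict_of_ae (s := s) (Lp.coeFn_smul z (f : S.H)), ae_restrict_of_ae (s := s) e1,
    ae_restrict_of_ae (s := s) e2, ae_restrict_of_ae (s := s) (J_coeFn k),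
    (ae_mu_restrict_iff (S := S) hs.measurableSet).2 hsign] with x h1 h2 h3 h4 h5 h6
  rw [h1, Pi.sub_apply, h2, Pi.smul_apply, h3, h5, h4, h6]
  simp only [Pi.smul_apply, Pi.sub_apply, smul_eq_mul]
  linear_combination (z * u x) * hε

/-! ### Zeros and poles of `M` -/

lemma LeftDefinite.mem_domM_iff (hS : S.LeftDefinite) {z : ℂ} :
    z ∈ S.domM ↔ z ∈ opResolventSet S.Bplus ∧ -z ∈ opResolventSet S.Bminus :=
  and_congr_right' (hS.mem_opResolventSet_neg isHalfLine_Iio)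

/-- `B₊` and `-B₋` have no common eigenvalue, since the eigenvalues of `B₊` and of `B₋` are
positive. -/
lemma LeftDefinite.not_mem_opPointSpectrum_and (hS : S.LeftDefinite) {z : ℂ} :
    ¬ (z ∈ opPointSpectrum S.Bplus ∧ -z ∈ opPointSpectrum S.Bminus) := by
  rintro ⟨h1, h2⟩
  obtain ⟨t, ht, rfl⟩ := hS.eigenvalue_dirichlet_pos isHalfLine_Ioi h1
  obtain ⟨t', ht', h⟩ := hS.eigenvalue_dirichlet_pos isHalfLine_Iio h2
  have : -t = t' := by exact_mod_cast h
  linarith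

lemma tendsto_neg_nhdsNE (z : ℂ) : Tendsto (fun w : ℂ => -w) (𝓝[≠] z) (𝓝[≠] (-z)) := by
  refine tendsto_nhdsWithin_iff.2
    ⟨continuous_neg.continuousAt.tendsto.mono_left nhdsWithin_le_nhds, ?_⟩
  filter_upwards [self_mem_nhdsWithin] with w hw h
  exact hw (neg_injective h)

lemma LeftDefinite.isPoleOf_M_iff (hS : S.LeftDefinite) {z : ℂ}
    (hc : (LinearMap.range (opShift S.Bplus z)).CoFG)
    (hc' : (LinearMap.range (opShift S.Bminus (-z))).CoFG) :
    IsPoleOf S.domM S.M z ↔ z ∈ opPointSpectrum S.Bplus ∨ -z ∈ opPointSpectrum S.Bminus := by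
  have hr := isHalfLine_Ioi (S := S)
  have hl := isHalfLine_Iio (S := S)
  have han : -z ∈ opResolventSet S.Bminus → AnalyticAt ℂ (fun w => S.mMinus (-w)) z := by
    intro h
    have h1 : AnalyticAt ℂ S.mMinus (-z) := hS.analyticAt_titchmarshWeyl hl h
    exact AnalyticAt.comp (f := fun w : ℂ => -w) h1 (by fun_prop)
  constructor
  · intro hp
    by_contra! hcon
    have h1 : AnalyticAt ℂ S.mPlus z :=
      hS.analyticAt_titchmarshWeyl hr (hS.mem_opResolventSet_of_cofg hr hc hcon.1)
    exact not_isPoleOf_of_analyticAt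
      (h1.fun_sub (han (hS.mem_opResolventSet_of_cofg hl hc' hcon.2))) hp
  · rintro (hz | hz)
    · have hρ : -z ∈ opResolventSet S.Bminus := hS.mem_opResolventSet_of_cofg hl hc'
        fun h => hS.not_mem_opPointSpectrum_and ⟨hz, h⟩
      obtain ⟨hU, h, κ, hh, hκ, hev⟩ := hS.exists_titchmarshWeyl_eq_add_div hr hc hz
      refine isPoleOf_of_eventually_eq ?_ (hh.fun_sub (han hρ)) hκ ?_
      · have hU' : ∀ᶠ w in 𝓝[≠] z, -w ∈ opResolventSet S.Bminus :=
          (continuous_neg.continuousAt.eventually_mem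
            ((hS.isOpen_opResolventSet hl).mem_nhds hρ)).filter_mono nhdsWithin_le_nhds
        filter_upwards [hU, hU'] with w h1 h2 using hS.mem_domM_iff.2 ⟨h1, h2⟩
      · filter_upwards [hev] with w hw
        rw [M, mPlus, hw]
        ring
    · have hρ : z ∈ opResolventSet S.Bplus := hS.mem_opResolventSet_of_cofg hr hc
        fun h => hS.not_mem_opPointSpectrum_and ⟨h, hz⟩
      obtain ⟨hU, h, κ, hh, hκ, hev⟩ := hS.exists_titchmarshWeyl_eq_add_div hl hc' hz
      have h1 : AnalyticAt ℂ S.mPlus z := hS.analyticAt_titchmarshWeyl hr hρ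
      have h2 : AnalyticAt ℂ (fun w => h (-w)) z :=
        AnalyticAt.comp (f := fun w : ℂ => -w) hh (by fun_prop)
      refine isPoleOf_of_eventually_eq ?_ (h1.fun_sub h2) hκ ?_
      · have hU' : ∀ᶠ w in 𝓝[≠] z, w ∈ opResolventSet S.Bplus :=
          nhdsWithin_le_nhds ((hS.isOpen_opResolventSet hr).mem_nhds hρ)
        filter_upwards [(tendsto_neg_nhdsNE z).eventually hU, hU'] with w h1 h2
          using hS.mem_domM_iff.2 ⟨h2, h1⟩
      · filter_upwards [(tendsto_neg_nhdsNE z).eventually hev, self_mem_nhdsWithin] with w hw hne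
        have e1 : w - z ≠ 0 := sub_ne_zero.2 hne
        have e2 : -w - -z ≠ 0 := by
          rw [show -w - -z = -(w - z) by ring]
          exact neg_ne_zero.2 e1
        rw [M, mMinus, hw, show -w - -z = -(w - z) by ring, div_neg]
        ring

end SLCoeff

end

theorem proposition3p3 (S : SLCoeff) (hS : S.LeftDefinite) :
    (∀ z : ℂ, z ∉ opEssSpectrum S.JA →
      (z ∈ opPointSpectrum S.JA ↔ IsZeroOf S.domM S.M z) ∧
      (z ∈ opPointSpectrum S.JB ↔ IsPoleOf S.domM S.M z)) ∧
    (∀ z : ℂ, z ∉ opEssSpectrum S.A →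
      (z ∈ opPointSpectrum S.A ↔
        (IsZeroOf (opResolventSet S.Bplus ∩ opResolventSet S.Bminus)
            (fun w => S.mPlus w - S.mMinus w) z ∨
          (IsPoleOf (opResolventSet S.Bplus) S.mPlus z ∧
            IsPoleOf (opResolventSet S.Bminus) S.mMinus z))) ∧
      (z ∈ opPointSpectrum S.B ↔
        (IsPoleOf (opResolventSet S.Bplus) S.mPlus z ∨
          IsPoleOf (opResolventSet S.Bminus) S.mMinus z))) := by
  have hr := SLCoeff.isHalfLine_Ioi (S := S)
  have hl := SLCoeff.isHalfLine_Iio (S := S)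
  refine ⟨fun z hz => ?_, fun z hz => ?_⟩
  · have hc : (LinearMap.range (opShift S.Bplus z)).CoFG := by
      have := hS.cofg_of_notMem_opEssSpectrum_JA hr hz
      rwa [one_mul] at this
    have hc' : (LinearMap.range (opShift S.Bminus (-z))).CoFG := by
      have := hS.cofg_of_notMem_opEssSpectrum_JA hl hz
      rwa [neg_one_mul] at this
    constructor
    · rw [SLCoeff.mem_opPointSpectrum_JA_iff, hS.hasCoupledSolution_iff hc hc',
        or_iff_left hS.not_mem_opPointSpectrum_and, IsZeroOf, hS.mem_domM_iff, SLCoeff.M,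
        sub_eq_zero, and_assoc]
    · rw [hS.isPoleOf_M_iff hc hc', SLCoeff.JB, SLCoeff.mem_opPointSpectrum_orthSum_iff,
        mem_opPointSpectrum_neg_iff]
  · have hc : (LinearMap.range (opShift S.Bplus z)).CoFG :=
      hS.cofg_of_notMem_opEssSpectrum_A hr hz
    have hc' : (LinearMap.range (opShift S.Bminus z)).CoFG :=
      hS.cofg_of_notMem_opEssSpectrum_A hl hz
    have hp : IsPoleOf (opResolventSet S.Bplus) S.mPlus z ↔ z ∈ opPointSpectrum S.Bplus :=
      hS.isPoleOf_titchmarshWeyl_iff hr hc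
    have hp' : IsPoleOf (opResolventSet S.Bminus) S.mMinus z ↔ z ∈ opPointSpectrum S.Bminus :=
      hS.isPoleOf_titchmarshWeyl_iff hl hc'
    constructor
    · rw [SLCoeff.mem_opPointSpectrum_A_iff, hS.hasCoupledSolution_iff hc hc', hp, hp', IsZeroOf,
        mem_inter_iff, sub_eq_zero, and_assoc]
    · rw [hp, hp', SLCoeff.B, SLCoeff.mem_opPointSpectrum_orthSum_iff]
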